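/- **Setting.** Let $m,n\ge 1$, $N=mn$, and $$P(x)=\frac1N\sum_{\tau=1}^n\sum_{i=1}^m\phi_{i\tau}(A_{i\tau}^\top x)+g(x),\qquad x\in\mathbb R^d,\ A_{i\tau}\in\mathbb R^{d\times t},$$ where each $\phi_{i\tau}:\mathbb R^t\to\mathbb R$ is convex, $1/\gamma$-smooth ($\gamma>0$) and bounded below, and $g:\mathbb R^d\to\mathbb R$ is $\lambda$-strongly convex ($\lambda>0$). Let $Q$ be a randomized map with $\mathbb E\|x-Q(x)\|^2\le(1-\delta)\|x\|^2$ for all $x$, where $0<\delta<1$. Put $R_m=\max_{i,\tau}\|A_{i\tau}\|$, $\bar R^2=\max_\tau\frac1m\lambda_{\max}(\sum_iA_{i\tau}A_{i\tau}^\top)$, $R^2=\frac1N\lambda_{\max}(\sum_{\tau,i}A_{i\tau}A_{i\tau}^\top)$, $$a_3=\frac{R_m^2}{n\gamma}+\frac{R^2}{\gamma}+\frac{\sqrt{1-\delta}R\bar R}{\delta\gamma}+\frac{\sqrt{1-\delta}RR_m}{\sqrt\delta\gamma},\qquad b_3=\frac1\delta\sqrt{\frac{(1-\delta)(\bar R^2+\delta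 R_m^2)}{\gamma}}.$$ **Outer method (Catalyst).** Let $\kappa\ge0$, $q=\lambda/(\lambda+\kappa)$, $0<\rho_0<\sqrt q$, $y^0=x^0$ with $P(x^0)>P^*=\min P$, and $\epsilon_k=\frac29(P(x^0)-P^*)(1-\rho_0)^k$. For $k\ge1$ the inner method is run on $G_k(x)=P(x)+\frac\kappa2\|x-y^{k-1}\|^2$, with minimum $G_k^*$, and returns $x^k$. Then $y^k=x^k+\beta_k(x^k-x^{k-1})$ with $\beta_k=\frac{\omega_{k-1}(1-\omega_{k-1})}{\omega_{k-1}^2+\omega_k}$, where $\omega_0=\sqrt q$ and $\omega_k$ is the positive root of $\omega_k^2=(1-\omega_k)\omega_{k-1}^2+q\omega_k$. **Inner method (EC-SDCA).** Let $\xi_k(x)=(g(x)+\frac\kappa2\|x-y^{k-1}\|^2)/(\lambda+\kappa)$ and $\theta=\frac18\bigl(m+\frac{a_3}{\lambda+\kappa}+\frac{b_3}{\sqrt{\lambda+\kappa}}\bigr)^{-1}$. In iteration $K\ge 0$ set $x^{K+1}=\nabla\xi_k^*(u^K)$. Every node $\tau$ samples $i$ uniformly from $\{1,\dots,m\}$,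 sets $\Delta=-\theta m\,(\alpha_{i\tau}^K+\nabla\phi_{i\tau}(A_{i\tau}^\top x^{K+1}))$ and $\alpha_{i\tau}^{K+1}=\alpha_{i\tau}^K+\Delta$, leaves its other dual variables unchanged, sends the compressed vector $z_\tau=Q\bigl(\frac{1}{(\lambda+\kappa)m}A_{i\tau}\Delta+e_\tau^K\bigr)$, and sets $e_\tau^{K+1}=e_\tau^K+\frac{1}{(\lambda+\kappa)m}A_{i\tau}\Delta-z_\tau$. Then $u^{K+1}=u^K+\frac1n\sum_\tau z_\tau$. All samples and compressor randomness are independent over nodes and iterations. Put $e^K=\frac1n\sum_\tau e_\tau^K$. Let $D_k(\alpha)=-\frac1N\sum_{\tau,i}\phi_{i\tau}^*(-\alpha_{i\tau})-(\lambda+\kappa)\,\xi_k^*\Bigl(\frac{1}{(\lambda+\kappa)N}\sum_{\tau,i}A_{i\tau}\alpha_{i\tau}\Bigr)$ be the dual objective, $\epsilon_{D,(k)}^K=G_k^*-D_k(\alpha^K)$, and $$\Psi_{3,(k)}^K=\epsilon_{D,(k)}^K+\frac{2(\rho+\theta(\lambda+\kappa))}{\delta n}\sum_\tau\|e_\tau^K\|^2,\qquad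 \rho=\frac{\delta(\lambda+\kappa)R}{2\sqrt{(1-\delta)(2\bar R^2+\delta R_m^2)}}$$ ($\rho=0$ if all $A_{i\tau}=0$). The inner loop stops at $$T_k=\inf\{K\ge1:\ \sqrt{4n+\delta mn}\,\Psi_{3,(k)}^K+2(G_k(x_{(k)}^{K+1})-G_k^*)\le\epsilon_k\}$$ and returns $x^k=x_{(k)}^{T_k+1}$. Each later inner loop is warm-started by carrying over $\alpha$, $u$ and all $e_\tau$ from the last state of the previous one; the first starts from $\alpha=0$, $u=0$, $e_\tau=0$. **Claim.** There is a universal constant $C>0$ such that in every such situation the following holds. Write $$B=\frac1\delta+m+\frac{a_3}{\lambda+\kappa}+\frac{b_3}{\sqrt{\lambda+\kappa}},\quad \mathcal L=1+\log\frac{N\,B\,(\lambda+\kappa)}{\lambda(\sqrt q-\rho_0)},\quad \mathcal L_0=\log\Bigl(1+\frac{\epsilon_{D,(1)}^0}{\epsilon_1}\Bigr).$$ 1. For all $k\ge1$, $K\ge0$: $u_{(k)}^K+e_{(k)}^K=\frac{1}{(\lambda+\kappa)N}\sum_{\tau,i}A_{i\tau}\alpha_{i\tau,(k)}^K$, and no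 uncompressed vector is ever sent. 2. $\mathbb E[T_k]\le C\,B\,\mathcal L$ for all $k\ge2$, and $\mathbb E[T_1]\le C\,B\,(\mathcal L+\mathcal L_0)$. That is, $\mathbb E[T_k]\le\tilde{\mathcal O}\bigl(\frac1\delta+m+\frac{a_3}{\lambda+\kappa}+\frac{b_3}{\sqrt{\lambda+\kappa}}\bigr)$. 3. Suppose $\rho_0\ge\frac12\sqrt q$, and let a compressed vector cost $r_Q\ge0$ and an uncompressed one $U_d\ge0$. For every $0<\epsilon\le P(x^0)-P^*$ there is a number $k$ of outer loops after which $P(x^k)-P^*\le\epsilon$ almost surely, and the expected communication cost per node of these $k$ loops is at most $$C\,\frac{r_Q}{\sqrt\lambda}\Bigl(\bigl(\tfrac1\delta+m\bigr)\sqrt{\lambda+\kappa}+\frac{a_3}{\sqrt{\lambda+\kappa}}+b_3\Bigr)\mathcal L^2\Bigl(1+\log\frac{P(x^0)-P^*}{\epsilon}+\mathcal L_0\Bigr),$$ with no dependence on $U_d$. -/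

import Mathlib

open MeasureTheory ProbabilityTheory
open scoped ENNReal NNReal

noncomputable section

/-- The Euclidean space `ℝ^d`. -/
abbrev Vec (d : ℕ) : Type := EuclideanSpace ℝ (Fin d)

/-- Fenchel conjugate `f*(u) = sup_x (⟨x, u⟩ - f x)`, possibly `+∞`. -/
def fenchelConj {d : ℕ} (f : Vec d → ℝ) (u : Vec d) : EReal :=
  ⨆ x : Vec d, ((inner ℝ x u - f x : ℝ) : EReal)

/-- The regularized finite-sum problem
`min_x P(x) = (1/N) ∑_τ ∑_i φ_{iτ}(A_{iτ}ᵀ x) + g(x)`, `N = m n`: each `φ_{iτ}` is convex,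
`1/γ`-smooth and bounded below, and `g` is `λ`-strongly convex. The matrix `A_{iτ} ∈ ℝ^{d×t}` is
`A τ i`, and `φ_{iτ}` is `φ τ i`. -/
structure SumProblem (d t n m : ℕ) where
  φ : Fin n → Fin m → Vec t → ℝ
  A : Fin n → Fin m → Vec t →L[ℝ] Vec d
  g : Vec d → ℝ
  lam : ℝ
  gam : ℝ
  n_pos : 0 < n
  m_pos : 0 < m
  lam_pos : 0 < lam
  gam_pos : 0 < gam
  φ_convex : ∀ τ i, ConvexOn ℝ Set.univ (φ τ i)
  φ_differentiable : ∀ τ i, Differentiable ℝ (φ τ i)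
  φ_smooth : ∀ τ i z w, ‖gradient (φ τ i) z - gradient (φ τ i) w‖ ≤ (1 / gam) * ‖z - w‖
  φ_bddBelow : ∀ τ i, BddBelow (Set.range (φ τ i))
  g_strongConvex : StrongConvexOn Set.univ lam g

/-- A randomized map `Q : ℝ^d → ℝ^d`, whose randomness is a seed with law `ν`, is a contraction
compressor with parameter `δ`. -/
structure IsContractionCompressor {d : ℕ} {S : Type*} [MeasurableSpace S] (ν : Measure S)
    (Q : Vec d → S → Vec d) (δ : ℝ) : Prop where
  measurable : Measurable (Function.uncurry Q)
  integrable : ∀ x, Integrable (fun s => ‖x - Q x s‖ ^ 2) ν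
  contraction : ∀ x, ∫ s, ‖x - Q x s‖ ^ 2 ∂ν ≤ (1 - δ) * ‖x‖ ^ 2

/-- The weights of Catalyst: `α_0 = √q`, and `α_k` is the positive root of
`α_k² = (1 - α_k) α_{k-1}² + q α_k`. -/
def catalystWeight (q : ℝ) : ℕ → ℝ
  | 0 => Real.sqrt q
  | k + 1 => ((q - catalystWeight q k ^ 2)
      + Real.sqrt ((q - catalystWeight q k ^ 2) ^ 2 + 4 * catalystWeight q k ^ 2)) / 2

theorem catalystWeight_eq (q : ℝ) (k : ℕ) :
    catalystWeight q (k + 1) ^ 2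
      = (1 - catalystWeight q (k + 1)) * catalystWeight q k ^ 2
        + q * catalystWeight q (k + 1) := by
  have h : (0 : ℝ) ≤ (q - catalystWeight q k ^ 2) ^ 2 + 4 * catalystWeight q k ^ 2 := by positivity
  have h2 := Real.sq_sqrt h
  simp only [catalystWeight]
  nlinarith [h2]

/-- The extrapolation parameters `β_k` of Catalyst, `k ≥ 1`. -/
def catalystBeta (q : ℝ) (k : ℕ) : ℝ :=
  catalystWeight q (k - 1) * (1 - catalystWeight q (k - 1))
    / (catalystWeight q (k - 1) ^ 2 + catalystWeight q k)

/-- The state of EC-SDCA: the dual variables `α_{iτ}`, the shared vector `u`, the local errors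
`e_τ`, and a ledger with the number of compressed and of uncompressed vectors of `ℝ^d` that
each node has sent so far. -/
structure SDCAState (d t n m : ℕ) where
  α : Fin n → Fin m → Vec t
  u : Vec d
  e : Fin n → Vec d
  compressedSent : ℕ
  uncompressedSent : ℕ

/-- The state before any communication: `α = 0`, `u = 0`, `e_τ = 0`. -/
def SDCAState.zero (d t n m : ℕ) : SDCAState d t n m := ⟨0, 0, 0, 0, 0⟩

/-- The outer state of Catalyst after `k` outer loops: `x^k`, `y^k` and the state in which the
last inner loop stopped. -/
structure OuterState (d t n m : ℕ) where
  x : Vec d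
  y : Vec d
  s : SDCAState d t n m

namespace SumProblem

variable {d t n m : ℕ} (p : SumProblem d t n m)

/-- The objective `P`. -/
def obj (x : Vec d) : ℝ :=
  (1 / ((m : ℝ) * n)) * (∑ τ, ∑ i, p.φ τ i ((p.A τ i).adjoint x)) + p.g x

/-- The minimum `P*` of `P`. -/
def optVal : ℝ := ⨅ x, p.obj x

/-- The objective `P(x) + (κ/2) ‖x - y‖²` of the subproblem with prox-center `y`. -/
def subObj (κ : ℝ) (y x : Vec d) : ℝ := p.obj x + κ / 2 * ‖x - y‖ ^ 2

/-- The minimum of the subproblem. -/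
def subOpt (κ : ℝ) (y : Vec d) : ℝ := ⨅ x, p.subObj κ y x

/-- The 1-strongly convex regularizer of the subproblem,
`ξ_k(x) = (g(x) + (κ/2) ‖x - y‖²) / (λ + κ)`. -/
def subReg (κ : ℝ) (y x : Vec d) : ℝ := (p.g x + κ / 2 * ‖x - y‖ ^ 2) / (p.lam + κ)

/-- `v(α) = (1/((λ+κ) N)) ∑_τ ∑_i A_{iτ} α_{iτ}`. -/
def dualToPrimal (κ : ℝ) (α : Fin n → Fin m → Vec t) : Vec d :=
  (1 / ((p.lam + κ) * ((m : ℝ) * n))) • ∑ τ, ∑ i, p.A τ i (α τ i)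

/-- The dual objective of the subproblem,
`D(α) = -(1/N) ∑_τ ∑_i φ_{iτ}*(-α_{iτ}) - (λ+κ) ξ_k*(v(α))`. -/
def dualObj (κ : ℝ) (y : Vec d) (α : Fin n → Fin m → Vec t) : EReal :=
  -(((1 / ((m : ℝ) * n) : ℝ) : EReal) * ∑ τ, ∑ i, fenchelConj (p.φ τ i) (-(α τ i)))
    - ((p.lam + κ : ℝ) : EReal) * fenchelConj (p.subReg κ y) (p.dualToPrimal κ α)

/-- The dual suboptimality `ε_D(α) = G* - D(α)`. -/
def dualGap (κ : ℝ) (y : Vec d) (α : Fin n → Fin m → Vec t) : EReal :=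
  ((p.subOpt κ y : ℝ) : EReal) - p.dualObj κ y α

/-- `∇ξ_k*(u)`. -/
def primalPoint (κ : ℝ) (y u : Vec d) : Vec d :=
  gradient (fun w => (fenchelConj (p.subReg κ y) w).toReal) u

/-- `R_m = max_{i,τ} ‖A_{iτ}‖`, spectral norm. -/
def Rm : ℝ := ⨆ τ, ⨆ i, ‖p.A τ i‖

/-- `R̄`, where `R̄² = max_τ (1/m) λ_max(∑_i A_{iτ} A_{iτ}ᵀ)`; the largest eigenvalue of a
positive semidefinite operator is its operator norm. -/
def Rbar : ℝ := Real.sqrt (⨆ τ, (1 / (m : ℝ)) * ‖∑ i, p.A τ i ∘L (p.A τ i).adjoint‖)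

/-- `R`, where `R² = (1/N) λ_max(∑_τ ∑_i A_{iτ} A_{iτ}ᵀ)`. -/
def R : ℝ := Real.sqrt ((1 / ((m : ℝ) * n)) * ‖∑ τ, ∑ i, p.A τ i ∘L (p.A τ i).adjoint‖)

/-- `a₃ = R_m²/(nγ) + R²/γ + √(1-δ) R R̄/(δγ) + √(1-δ) R R_m/(√δ γ)`. -/
def a3 (δ : ℝ) : ℝ :=
  p.Rm ^ 2 / (n * p.gam) + p.R ^ 2 / p.gam + Real.sqrt (1 - δ) * p.R * p.Rbar / (δ * p.gam)
    + Real.sqrt (1 - δ) * p.R * p.Rm / (Real.sqrt δ * p.gam)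

/-- `b₃ = (1/δ) √((1-δ)(R̄² + δ R_m²)/γ)`. -/
def b3 (δ : ℝ) : ℝ :=
  (1 / δ) * Real.sqrt ((1 - δ) * (p.Rbar ^ 2 + δ * p.Rm ^ 2) / p.gam)

/-- The complexity `1/δ + m + a₃/(λ+κ) + b₃/√(λ+κ)`. -/
def rate (κ δ : ℝ) : ℝ :=
  1 / δ + m + p.a3 δ / (p.lam + κ) + p.b3 δ / Real.sqrt (p.lam + κ)

/-- The step size `θ` of EC-SDCA. -/
def stepSize (κ δ : ℝ) : ℝ :=
  1 / (8 * (m + p.a3 δ / (p.lam + κ) + p.b3 δ / Real.sqrt (p.lam + κ)))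

/-- `ρ = δ (λ+κ) R / (2 √((1-δ)(2R̄² + δ R_m²)))` (zero when all `A_{iτ}` vanish). -/
def rho (κ δ : ℝ) : ℝ :=
  δ * (p.lam + κ) * p.R / (2 * Real.sqrt ((1 - δ) * (2 * p.Rbar ^ 2 + δ * p.Rm ^ 2)))

/-- The Lyapunov function
`Ψ₃ = ε_D(α) + (2(ρ + θ(λ+κ))/(δ n)) ∑_τ ‖e_τ‖²` of EC-SDCA. -/
def lyapunov (κ δ : ℝ) (y : Vec d) (s : SDCAState d t n m) : EReal :=
  p.dualGap κ y s.α
    + ((2 * (p.rho κ δ + p.stepSize κ δ * (p.lam + κ)) / (δ * n) * ∑ τ, ‖s.e τ‖ ^ 2 : ℝ) : EReal)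

/-- One iteration of EC-SDCA on the subproblem with prox-center `y`. In `draw τ`, the first
component is the sampled index and the second one is the seed of the compressor at node `τ`. -/
def step {S : Type*} (Q : Vec d → S → Vec d) (κ δ : ℝ) (y : Vec d)
    (draw : Fin n → Fin m × S) (s : SDCAState d t n m) : SDCAState d t n m :=
  let x : Vec d := p.primalPoint κ y s.u
  let Δ : Fin n → Vec t := fun τ =>
    -((p.stepSize κ δ * m) • s.α τ (draw τ).1)
      - (p.stepSize κ δ * m) •
          gradient (p.φ τ (draw τ).1) ((p.A τ (draw τ).1).adjoint x)
  let c : Fin n → Vec d := fun τ =>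
    (1 / ((p.lam + κ) * m)) • p.A τ (draw τ).1 (Δ τ)
  let msg : Fin n → Vec d := fun τ => Q (c τ + s.e τ) (draw τ).2
  { α := fun τ => Function.update (s.α τ) (draw τ).1 (s.α τ (draw τ).1 + Δ τ)
    u := s.u + (1 / (n : ℝ)) • ∑ τ, msg τ
    e := fun τ => s.e τ + c τ - msg τ
    compressedSent := s.compressedSent + 1
    uncompressedSent := s.uncompressedSent }

/-- The state after `K` iterations of EC-SDCA started at `s`. -/
def inner {S : Type*} (Q : Vec d → S → Vec d) (κ δ : ℝ) (y : Vec d)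
    (draw : ℕ → Fin n → Fin m × S) (s : SDCAState d t n m) : ℕ → SDCAState d t n m
  | 0 => s
  | K + 1 => p.step Q κ δ y (draw K) (inner Q κ δ y draw s K)

/-- The stopping criterion
`√(4n + δmn) Ψ₃^K + 2 (G(x^{K+1}) - G*) ≤ ε`, where `x^{K+1} = ∇ξ_k*(u^K)`. -/
def stopCrit (κ δ : ℝ) (y : Vec d) (ε : ℝ) (s : SDCAState d t n m) : Prop :=
  ((Real.sqrt (4 * n + δ * m * n) : ℝ) : EReal) * p.lyapunov κ δ y s
    + ((2 * (p.subObj κ y (p.primalPoint κ y s.u) - p.subOpt κ y) : ℝ) : EReal) ≤ (ε : EReal)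

/-- The first `K ≥ 1` at which the criterion holds, `⊤` if there is none. -/
def stopTime {S : Type*} (Q : Vec d → S → Vec d) (κ δ : ℝ) (y : Vec d) (ε : ℝ)
    (draw : ℕ → Fin n → Fin m × S) (s : SDCAState d t n m) : ℕ∞ :=
  ⨅ K : ℕ, ⨅ _ : 1 ≤ K ∧ p.stopCrit κ δ y ε (p.inner Q κ δ y draw s K), (K : ℕ∞)

/-- `q = λ/(λ+κ)`. -/
def q (κ : ℝ) : ℝ := p.lam / (p.lam + κ)

/-- `ε_k = (2/9) (P(x^0) - P*) (1 - ρ₀)^k`. -/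
def tol (ρ₀ : ℝ) (x₀ : Vec d) (k : ℕ) : ℝ := 2 / 9 * (p.obj x₀ - p.optVal) * (1 - ρ₀) ^ k

/-- Catalyst with EC-SDCA as inner solver. Outer loop `k + 1` starts from the state in which
outer loop `k` stopped (`α`, `u` and all `e_τ` are carried over, nothing is sent), and uses
`draw (k + 1)`. -/
def outer {S : Type*} (Q : Vec d → S → Vec d) (κ δ ρ₀ : ℝ) (x₀ : Vec d)
    (draw : ℕ → ℕ → Fin n → Fin m × S) : ℕ → OuterState d t n m
  | 0 => ⟨x₀, x₀, SDCAState.zero d t n m⟩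
  | k + 1 =>
    let o := outer Q κ δ ρ₀ x₀ draw k
    let T := p.stopTime Q κ δ o.y (p.tol ρ₀ x₀ (k + 1)) (draw (k + 1)) o.s
    let s' := p.inner Q κ δ o.y (draw (k + 1)) o.s T.toNat
    let x' := p.primalPoint κ o.y s'.u
    ⟨x', x' + catalystBeta (p.q κ) (k + 1) • (x' - o.x), s'⟩

/-- The `K`-th inner state of the `k`-th outer loop, `k ≥ 1`. -/
def innerState {S : Type*} (Q : Vec d → S → Vec d) (κ δ ρ₀ : ℝ) (x₀ : Vec d)
    (draw : ℕ → ℕ → Fin n → Fin m × S) (k K : ℕ) : SDCAState d t n m :=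
  let o := p.outer Q κ δ ρ₀ x₀ draw (k - 1)
  p.inner Q κ δ o.y (draw k) o.s K

/-- The number `T_k` of inner iterations of the `k`-th outer loop, `k ≥ 1`. -/
def innerCount {S : Type*} (Q : Vec d → S → Vec d) (κ δ ρ₀ : ℝ) (x₀ : Vec d)
    (draw : ℕ → ℕ → Fin n → Fin m × S) (k : ℕ) : ℕ∞ :=
  let o := p.outer Q κ δ ρ₀ x₀ draw (k - 1)
  p.stopTime Q κ δ o.y (p.tol ρ₀ x₀ k) (draw k) o.s

/-- Communication cost per node of the first `k` outer loops, when a compressed vector costs `rQ`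
and an uncompressed vector of `ℝ^d` costs `Ud`. -/
def commCost {S : Type*} (Q : Vec d → S → Vec d) (κ δ ρ₀ : ℝ) (x₀ : Vec d)
    (draw : ℕ → ℕ → Fin n → Fin m × S) (rQ Ud : ℝ≥0) (k : ℕ) : ℝ≥0∞ :=
  let s := (p.outer Q κ δ ρ₀ x₀ draw k).s
  (s.compressedSent : ℝ≥0∞) * rQ + (s.uncompressedSent : ℝ≥0∞) * Ud

/-- The logarithmic factor `1 + log (N · rate · ((λ+κ)/λ) / (√q - ρ₀))` of the bounds. -/
def logFactor (κ δ ρ₀ : ℝ) : ℝ :=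
  1 + Real.log ((m : ℝ) * n * p.rate κ δ * ((p.lam + κ) / p.lam) / (Real.sqrt (p.q κ) - ρ₀))

/-- The logarithm `log (1 + ε_{D,(1)}^0 / ε_1)` of the initial dual suboptimality. -/
def initLog (κ ρ₀ : ℝ) (x₀ : Vec d) : ℝ :=
  Real.log (1 + (p.dualGap κ x₀ 0).toReal / p.tol ρ₀ x₀ 1)

end SumProblem

/-- The draws of all nodes in all iterations are independent; each consists of a uniform index
in `Fin m` and an independent compressor seed with law `ν`. -/
structure AreDraws {n m : ℕ} {S Ω : Type*} [MeasurableSpace S] [MeasurableSpace Ω]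
    (ν : Measure S) (μ : Measure Ω) (Z : ℕ → ℕ → Fin n → Ω → Fin m × S) : Prop where
  measurable : ∀ k K τ, Measurable (Z k K τ)
  indep : iIndepFun (fun (j : ℕ × ℕ × Fin n) => Z j.1 j.2.1 j.2.2) μ
  law : ∀ k K τ, μ.map (Z k K τ) = (uniformOn (Set.univ : Set (Fin m))).prod ν

end

/-! The inner loop is a randomized contraction in expectation, the outer loop is a deterministic
inequality along each path, and a warm-start estimate ties them together.

Inner loop. A dual step moves the sampled $-\alpha_{i\tau}$ a fraction $\theta m$ of the way to a
gradient of $\phi_{i\tau}$. Smoothness of $\phi_{i\tau}$ makes $\phi_{i\tau}^*$ strongly convex, so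
the step gains a multiple of the squared residual. Averaging over the index turns the first-order
terms into $-\theta$ times the primal-dual gap at $x=\nabla\xi^*(u)$. Three things are lost: $u$
differs from $v(\alpha)$ by the mean error $e$, the update has a second moment, and compression
creates new errors. Apart from multiples of $\|e\|^2$, these losses are multiples of the mean
squared residual, and $\theta$ and $\rho$ are chosen so that the gain covers them (`coeff_nonpos`).
The $\|e\|^2$ terms are paid for by the contraction of the weighted errors in $\Psi_3$. With
$c=\min(\theta/2,\delta/4)$ the outcome is $\mathbb E\Psi^{+}\le(1-c)\Psi-\frac\theta2(G(x)-G^*)$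
(`lyap_mean_le`, `lintegral_lyapReal_step_le`), where $1/c\le16B$. The last term is kept on purpose:
the left side is nonnegative, so $G(x)-G^*\le\frac2\theta\Psi$, and the whole stopping quantity is
at most $35NB\,\Psi$. Markov's inequality and a geometric tail then give $\mathbb E[T]\lesssim
B\log(1+35NB\,\Psi^0/\epsilon)$ (`lintegral_stopTime_le`).

Outer loop. The Catalyst weights are constantly $\sqrt q$, and the potential
$P(x)-P^*+\frac\lambda2\|x^*-z\|^2$ contracts by $1-\sqrt q$ up to the inner accuracy
(`catalyst_step`). Since $\rho_0<\sqrt q$, it decays like $(1-\rho_0)^k$ with a prefactor of order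
$(\sqrt q-\rho_0)^{-2}$ (`outer_converges`). The same bound controls the distance between
consecutive prox-centers.

Warm start. Moving the prox-center at most doubles the dual gap and adds $\frac32\kappa\|y'-y\|^2$
(`gapReal_warm_start`). Hence $\Psi$ at the start of a later loop is the new tolerance times a
polynomial in the argument of $\mathcal L$ (`lyapReal_warm_start`), and its logarithm is $O(\mathcal
L)$. Only the first loop sees $\mathcal L_0$. This estimate needs the earlier loops to have stopped,
so the count is bounded by strong induction: a finite expectation gives almost sure termination.
Each loop is treated conditionally on the past through independence of its draws.

Cost. One inner iteration sends one compressed vector per node, and $O(1/\sqrt q)$ outer loops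
suffice up to logarithms, so the cost is governed by $B/\sqrt q$ (`rate_div_sqrt_q`). -/

noncomputable section

/-! ### Strongly convex and smooth functions -/

section ConvexAnalysis

variable {E F : Type*} [NormedAddCommGroup E] [InnerProductSpace ℝ E]
  [NormedAddCommGroup F] [InnerProductSpace ℝ F]

theorem norm_combo_sq (x y : E) {a b : ℝ} (h : a + b = 1) :
    ‖a • x + b • y‖ ^ 2 = a * ‖x‖ ^ 2 + b * ‖y‖ ^ 2 - a * b * ‖x - y‖ ^ 2 := by
  obtain rfl : b = 1 - a := by linarith
  rw [norm_add_sq_real, norm_sub_sq_real, norm_smul, norm_smul, real_inner_smul_left,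
    real_inner_smul_right, mul_pow, mul_pow, Real.norm_eq_abs, Real.norm_eq_abs, sq_abs, sq_abs]
  ring

theorem norm_sub_sq_combo (x y z : E) {a b : ℝ} (h : a + b = 1) :
    ‖a • x + b • y - z‖ ^ 2 = a * ‖x - z‖ ^ 2 + b * ‖y - z‖ ^ 2 - a * b * ‖x - y‖ ^ 2 := by
  have h1 : a • x + b • y - z = a • (x - z) + b • (y - z) := by
    obtain rfl : b = 1 - a := by linarith
    module
  rw [h1, norm_combo_sq _ _ h]
  congr 4
  abel

theorem StrongConvexOn.add_quadratic {f : E → ℝ} {μ : ℝ} (hf : StrongConvexOn Set.univ μ f)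
    (κ : ℝ) (y : E) :
    StrongConvexOn Set.univ (μ + κ) (fun x => f x + κ / 2 * ‖x - y‖ ^ 2) := by
  refine ⟨convex_univ, fun x _ z _ a b ha hb hab => ?_⟩
  have h := hf.2 (Set.mem_univ x) (Set.mem_univ z) ha hb hab
  simp only [smul_eq_mul] at h ⊢
  rw [norm_sub_sq_combo _ _ _ hab]
  linarith

theorem StrongConvexOn.sub_inner {f : E → ℝ} {μ : ℝ} (hf : StrongConvexOn Set.univ μ f) (w : E) :
    StrongConvexOn Set.univ μ (fun x => f x - inner ℝ x w) := by
  refine ⟨convex_univ, fun x _ z _ a b ha hb hab => ?_⟩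
  have h := hf.2 (Set.mem_univ x) (Set.mem_univ z) ha hb hab
  simp only [smul_eq_mul] at h ⊢
  rw [inner_add_left, real_inner_smul_left, real_inner_smul_left]
  linarith

theorem StrongConvexOn.add_convexOn {f g : E → ℝ} {μ : ℝ} (hf : StrongConvexOn Set.univ μ f)
    (hg : ConvexOn ℝ Set.univ g) : StrongConvexOn Set.univ μ (fun x => g x + f x) := by
  refine ⟨convex_univ, fun x _ z _ a b ha hb hab => ?_⟩
  have h := hf.2 (Set.mem_univ x) (Set.mem_univ z) ha hb hab
  have h' := hg.2 (Set.mem_univ x) (Set.mem_univ z) ha hb hab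
  simp only [smul_eq_mul] at h h' ⊢
  linarith

theorem StrongConvexOn.div_const {f : E → ℝ} {μ : ℝ} (hf : StrongConvexOn Set.univ μ f)
    {c : ℝ} (hc : 0 < c) : StrongConvexOn Set.univ (μ / c) (fun x => f x / c) := by
  refine ⟨convex_univ, fun x _ z _ a b ha hb hab => ?_⟩
  have h := hf.2 (Set.mem_univ x) (Set.mem_univ z) ha hb hab
  simp only [smul_eq_mul] at h ⊢
  calc f (a • x + b • z) / c ≤ (a * f x + b * f z - a * b * (μ / 2 * ‖x - z‖ ^ 2)) / c := by gcongr
    _ = _ := by ring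

/-- A minimizer of a strongly convex function satisfies the quadratic growth condition. -/
theorem StrongConvexOn.quadratic_growth {f : E → ℝ} {μ : ℝ} (hf : StrongConvexOn Set.univ μ f)
    {z : E} (hz : ∀ x, f z ≤ f x) (x : E) : f z + μ / 2 * ‖x - z‖ ^ 2 ≤ f x := by
  -- Strong convexity on the segment from `z` to `x`, combined with minimality and divided by `a`;
  -- letting `a → 0` then removes the factor `1 - a`.
  have key : ∀ a : ℝ, 0 < a → a ≤ 1 → (1 - a) * (μ / 2 * ‖x - z‖ ^ 2) ≤ f x - f z := by
    intro a ha ha1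
    have h := hf.2 (Set.mem_univ x) (Set.mem_univ z) ha.le (by linarith : (0 : ℝ) ≤ 1 - a)
      (by ring)
    have h2 := hz (a • x + (1 - a) • z)
    simp only [smul_eq_mul] at h
    have : a * ((1 - a) * (μ / 2 * ‖x - z‖ ^ 2)) ≤ a * (f x - f z) := by linarith
    exact le_of_mul_le_mul_left this ha
  have hlim : Filter.Tendsto (fun a : ℝ => (1 - a) * (μ / 2 * ‖x - z‖ ^ 2)) (nhdsWithin 0 (Set.Ioi 0))
      (nhds ((1 - 0) * (μ / 2 * ‖x - z‖ ^ 2))) :=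
    (Continuous.tendsto (by fun_prop) 0).mono_left nhdsWithin_le_nhds
  have := le_of_tendsto hlim (by
    filter_upwards [Ioc_mem_nhdsGT (zero_lt_one' ℝ)] with a ha using key a ha.1 ha.2)
  linarith

theorem StrongConvexOn.continuous [FiniteDimensional ℝ E] {f : E → ℝ} {μ : ℝ} (hμ : 0 ≤ μ)
    (hf : StrongConvexOn Set.univ μ f) : Continuous f := by
  have hc : ConvexOn ℝ Set.univ f := by
    have := StrongConvexOn.mono hμ hf
    rwa [strongConvexOn_zero] at this
  rw [← continuousOn_univ]
  exact hc.continuousOn isOpen_univ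

/-- Coercivity from compactness: `f` is bounded below on the unit ball, and strong convexity on the
segment from `0` to `x`, read at the unit vector along `x`, forces quadratic growth. Outside a ball
`f` therefore exceeds `f 0`. -/
theorem StrongConvexOn.exists_minimizer [FiniteDimensional ℝ E] {f : E → ℝ} {μ : ℝ} (hμ : 0 < μ)
    (hf : StrongConvexOn Set.univ μ f) : ∃ z, ∀ x, f z ≤ f x := by
  have hcont := hf.continuous hμ.le
  obtain ⟨M, hM⟩ := ((isCompact_closedBall (0 : E) 1).image hcont).bddBelow
  have hM' : ∀ x : E, ‖x‖ ≤ 1 → M ≤ f x := fun x hx =>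
    hM ⟨x, by simpa using hx, rfl⟩
  have hlow : ∀ x : E, 1 ≤ ‖x‖ →
      ‖x‖ * (M - f 0 + μ / 2 * (‖x‖ - 1)) + f 0 ≤ f x := by
    intro x hx
    have hr : 0 < ‖x‖ := by linarith
    have h := hf.2 (Set.mem_univ x) (Set.mem_univ 0) (inv_nonneg.2 hr.le)
      (by linarith [inv_le_one_of_one_le₀ hx] : (0 : ℝ) ≤ 1 - ‖x‖⁻¹) (by ring)
    have h2 := hM' (‖x‖⁻¹ • x) (by rw [norm_smul, norm_inv, norm_norm, inv_mul_cancel₀ hr.ne'])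
    simp only [smul_eq_mul, smul_zero, add_zero, sub_zero] at h
    have h3 := mul_le_mul_of_nonneg_left (h2.trans h) hr.le
    have e : ‖x‖ * (‖x‖⁻¹ * f x + (1 - ‖x‖⁻¹) * f 0 -
        ‖x‖⁻¹ * (1 - ‖x‖⁻¹) * (μ / 2 * ‖x‖ ^ 2)) =
        f x + (‖x‖ - 1) * f 0 - (‖x‖ - 1) * (μ / 2 * ‖x‖) := by
      field_simp
    rw [e] at h3
    linarith
  refine hcont.exists_forall_le' 0 ?_
  have hev := (tendsto_norm_cocompact_atTop (E := E)).eventually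
    (Filter.eventually_ge_atTop (max 1 (1 + 2 / μ * (f 0 - M))))
  filter_upwards [hev] with x hx
  have hx1 : 1 ≤ ‖x‖ := le_trans (le_max_left _ _) hx
  have hx2 : 1 + 2 / μ * (f 0 - M) ≤ ‖x‖ := le_trans (le_max_right _ _) hx
  have h4 : f 0 - M ≤ μ / 2 * (‖x‖ - 1) := by
    have : μ / 2 * (2 / μ * (f 0 - M)) ≤ μ / 2 * (‖x‖ - 1) := by gcongr; linarith
    have e : μ / 2 * (2 / μ * (f 0 - M)) = f 0 - M := by field_simp
    linarith
  have h5 : 0 ≤ ‖x‖ * (M - f 0 + μ / 2 * (‖x‖ - 1)) := by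
    apply mul_nonneg <;> linarith
  linarith [hlow x hx1]

theorem hasDerivAt_comp_line [CompleteSpace E] {f : E → ℝ} (hf : Differentiable ℝ f) (x h : E)
    (r : ℝ) : HasDerivAt (fun r : ℝ => f (x + r • h)) (inner ℝ (gradient f (x + r • h)) h) r := by
  have h1 : HasDerivAt (fun r : ℝ => x + r • h) h r := by
    simpa using ((hasDerivAt_id r).smul_const h).const_add x
  have h2 := (hf (x + r • h)).hasGradientAt.hasFDerivAt
  exact h2.comp_hasDerivAt r h1

/-- The gradient inequality for convex functions. -/
theorem ConvexOn.gradient_inequality [CompleteSpace E] {f : E → ℝ} (hc : ConvexOn ℝ Set.univ f)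
    (hf : Differentiable ℝ f) (x y : E) : f x + inner ℝ (gradient f x) (y - x) ≤ f y := by
  have hconv : ConvexOn ℝ Set.univ (fun r : ℝ => f (x + r • (y - x))) := by
    refine ⟨convex_univ, fun r _ r' _ a b ha hb hab => ?_⟩
    have h := hc.2 (Set.mem_univ (x + r • (y - x))) (Set.mem_univ (x + r' • (y - x))) ha hb hab
    convert h using 2
    obtain rfl : b = 1 - a := by linarith
    simp only [smul_eq_mul]
    module
  have hd := hasDerivAt_comp_line hf x (y - x) 0
  have := hconv.le_slope_of_hasDerivAt (Set.mem_univ 0) (Set.mem_univ 1) zero_lt_one hd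
  rw [slope_def_field] at this
  simp only [zero_smul, add_zero, one_smul, sub_zero, div_one, add_sub_cancel] at this
  linarith

/-- The descent lemma. -/
theorem descent_lemma [CompleteSpace E] {f : E → ℝ} {L : ℝ} (hf : Differentiable ℝ f)
    (hL : ∀ z w, ‖gradient f z - gradient f w‖ ≤ L * ‖z - w‖) (x y : E) :
    f y ≤ f x + inner ℝ (gradient f x) (y - x) + L / 2 * ‖y - x‖ ^ 2 := by
  set h := y - x
  -- Up to a constant, this is `f` on the segment minus its quadratic upper model; the Lipschitz
  -- gradient makes the derivative nonpositive.
  let ψ : ℝ → ℝ := fun r => f (x + r • h) - r * inner ℝ (gradient f x) h - L / 2 * ‖h‖ ^ 2 * r ^ 2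
  have hψ : ∀ r, HasDerivAt ψ (inner ℝ (gradient f (x + r • h)) h - inner ℝ (gradient f x) h
      - L * ‖h‖ ^ 2 * r) r := by
    intro r
    have h1 := hasDerivAt_comp_line hf x h r
    have h2 := (hasDerivAt_id r).mul_const (inner ℝ (gradient f x) h)
    have h3 := (hasDerivAt_pow 2 r).const_mul (L / 2 * ‖h‖ ^ 2)
    refine HasDerivAt.congr_deriv ((h1.sub h2).sub h3) ?_
    simp only [one_mul, Nat.cast_ofNat, Nat.add_one_sub_one, pow_one]
    ring
  have hanti : AntitoneOn ψ (Set.Icc 0 1) := by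
    refine antitoneOn_of_deriv_nonpos (convex_Icc 0 1)
      (fun r _ => (hψ r).continuousAt.continuousWithinAt)
      (fun r _ => (hψ r).differentiableAt.differentiableWithinAt) fun r hr => ?_
    rw [interior_Icc] at hr
    rw [(hψ r).deriv, ← inner_sub_left]
    have h1 := real_inner_le_norm (gradient f (x + r • h) - gradient f x) h
    have h2 := hL (x + r • h) x
    have h3 : ‖x + r • h - x‖ = r * ‖h‖ := by
      rw [add_sub_cancel_left, norm_smul, Real.norm_of_nonneg hr.1.le]
    rw [h3] at h2
    have h4 := mul_le_mul_of_nonneg_right h2 (norm_nonneg h)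
    nlinarith
  have := hanti (Set.left_mem_Icc.2 zero_le_one) (Set.right_mem_Icc.2 zero_le_one) zero_le_one
  simp only [ψ, h, zero_smul, add_zero, one_smul, zero_mul, one_mul, add_sub_cancel, sub_zero,
    mul_zero, ne_eq, OfNat.ofNat_ne_zero, not_false_eq_true, zero_pow, one_pow, mul_one] at this
  linarith

/-- The image of a family of vectors under a family of operators is controlled by the norm of
the sum of the operators `B Bᵀ`. -/
theorem norm_sum_apply_sq_le [CompleteSpace E] [CompleteSpace F] {ι : Type*} [Fintype ι]
    (B : ι → F →L[ℝ] E) (w : ι → F) :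
    ‖∑ j, B j (w j)‖ ^ 2 ≤ ‖∑ j, B j ∘L (B j).adjoint‖ * ∑ j, ‖w j‖ ^ 2 := by
  set z := ∑ j, B j (w j) with hz
  set M := ‖∑ j, B j ∘L (B j).adjoint‖
  have h1 : ‖z‖ ^ 2 = ∑ j, inner ℝ (w j) ((B j).adjoint z) := by
    rw [← real_inner_self_eq_norm_sq]
    nth_rw 1 [hz]
    rw [sum_inner]
    simp [ContinuousLinearMap.adjoint_inner_right]
  -- The left side is the quadratic form of `∑ B Bᵀ` at `z`. Cauchy–Schwarz applied to `h1` then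
  -- leaves a factor `‖z‖²` on both sides that cancels.
  have h2 : ∑ j, ‖(B j).adjoint z‖ ^ 2 ≤ M * ‖z‖ ^ 2 := by
    have e : ∑ j, ‖(B j).adjoint z‖ ^ 2 = inner ℝ ((∑ j, B j ∘L (B j).adjoint) z) z := by
      rw [sum_apply, sum_inner]
      refine Finset.sum_congr rfl fun j _ => ?_
      rw [ContinuousLinearMap.comp_apply, ← ContinuousLinearMap.adjoint_inner_right,
        real_inner_self_eq_norm_sq]
    rw [e]
    calc _ ≤ ‖(∑ j, B j ∘L (B j).adjoint) z‖ * ‖z‖ := real_inner_le_norm _ _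
      _ ≤ (M * ‖z‖) * ‖z‖ := by gcongr; exact ContinuousLinearMap.le_opNorm _ _
      _ = _ := by ring
  have h3 : (‖z‖ ^ 2) ^ 2 ≤ (∑ j, ‖w j‖ ^ 2) * (M * ‖z‖ ^ 2) := by
    calc (‖z‖ ^ 2) ^ 2 ≤ (∑ j, ‖w j‖ * ‖(B j).adjoint z‖) ^ 2 := by
          gcongr
          rw [h1]
          exact Finset.sum_le_sum fun j _ => real_inner_le_norm _ _
      _ ≤ (∑ j, ‖w j‖ ^ 2) * ∑ j, ‖(B j).adjoint z‖ ^ 2 := Finset.sum_mul_sq_le_sq_mul_sq _ _ _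
      _ ≤ _ := by gcongr
  rcases (sq_nonneg ‖z‖).eq_or_lt with h0 | h0
  · rw [← h0]; positivity
  · nlinarith

end ConvexAnalysis

/-! ### Fenchel conjugates of smooth functions -/

section Conjugate

variable {d : ℕ}

theorem le_fenchelConj (f : Vec d → ℝ) (u x : Vec d) :
    ((inner ℝ x u - f x : ℝ) : EReal) ≤ fenchelConj f u :=
  le_iSup (fun x : Vec d => ((inner ℝ x u - f x : ℝ) : EReal)) x

theorem fenchelConj_ne_bot (f : Vec d → ℝ) (u : Vec d) : fenchelConj f u ≠ ⊥ := fun h => by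
  have := le_fenchelConj f u 0
  rw [h] at this
  exact EReal.coe_ne_bot _ (le_bot_iff.1 this)

theorem fenchelConj_eq_of_isMax {f : Vec d → ℝ} {u z : Vec d}
    (hz : ∀ x, inner ℝ x u - f x ≤ inner ℝ z u - f z) :
    fenchelConj f u = ((inner ℝ z u - f z : ℝ) : EReal) :=
  le_antisymm (iSup_le fun x => EReal.coe_le_coe_iff.2 (hz x)) (le_fenchelConj f u z)

theorem fenchelConj_eq_of_le {f : Vec d → ℝ} {u : Vec d} {c : ℝ}
    (h : ∀ x, inner ℝ x u - f x ≤ c) :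
    fenchelConj f u ≠ ⊤ ∧ (fenchelConj f u).toReal ≤ c := by
  have h1 : fenchelConj f u ≤ (c : EReal) := iSup_le fun x => EReal.coe_le_coe_iff.2 (h x)
  refine ⟨fun h2 => by rw [h2] at h1; exact EReal.coe_ne_top _ (top_le_iff.1 h1), ?_⟩
  simpa using EReal.toReal_le_toReal h1 (fenchelConj_ne_bot f u) (EReal.coe_ne_top c)

theorem le_toReal_fenchelConj {f : Vec d → ℝ} {u : Vec d} (h : fenchelConj f u ≠ ⊤) (x : Vec d) :
    inner ℝ x u - f x ≤ (fenchelConj f u).toReal := by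
  have := EReal.toReal_le_toReal (le_fenchelConj f u x) (EReal.coe_ne_bot _) h
  rwa [EReal.toReal_coe] at this

theorem measurable_fenchelConj (f : Vec d → ℝ) : Measurable (fenchelConj f) := by
  have : LowerSemicontinuous (fenchelConj f) := by
    apply lowerSemicontinuous_iSup
    intro x
    apply Continuous.lowerSemicontinuous
    exact continuous_coe_real_ereal.comp (by fun_prop)
  exact this.measurable

/-- Conjugates of `1/γ`-smooth functions are `γ`-strongly convex. -/
theorem fenchelConj_combo {f : Vec d → ℝ} {γ : ℝ} (hγ : 0 < γ) (hf : Differentiable ℝ f)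
    (hs : ∀ z w, ‖gradient f z - gradient f w‖ ≤ (1 / γ) * ‖z - w‖) {b c : Vec d}
    (hb : fenchelConj f b ≠ ⊤) (hc : fenchelConj f c ≠ ⊤) {s : ℝ} (h0 : 0 ≤ s) (h1 : s ≤ 1) :
    fenchelConj f ((1 - s) • b + s • c) ≠ ⊤ ∧
      (fenchelConj f ((1 - s) • b + s • c)).toReal ≤
        (1 - s) * (fenchelConj f b).toReal + s * (fenchelConj f c).toReal
          - γ / 2 * (s * (1 - s)) * ‖b - c‖ ^ 2 := by
  -- The supremum is tested at `w + γ (b - ∇f w)`, the point that optimizes the bound of the descent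
  -- lemma. Averaging the resulting lower bounds for `b` and `c` at the same `w` yields the
  -- quadratic remainder.
  have key : ∀ (w b : Vec d), fenchelConj f b ≠ ⊤ →
      inner ℝ w b - f w + γ / 2 * ‖b - gradient f w‖ ^ 2 ≤ (fenchelConj f b).toReal := by
    intro w b hb
    refine le_trans ?_ (le_toReal_fenchelConj hb (w + γ • (b - gradient f w)))
    have h := descent_lemma hf hs w (w + γ • (b - gradient f w))
    rw [add_sub_cancel_left, norm_smul, Real.norm_of_nonneg hγ.le, real_inner_smul_right] at h
    rw [inner_add_left, real_inner_smul_left]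
    have e : inner ℝ (b - gradient f w) b - inner ℝ (gradient f w) (b - gradient f w)
        = ‖b - gradient f w‖ ^ 2 := by
      rw [← real_inner_self_eq_norm_sq, real_inner_comm (b - gradient f w) (gradient f w),
        ← inner_sub_right]
    have e2 : 1 / γ / 2 * (γ * ‖b - gradient f w‖) ^ 2 = γ / 2 * ‖b - gradient f w‖ ^ 2 := by
      field_simp
    rw [e2] at h
    nlinarith
  apply fenchelConj_eq_of_le
  intro w
  have hb' := key w b hb
  have hc' := key w c hc
  have hn := norm_combo_sq (b - gradient f w) (c - gradient f w) (by ring : (1 - s) + s = 1)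
  have e : b - gradient f w - (c - gradient f w) = b - c := by abel
  rw [e] at hn
  rw [inner_add_right, real_inner_smul_right, real_inner_smul_right]
  have hpos : 0 ≤ γ / 2 * ‖(1 - s) • (b - gradient f w) + s • (c - gradient f w)‖ ^ 2 := by positivity
  have h2 := mul_le_mul_of_nonneg_left hb' (sub_nonneg.2 h1)
  have h3 := mul_le_mul_of_nonneg_left hc' h0
  rw [hn] at hpos
  nlinarith

theorem fenchelConj_gradient {f : Vec d → ℝ} (hc : ConvexOn ℝ Set.univ f)
    (hf : Differentiable ℝ f) (z : Vec d) :
    fenchelConj f (gradient f z) = ((inner ℝ z (gradient f z) - f z : ℝ) : EReal) := by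
  apply fenchelConj_eq_of_isMax
  intro x
  have := hc.gradient_inequality hf z x
  rw [inner_sub_right, real_inner_comm x, real_inner_comm z] at this
  linarith

end Conjugate

/-! ### Differentiability of the conjugate of a strongly convex function -/

section StrongConj

variable {d : ℕ} {f : Vec d → ℝ}

/-- The gradient of the conjugate of a 1-strongly convex function is the maximizer. -/
theorem StrongConvexOn.gradient_fenchelConj (hf : StrongConvexOn Set.univ 1 f) (u x : Vec d) :
    f (gradient (fun w => (fenchelConj f w).toReal) u)
        - inner ℝ (gradient (fun w => (fenchelConj f w).toReal) u) u
        + 1 / 2 * ‖x - gradient (fun w => (fenchelConj f w).toReal) u‖ ^ 2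
      ≤ f x - inner ℝ x u := by
  have hex : ∀ u : Vec d, ∃ z, ∀ x, f z - inner ℝ z u + 1 / 2 * ‖x - z‖ ^ 2 ≤ f x - inner ℝ x u :=
    fun u => by
      obtain ⟨z, hz⟩ := (hf.sub_inner u).exists_minimizer one_pos
      exact ⟨z, (hf.sub_inner u).quadratic_growth hz⟩
  choose X hX using hex
  have hval : ∀ u, (fenchelConj f u).toReal = inner ℝ (X u) u - f (X u) := fun u => by
    rw [fenchelConj_eq_of_isMax (z := X u) fun x => ?_, EReal.toReal_coe]
    have := hX u x
    nlinarith [sq_nonneg ‖x - X u‖]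
  have hgrad : HasGradientAt (fun w => (fenchelConj f w).toReal) (X u) u := by
    rw [hasGradientAt_iff_isLittleO]
    -- The linearization error lies between `0` and `‖w - u‖²`: testing optimality of each maximizer
    -- against the other one gives both sides.
    have hO : (fun w => (fenchelConj f w).toReal - (fenchelConj f u).toReal - inner ℝ (X u) (w - u))
        =O[nhds u] fun w => ‖w - u‖ ^ 2 := by
      apply Asymptotics.IsBigO.of_bound 1
      refine Filter.Eventually.of_forall fun w => ?_
      have h1 := hX w (X u)
      have h2 := hX u (X w)
      have h3 := real_inner_le_norm (X w - X u) (w - u)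
      have h4 := two_mul_le_add_sq ‖X w - X u‖ ‖w - u‖
      simp only [inner_sub_left, inner_sub_right] at h3 ⊢
      rw [norm_sub_rev] at h1
      rw [hval, hval, Real.norm_eq_abs, abs_of_nonneg (by nlinarith [sq_nonneg ‖X w - X u‖]),
        one_mul, Real.norm_of_nonneg (by positivity)]
      nlinarith [sq_nonneg ‖w - u‖]
    refine hO.trans_isLittleO ?_
    have h5 : (fun w : Vec d => ‖w - u‖ ^ 2) =o[nhds u] fun w => ‖w - u‖ := by
      have h6 : Filter.Tendsto (fun w : Vec d => ‖w - u‖) (nhds u) (nhds 0) := by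
        have : Continuous fun w : Vec d => ‖w - u‖ := by fun_prop
        simpa using this.tendsto u
      exact (Asymptotics.isLittleO_pow_id one_lt_two).comp_tendsto h6
    exact h5.norm_right.trans_isBigO (Asymptotics.isBigO_of_le _ fun w => by simp)
  rw [hgrad.gradient]
  exact hX u x

end StrongConj

/-! ### Duality for the proximal subproblem -/

namespace SumProblem

variable {d t n m : ℕ} (p : SumProblem d t n m) {κ δ : ℝ}

section

theorem N_pos (p : SumProblem d t n m) : (0 : ℝ) < (m : ℝ) * n :=
  mul_pos (Nat.cast_pos.2 p.m_pos) (Nat.cast_pos.2 p.n_pos)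

theorem lam_add_pos (hκ : 0 ≤ κ) : 0 < p.lam + κ := add_pos_of_pos_of_nonneg p.lam_pos hκ

theorem strongConvexOn_subReg (hκ : 0 ≤ κ) (y : Vec d) :
    StrongConvexOn Set.univ 1 (p.subReg κ y) := by
  have h := (p.g_strongConvex.add_quadratic κ y).div_const (p.lam_add_pos hκ)
  rwa [div_self (p.lam_add_pos hκ).ne'] at h

theorem primalPoint_spec (hκ : 0 ≤ κ) (y u x : Vec d) :
    p.subReg κ y (p.primalPoint κ y u) - Inner.inner ℝ (p.primalPoint κ y u) u
      + 1 / 2 * ‖x - p.primalPoint κ y u‖ ^ 2 ≤ p.subReg κ y x - Inner.inner ℝ x u :=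
  (p.strongConvexOn_subReg hκ y).gradient_fenchelConj u x

theorem fenchelConj_subReg (hκ : 0 ≤ κ) (y u : Vec d) :
    fenchelConj (p.subReg κ y) u
      = ((Inner.inner ℝ (p.primalPoint κ y u) u - p.subReg κ y (p.primalPoint κ y u) : ℝ) : EReal) :=
  fenchelConj_eq_of_isMax fun x => by
    have := p.primalPoint_spec hκ y u x
    nlinarith [sq_nonneg ‖x - p.primalPoint κ y u‖]

/-- Adding the two optimality inequalities, each with its quadratic remainder, gives the estimate. A
shift of the prox-center changes the regularizer only by a linear term and a constant, so it acts
like a shift of `u` by `κ/(λ+κ) (y - y')`. -/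
theorem norm_primalPoint_sub_le (hκ : 0 ≤ κ) (y y' u u' : Vec d) :
    ‖p.primalPoint κ y u - p.primalPoint κ y' u'‖
      ≤ ‖u - u' + (κ / (p.lam + κ)) • (y - y')‖ := by
  set x := p.primalPoint κ y u with hx
  set x' := p.primalPoint κ y' u' with hx'
  have hL := p.lam_add_pos hκ
  have h1 := p.primalPoint_spec hκ y u x'
  have h2 := p.primalPoint_spec hκ y' u' x
  rw [← hx] at h1
  rw [← hx', norm_sub_rev] at h2
  have key : ‖x' - x‖ ^ 2 ≤ Inner.inner ℝ (x - x') (u - u' + (κ / (p.lam + κ)) • (y - y')) := by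
    have e : p.subReg κ y x' - p.subReg κ y x + p.subReg κ y' x - p.subReg κ y' x'
        = (κ / (p.lam + κ)) * Inner.inner ℝ (x - x') (y - y') := by
      simp only [subReg, norm_sub_sq_real, inner_sub_left, inner_sub_right]
      field_simp
      ring
    rw [inner_add_right, real_inner_smul_right, ← e]
    simp only [inner_sub_left, inner_sub_right]
    linarith
  have h3 := real_inner_le_norm (x - x') (u - u' + (κ / (p.lam + κ)) • (y - y'))
  rw [norm_sub_rev x' x] at key
  rcases (norm_nonneg (x - x')).eq_or_lt with h0 | h0
  · rw [← h0]; positivity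
  · nlinarith

theorem continuous_primalPoint (hκ : 0 ≤ κ) :
    Continuous fun z : Vec d × Vec d => p.primalPoint κ z.1 z.2 := by
  rw [continuous_iff_continuousAt]
  intro z
  rw [ContinuousAt, tendsto_iff_norm_sub_tendsto_zero]
  have hc : Continuous fun w : Vec d × Vec d =>
      ‖w.2 - z.2 + (κ / (p.lam + κ)) • (w.1 - z.1)‖ := by fun_prop
  have h := hc.tendsto z
  simp only [sub_self, smul_zero, add_zero, norm_zero] at h
  exact squeeze_zero (fun _ => norm_nonneg _) (fun w => p.norm_primalPoint_sub_le hκ _ _ _ _) h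

theorem convexOn_avg_loss :
    ConvexOn ℝ Set.univ fun x : Vec d =>
      (1 / ((m : ℝ) * n)) * (∑ τ, ∑ i, p.φ τ i ((p.A τ i).adjoint x)) := by
  refine ⟨convex_univ, fun x _ z _ a b ha hb hab => ?_⟩
  simp only [smul_eq_mul]
  have hN := p.N_pos
  calc _ ≤ (1 / ((m : ℝ) * n)) * (∑ τ, ∑ i, (a * p.φ τ i ((p.A τ i).adjoint x)
        + b * p.φ τ i ((p.A τ i).adjoint z))) := by
        gcongr with τ _ i _
        rw [map_add, map_smul, map_smul]
        exact (p.φ_convex τ i).2 (Set.mem_univ _) (Set.mem_univ _) ha hb hab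
    _ = _ := by
        simp only [Finset.sum_add_distrib, ← Finset.mul_sum]
        ring

theorem strongConvexOn_obj : StrongConvexOn Set.univ p.lam p.obj :=
  p.g_strongConvex.add_convexOn p.convexOn_avg_loss

theorem strongConvexOn_subObj (κ : ℝ) (y : Vec d) :
    StrongConvexOn Set.univ (p.lam + κ) (p.subObj κ y) :=
  p.strongConvexOn_obj.add_quadratic κ y

theorem exists_isMin_obj :
    ∃ z, p.obj z = p.optVal ∧ ∀ x, p.optVal + p.lam / 2 * ‖x - z‖ ^ 2 ≤ p.obj x := by
  obtain ⟨z, hz⟩ := p.strongConvexOn_obj.exists_minimizer p.lam_pos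
  have e : p.obj z = p.optVal :=
    le_antisymm (le_ciInf hz) (ciInf_le ⟨p.obj z, by rintro _ ⟨x, rfl⟩; exact hz x⟩ z)
  exact ⟨z, e, fun x => e ▸ p.strongConvexOn_obj.quadratic_growth hz x⟩

theorem exists_isMin_subObj (hκ : 0 ≤ κ) (y : Vec d) :
    ∃ z, p.subObj κ y z = p.subOpt κ y ∧
      ∀ x, p.subOpt κ y + (p.lam + κ) / 2 * ‖x - z‖ ^ 2 ≤ p.subObj κ y x := by
  obtain ⟨z, hz⟩ := (p.strongConvexOn_subObj κ y).exists_minimizer (p.lam_add_pos hκ)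
  have e : p.subObj κ y z = p.subOpt κ y :=
    le_antisymm (le_ciInf hz) (ciInf_le ⟨p.subObj κ y z, by rintro _ ⟨x, rfl⟩; exact hz x⟩ z)
  exact ⟨z, e, fun x => e ▸ (p.strongConvexOn_subObj κ y).quadratic_growth hz x⟩

/-- The minimizer of the subproblem. -/
def subMin (κ : ℝ) (hκ : 0 ≤ κ) (y : Vec d) : Vec d := (p.exists_isMin_subObj hκ y).choose

theorem subObj_subMin (hκ : 0 ≤ κ) (y : Vec d) :
    p.subObj κ y (p.subMin κ hκ y) = p.subOpt κ y := (p.exists_isMin_subObj hκ y).choose_spec.1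

theorem subOpt_add_le (hκ : 0 ≤ κ) (y x : Vec d) :
    p.subOpt κ y + (p.lam + κ) / 2 * ‖x - p.subMin κ hκ y‖ ^ 2 ≤ p.subObj κ y x :=
  (p.exists_isMin_subObj hκ y).choose_spec.2 x

theorem subOpt_le (hκ : 0 ≤ κ) (y x : Vec d) : p.subOpt κ y ≤ p.subObj κ y x := by
  have := p.subOpt_add_le hκ y x
  have := p.lam_add_pos hκ
  have : 0 ≤ (p.lam + κ) / 2 * ‖x - p.subMin κ hκ y‖ ^ 2 := by positivity
  linarith

theorem optVal_le (x : Vec d) : p.optVal ≤ p.obj x := by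
  obtain ⟨z, -, hz⟩ := p.exists_isMin_obj
  have := hz x
  have := p.lam_pos
  have : 0 ≤ p.lam / 2 * ‖x - z‖ ^ 2 := by positivity
  linarith

/-- All conjugates are finite at the dual variables. -/
def Feasible (α : Fin n → Fin m → Vec t) : Prop :=
  ∀ τ i, fenchelConj (p.φ τ i) (-(α τ i)) ≠ ⊤

/-- The loss part of the dual objective, as a real number. -/
def conjAvg (α : Fin n → Fin m → Vec t) : ℝ :=
  (1 / ((m : ℝ) * n)) * ∑ τ, ∑ i, (fenchelConj (p.φ τ i) (-(α τ i))).toReal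

/-- The conjugate of the regularizer of the subproblem, as a real number. -/
def regConj (κ : ℝ) (y u : Vec d) : ℝ :=
  Inner.inner ℝ (p.primalPoint κ y u) u - p.subReg κ y (p.primalPoint κ y u)

/-- The dual objective as a real number. -/
def dualReal (κ : ℝ) (y : Vec d) (α : Fin n → Fin m → Vec t) : ℝ :=
  -p.conjAvg α - (p.lam + κ) * p.regConj κ y (p.dualToPrimal κ α)

/-- The dual suboptimality as a real number. -/
def gapReal (κ : ℝ) (y : Vec d) (α : Fin n → Fin m → Vec t) : ℝ :=
  p.subOpt κ y - p.dualReal κ y α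

/-- The weight of the compression errors in the Lyapunov function. -/
def errWeight (κ δ : ℝ) : ℝ := 2 * (p.rho κ δ + p.stepSize κ δ * (p.lam + κ)) / (δ * n)

/-- The Lyapunov function as a real number. -/
def lyapReal (κ δ : ℝ) (y : Vec d) (s : SDCAState d t n m) : ℝ :=
  p.gapReal κ y s.α + p.errWeight κ δ * ∑ τ, ‖s.e τ‖ ^ 2

theorem _root_.EReal.coe_finset_sum {ι : Type*} (s : Finset ι) (f : ι → ℝ) :
    ((∑ i ∈ s, f i : ℝ) : EReal) = ∑ i ∈ s, (f i : EReal) := by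
  classical
  induction s using Finset.induction_on with
  | empty => simp
  | insert a s ha ih => rw [Finset.sum_insert ha, Finset.sum_insert ha, EReal.coe_add, ih]

theorem dualObj_eq (hκ : 0 ≤ κ) (y : Vec d) {α : Fin n → Fin m → Vec t} (hα : p.Feasible α) :
    p.dualObj κ y α = (p.dualReal κ y α : EReal) := by
  have h : ∀ τ i, fenchelConj (p.φ τ i) (-(α τ i))
      = (((fenchelConj (p.φ τ i) (-(α τ i))).toReal : ℝ) : EReal) := fun τ i =>
    (EReal.coe_toReal (hα τ i) (fenchelConj_ne_bot _ _)).symm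
  have h2 : ∑ τ, ∑ i, fenchelConj (p.φ τ i) (-(α τ i))
      = ((∑ τ, ∑ i, (fenchelConj (p.φ τ i) (-(α τ i))).toReal : ℝ) : EReal) := by
    simp_rw [EReal.coe_finset_sum]
    exact Finset.sum_congr rfl fun τ _ => Finset.sum_congr rfl fun i _ => h τ i
  rw [dualObj, h2, p.fenchelConj_subReg hκ, ← EReal.coe_mul, ← EReal.coe_mul, ← EReal.coe_neg,
    ← EReal.coe_sub]
  rfl

theorem dualGap_eq (hκ : 0 ≤ κ) (y : Vec d) {α : Fin n → Fin m → Vec t} (hα : p.Feasible α) :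
    p.dualGap κ y α = (p.gapReal κ y α : EReal) := by
  rw [dualGap, p.dualObj_eq hκ y hα, ← EReal.coe_sub]
  rfl

theorem lyapunov_eq (hκ : 0 ≤ κ) (y : Vec d) {s : SDCAState d t n m} (hs : p.Feasible s.α) :
    p.lyapunov κ δ y s = (p.lyapReal κ δ y s : EReal) := by
  rw [lyapunov, p.dualGap_eq hκ y hs, ← EReal.coe_add]
  rfl

theorem stopCrit_iff (hκ : 0 ≤ κ) (y : Vec d) (ε : ℝ) {s : SDCAState d t n m}
    (hs : p.Feasible s.α) :
    p.stopCrit κ δ y ε s ↔ Real.sqrt (4 * n + δ * m * n) * p.lyapReal κ δ y s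
      + 2 * (p.subObj κ y (p.primalPoint κ y s.u) - p.subOpt κ y) ≤ ε := by
  rw [stopCrit, p.lyapunov_eq hκ y hs, ← EReal.coe_mul, ← EReal.coe_add, EReal.coe_le_coe_iff]

/-- The conjugate at `0` is `-inf φ`, which is finite because `φ` is bounded below; the method thus
starts from a finite dual value. -/
theorem feasible_zero : p.Feasible 0 := fun τ i => by
  obtain ⟨c, hc⟩ := p.φ_bddBelow τ i
  refine (fenchelConj_eq_of_le (c := -c) fun x => ?_).1
  have := hc ⟨x, rfl⟩
  simp
  linarith

theorem inner_dualToPrimal (hκ : 0 ≤ κ) (x : Vec d) (α : Fin n → Fin m → Vec t) :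
    (p.lam + κ) * Inner.inner ℝ x (p.dualToPrimal κ α)
      = (1 / ((m : ℝ) * n)) * ∑ τ, ∑ i, Inner.inner ℝ ((p.A τ i).adjoint x) (α τ i) := by
  have hL := p.lam_add_pos hκ
  have hN := p.N_pos
  simp only [dualToPrimal, real_inner_smul_right, inner_sum,
    ContinuousLinearMap.adjoint_inner_left]
  field_simp

theorem subObj_eq (hκ : 0 ≤ κ) (y x : Vec d) :
    p.subObj κ y x = (1 / ((m : ℝ) * n)) * (∑ τ, ∑ i, p.φ τ i ((p.A τ i).adjoint x))
      + (p.lam + κ) * p.subReg κ y x := by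
  have hL := p.lam_add_pos hκ
  rw [subObj, obj, subReg]
  field_simp
  ring

/-- Adding and subtracting the coupling term `⟨x, v(α)⟩` splits the primal-dual gap into
Fenchel–Young defects: one per loss and one for the regularizer. -/
theorem subObj_sub_dualReal (hκ : 0 ≤ κ) (y x : Vec d) (α : Fin n → Fin m → Vec t) :
    p.subObj κ y x - p.dualReal κ y α
      = (1 / ((m : ℝ) * n)) * ∑ τ, ∑ i, (p.φ τ i ((p.A τ i).adjoint x)
          + (fenchelConj (p.φ τ i) (-(α τ i))).toReal + Inner.inner ℝ ((p.A τ i).adjoint x) (α τ i))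
        + (p.lam + κ) * (p.subReg κ y x + p.regConj κ y (p.dualToPrimal κ α)
          - Inner.inner ℝ x (p.dualToPrimal κ α)) := by
  have h := p.inner_dualToPrimal hκ x α
  rw [p.subObj_eq hκ, dualReal, conjAvg]
  simp only [Finset.sum_add_distrib, mul_add, mul_sub] at h ⊢
  linarith

theorem subReg_add_regConj (hκ : 0 ≤ κ) (y x u : Vec d) :
    1 / 2 * ‖x - p.primalPoint κ y u‖ ^ 2
      ≤ p.subReg κ y x + p.regConj κ y u - Inner.inner ℝ x u := by
  have := p.primalPoint_spec hκ y u x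
  rw [regConj]
  linarith

/-- Weak duality with a quadratic remainder. -/
theorem weak_duality (hκ : 0 ≤ κ) (y x : Vec d) {α : Fin n → Fin m → Vec t} (hα : p.Feasible α) :
    (p.lam + κ) / 2 * ‖x - p.primalPoint κ y (p.dualToPrimal κ α)‖ ^ 2
      ≤ p.subObj κ y x - p.dualReal κ y α := by
  have hL := p.lam_add_pos hκ
  have hN := p.N_pos
  have h1 := mul_le_mul_of_nonneg_left
    (p.subReg_add_regConj hκ y x (p.dualToPrimal κ α)) hL.le
  have h2 : 0 ≤ (1 / ((m : ℝ) * n)) * ∑ τ, ∑ i, (p.φ τ i ((p.A τ i).adjoint x)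
      + (fenchelConj (p.φ τ i) (-(α τ i))).toReal + Inner.inner ℝ ((p.A τ i).adjoint x) (α τ i)) := by
    refine mul_nonneg (by positivity) (Finset.sum_nonneg fun τ _ => Finset.sum_nonneg fun i _ => ?_)
    have := le_toReal_fenchelConj (hα τ i) ((p.A τ i).adjoint x)
    rw [inner_neg_right] at this
    linarith
  rw [p.subObj_sub_dualReal hκ]
  linarith

theorem gapReal_ge (hκ : 0 ≤ κ) (y : Vec d) {α : Fin n → Fin m → Vec t} (hα : p.Feasible α) :
    (p.lam + κ) / 2 * ‖p.subMin κ hκ y - p.primalPoint κ y (p.dualToPrimal κ α)‖ ^ 2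
      ≤ p.gapReal κ y α := by
  rw [gapReal, ← p.subObj_subMin hκ]
  exact p.weak_duality hκ y _ hα

theorem gapReal_nonneg (hκ : 0 ≤ κ) (y : Vec d) {α : Fin n → Fin m → Vec t} (hα : p.Feasible α) :
    0 ≤ p.gapReal κ y α :=
  le_trans (mul_nonneg (by linarith [p.lam_add_pos hκ]) (sq_nonneg _)) (p.gapReal_ge hκ y hα)

/-- Change of the dual suboptimality when the prox-center moves. -/
theorem gapReal_warm_start (hκ : 0 ≤ κ) (y y' : Vec d) {α : Fin n → Fin m → Vec t}
    (hα : p.Feasible α) :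
    p.gapReal κ y' α ≤ 2 * p.gapReal κ y α + 3 / 2 * κ * ‖y' - y‖ ^ 2 := by
  have hL := p.lam_add_pos hκ
  set v := p.dualToPrimal κ α with hv
  set z := p.subMin κ hκ y with hz
  set xv := p.primalPoint κ y v with hxv
  set x' := p.primalPoint κ y' v with hx'
  have h1 := p.gapReal_ge hκ y hα
  rw [← hv, ← hxv, ← hz] at h1
  -- The old minimizer `z` is tested in the new subproblem, and in `h5` the new point `x'` in the
  -- old conjugate. The differences of squares combine to `κ ⟨x' - z, y' - y⟩`; of the two parts of
  -- `x' - z`, the first is at most `‖y' - y‖` and the second is absorbed by a second copy of the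
  -- old gap.
  have h2 : p.subOpt κ y' ≤ p.subOpt κ y + κ / 2 * (‖z - y'‖ ^ 2 - ‖z - y‖ ^ 2) := by
    have h3 := p.subOpt_le hκ y' z
    have h4 := p.subObj_subMin hκ y
    rw [← hz] at h4
    simp only [subObj] at h3 h4
    linarith
  have h5 : (p.lam + κ) * p.regConj κ y' v ≤ (p.lam + κ) * p.regConj κ y v
      + κ / 2 * (‖x' - y‖ ^ 2 - ‖x' - y'‖ ^ 2) := by
    have h6 := mul_le_mul_of_nonneg_left (p.subReg_add_regConj hκ y x' v) hL.le
    have h7 : 0 ≤ (p.lam + κ) * (1 / 2 * ‖x' - p.primalPoint κ y v‖ ^ 2) := by positivity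
    have h8 : (p.lam + κ) * p.subReg κ y' x' = (p.lam + κ) * p.subReg κ y x'
        + κ / 2 * (‖x' - y'‖ ^ 2 - ‖x' - y‖ ^ 2) := by
      simp only [subReg]
      field_simp
      ring
    have e : p.regConj κ y' v = Inner.inner ℝ x' v - p.subReg κ y' x' := rfl
    rw [e]
    linarith
  have h9 : κ / 2 * (‖z - y'‖ ^ 2 - ‖z - y‖ ^ 2) + κ / 2 * (‖x' - y‖ ^ 2 - ‖x' - y'‖ ^ 2)
      = κ * Inner.inner ℝ (x' - z) (y' - y) := by
    simp only [norm_sub_sq_real, inner_sub_left, inner_sub_right]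
    ring
  have h10 : Inner.inner ℝ (x' - z) (y' - y) ≤ (‖x' - xv‖ + ‖z - xv‖) * ‖y' - y‖ := by
    refine (real_inner_le_norm _ _).trans ?_
    gcongr
    rw [norm_sub_rev z xv]
    exact norm_sub_le_norm_sub_add_norm_sub _ _ _
  have h11 : ‖x' - xv‖ ≤ ‖y' - y‖ := by
    refine (p.norm_primalPoint_sub_le hκ y' y v v).trans ?_
    rw [sub_self, zero_add, norm_smul, Real.norm_of_nonneg (by positivity)]
    have : κ / (p.lam + κ) ≤ 1 := by
      rw [div_le_one hL]; linarith [p.lam_pos]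
    exact mul_le_of_le_one_left (norm_nonneg _) this
  have h12 : ‖z - xv‖ * ‖y' - y‖ ≤ 1 / 2 * ‖z - xv‖ ^ 2 + 1 / 2 * ‖y' - y‖ ^ 2 := by
    nlinarith [sq_nonneg (‖z - xv‖ - ‖y' - y‖)]
  have h13 : Inner.inner ℝ (x' - z) (y' - y) ≤ 1 / 2 * ‖z - xv‖ ^ 2 + 3 / 2 * ‖y' - y‖ ^ 2 := by
    have := mul_le_mul_of_nonneg_right h11 (norm_nonneg (y' - y))
    nlinarith
  have h14 := mul_le_mul_of_nonneg_left h13 hκ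
  have h15 : κ / 2 * ‖z - xv‖ ^ 2 ≤ (p.lam + κ) / 2 * ‖z - xv‖ ^ 2 := by
    gcongr; linarith [p.lam_pos]
  have e1 : p.gapReal κ y' α
      = p.subOpt κ y' + p.conjAvg α + (p.lam + κ) * p.regConj κ y' v := by
    rw [gapReal, dualReal]; ring
  have e2 : p.gapReal κ y α
      = p.subOpt κ y + p.conjAvg α + (p.lam + κ) * p.regConj κ y v := by
    rw [gapReal, dualReal]; ring
  linarith

/-- Smoothness of the conjugate of the regularizer. -/
theorem regConj_le (hκ : 0 ≤ κ) (y u w : Vec d) :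
    p.regConj κ y w ≤ p.regConj κ y u + Inner.inner ℝ (p.primalPoint κ y u) (w - u)
      + 1 / 2 * ‖w - u‖ ^ 2 := by
  have h := p.primalPoint_spec hκ y u (p.primalPoint κ y w)
  have h3 := real_inner_le_norm (p.primalPoint κ y w - p.primalPoint κ y u) (w - u)
  have h4 := two_mul_le_add_sq ‖p.primalPoint κ y w - p.primalPoint κ y u‖ ‖w - u‖
  simp only [regConj, inner_sub_left, inner_sub_right] at h3 ⊢
  nlinarith

end

end SumProblem

/-! ### One iteration of EC-SDCA along a fixed draw -/

namespace SumProblem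

variable {d t n m : ℕ} (p : SumProblem d t n m) {κ δ : ℝ}

section

theorem n_real_pos (p : SumProblem d t n m) : (0 : ℝ) < n := Nat.cast_pos.2 p.n_pos

theorem m_real_pos (p : SumProblem d t n m) : (0 : ℝ) < m := Nat.cast_pos.2 p.m_pos

theorem one_le_n (p : SumProblem d t n m) : (1 : ℝ) ≤ n := Nat.one_le_cast.2 p.n_pos

theorem one_le_m (p : SumProblem d t n m) : (1 : ℝ) ≤ m := Nat.one_le_cast.2 p.m_pos

theorem Rm_nonneg : 0 ≤ p.Rm :=
  Real.iSup_nonneg fun _ => Real.iSup_nonneg fun _ => norm_nonneg _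

theorem norm_A_le (τ : Fin n) (i : Fin m) : ‖p.A τ i‖ ≤ p.Rm :=
  (le_ciSup (Set.finite_range fun i => ‖p.A τ i‖).bddAbove i).trans
    (le_ciSup (Set.finite_range fun τ => ⨆ i, ‖p.A τ i‖).bddAbove τ)

theorem Rbar_nonneg : 0 ≤ p.Rbar := Real.sqrt_nonneg _

theorem R_nonneg : 0 ≤ p.R := Real.sqrt_nonneg _

theorem norm_sum_le_Rbar (τ : Fin n) :
    ‖∑ i, p.A τ i ∘L (p.A τ i).adjoint‖ ≤ m * p.Rbar ^ 2 := by
  have hm := p.m_real_pos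
  have h : (1 / (m : ℝ)) * ‖∑ i, p.A τ i ∘L (p.A τ i).adjoint‖ ≤ p.Rbar ^ 2 := by
    rw [Rbar, Real.sq_sqrt (Real.iSup_nonneg fun _ => by positivity)]
    exact le_ciSup (Set.finite_range fun τ => (1 / (m : ℝ)) *
      ‖∑ i, p.A τ i ∘L (p.A τ i).adjoint‖).bddAbove τ
  rw [one_div, inv_mul_le_iff₀ hm] at h
  linarith

theorem norm_sum_eq_R :
    ‖∑ τ, ∑ i, p.A τ i ∘L (p.A τ i).adjoint‖ = (m : ℝ) * n * p.R ^ 2 := by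
  have hN := p.N_pos
  rw [R, Real.sq_sqrt (by positivity), ← mul_assoc, mul_one_div_cancel hN.ne', one_mul]

theorem R_eq_zero (h : p.Rm = 0) : p.R = 0 := by
  have hA : ∀ τ i, p.A τ i = 0 := fun τ i =>
    norm_le_zero_iff.1 (h ▸ p.norm_A_le τ i)
  simp [R, hA]

theorem norm_avg_local_sq_le (τ : Fin n) (w : Fin m → Vec t) :
    ‖∑ i, p.A τ i (w i)‖ ^ 2 ≤ m * p.Rbar ^ 2 * ∑ i, ‖w i‖ ^ 2 :=
  (norm_sum_apply_sq_le (p.A τ) w).trans (by gcongr; exact p.norm_sum_le_Rbar τ)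

theorem norm_sum_sq_le (w : Fin n → Fin m → Vec t) :
    ‖∑ τ, ∑ i, p.A τ i (w τ i)‖ ^ 2 ≤ (m : ℝ) * n * p.R ^ 2 * ∑ τ, ∑ i, ‖w τ i‖ ^ 2 := by
  have h := norm_sum_apply_sq_le (fun j : Fin n × Fin m => p.A j.1 j.2) (fun j => w j.1 j.2)
  simp only [Fintype.sum_prod_type] at h
  rwa [p.norm_sum_eq_R] at h

theorem a3_nonneg (hδ : 0 < δ) : 0 ≤ p.a3 δ := by
  have := p.gam_pos
  have := p.n_real_pos
  have := p.Rm_nonneg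
  have := p.R_nonneg
  have := p.Rbar_nonneg
  unfold a3
  positivity

theorem b3_nonneg (hδ : 0 < δ) : 0 ≤ p.b3 δ := by
  unfold b3
  positivity

theorem stepDen_pos (hκ : 0 ≤ κ) (hδ : 0 < δ) :
    0 < m + p.a3 δ / (p.lam + κ) + p.b3 δ / Real.sqrt (p.lam + κ) := by
  have := p.lam_add_pos hκ
  have := p.a3_nonneg hδ
  have := p.b3_nonneg hδ
  have := p.m_real_pos
  positivity

theorem stepSize_pos (hκ : 0 ≤ κ) (hδ : 0 < δ) : 0 < p.stepSize κ δ := by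
  have := p.stepDen_pos hκ hδ
  unfold stepSize
  positivity

/-- The budget `1/8` is shared by the three terms in the denominator of `θ`; the parameter estimates
spend these shares. -/
theorem stepSize_identity (hκ : 0 ≤ κ) (hδ : 0 < δ) :
    p.stepSize κ δ * m + p.stepSize κ δ * (p.a3 δ / (p.lam + κ))
      + p.stepSize κ δ * (p.b3 δ / Real.sqrt (p.lam + κ)) = 1 / 8 := by
  have := p.stepDen_pos hκ hδ
  rw [← mul_add, ← mul_add, stepSize]
  field_simp

theorem stepSize_mul_le (hκ : 0 ≤ κ) (hδ : 0 < δ) : p.stepSize κ δ * m ≤ 1 / 8 := by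
  have h := p.stepSize_identity hκ hδ
  have := p.lam_add_pos hκ
  have := p.a3_nonneg hδ
  have := p.b3_nonneg hδ
  have := p.stepSize_pos hκ hδ
  have h1 : 0 ≤ p.stepSize κ δ * (p.a3 δ / (p.lam + κ)) := by positivity
  have h2 : 0 ≤ p.stepSize κ δ * (p.b3 δ / Real.sqrt (p.lam + κ)) := by positivity
  linarith

theorem rho_nonneg (hκ : 0 ≤ κ) (hδ : 0 < δ) : 0 ≤ p.rho κ δ := by
  have := p.lam_add_pos hκ
  have := p.R_nonneg
  unfold rho
  positivity

theorem errWeight_nonneg (hκ : 0 ≤ κ) (hδ : 0 < δ) : 0 ≤ p.errWeight κ δ := by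
  have := p.lam_add_pos hκ
  have := p.rho_nonneg hκ hδ
  have := p.stepSize_pos hκ hδ
  unfold errWeight
  positivity

/-- The residual `α_{iτ} + ∇φ_{iτ}(A_{iτ}ᵀ x)` at `x = ∇ξ*(u)`. -/
def resid (κ : ℝ) (y : Vec d) (s : SDCAState d t n m) (τ : Fin n) (i : Fin m) : Vec t :=
  s.α τ i + gradient (p.φ τ i) ((p.A τ i).adjoint (p.primalPoint κ y s.u))

/-- The mean squared residual. -/
def meanResid (κ : ℝ) (y : Vec d) (s : SDCAState d t n m) : ℝ :=
  (1 / ((m : ℝ) * n)) * ∑ τ, ∑ i, ‖p.resid κ y s τ i‖ ^ 2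

/-- The mean of the local errors. -/
def _root_.SDCAState.meanErr (s : SDCAState d t n m) : Vec d := (1 / (n : ℝ)) • ∑ τ, s.e τ

/-- The states that EC-SDCA can reach: the conjugates are finite at the dual variables, and `u`
and the local errors add up to `v(α)`. -/
structure Consistent (κ : ℝ) (s : SDCAState d t n m) : Prop where
  feasible : p.Feasible s.α
  sum_eq : s.u + (1 / (n : ℝ)) • ∑ τ, s.e τ = p.dualToPrimal κ s.α

variable {S : Type*} (Q : Vec d → S → Vec d)

theorem step_α (y : Vec d) (draw : Fin n → Fin m × S) (s : SDCAState d t n m) (τ : Fin n) :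
    (p.step Q κ δ y draw s).α τ = Function.update (s.α τ) (draw τ).1
      (s.α τ (draw τ).1 - (p.stepSize κ δ * m) • p.resid κ y s τ (draw τ).1) := by
  simp only [step, resid]
  congr 1
  module

/-- The vector that node `τ` wants to send, without the accumulated error. -/
def localUpdate (κ δ : ℝ) (y : Vec d) (s : SDCAState d t n m) (τ : Fin n) (i : Fin m) : Vec d :=
  -(p.stepSize κ δ / (p.lam + κ)) • p.A τ i (p.resid κ y s τ i)

theorem step_local (hκ : 0 ≤ κ) (y : Vec d) (s : SDCAState d t n m) (τ : Fin n) (i : Fin m) :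
    (1 / ((p.lam + κ) * m)) • p.A τ i (-((p.stepSize κ δ * m) • s.α τ i)
      - (p.stepSize κ δ * m) •
          gradient (p.φ τ i) ((p.A τ i).adjoint (p.primalPoint κ y s.u)))
      = p.localUpdate κ δ y s τ i := by
  have := p.lam_add_pos hκ
  have := p.m_real_pos
  have e : -((p.stepSize κ δ * m) • s.α τ i) - (p.stepSize κ δ * m) •
      gradient (p.φ τ i) ((p.A τ i).adjoint (p.primalPoint κ y s.u))
      = (-(p.stepSize κ δ * m)) • p.resid κ y s τ i := by
    rw [resid]; module
  rw [e, map_smul, localUpdate, smul_smul]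
  congr 1
  field_simp

theorem step_e (hκ : 0 ≤ κ) (y : Vec d) (draw : Fin n → Fin m × S) (s : SDCAState d t n m)
    (τ : Fin n) :
    (p.step Q κ δ y draw s).e τ = (p.localUpdate κ δ y s τ (draw τ).1 + s.e τ)
      - Q (p.localUpdate κ δ y s τ (draw τ).1 + s.e τ) (draw τ).2 := by
  simp only [step, p.step_local hκ]
  abel_nf

theorem step_u (hκ : 0 ≤ κ) (y : Vec d) (draw : Fin n → Fin m × S) (s : SDCAState d t n m) :
    (p.step Q κ δ y draw s).u = s.u
      + (1 / (n : ℝ)) • ∑ τ, Q (p.localUpdate κ δ y s τ (draw τ).1 + s.e τ) (draw τ).2 := by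
  simp only [step, p.step_local hκ]

theorem step_dualToPrimal (hκ : 0 ≤ κ) (y : Vec d) (draw : Fin n → Fin m × S)
    (s : SDCAState d t n m) :
    p.dualToPrimal κ (p.step Q κ δ y draw s).α = p.dualToPrimal κ s.α
      + ∑ τ, (1 / (n : ℝ)) • p.localUpdate κ δ y s τ (draw τ).1 := by
  have hL := p.lam_add_pos hκ
  have hm := p.m_real_pos
  have hn := p.n_real_pos
  have h : ∀ τ, ∑ i, p.A τ i ((p.step Q κ δ y draw s).α τ i) = ∑ i, p.A τ i (s.α τ i)
      + (-(p.stepSize κ δ * m)) • p.A τ (draw τ).1 (p.resid κ y s τ (draw τ).1) := by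
    intro τ
    rw [← sub_eq_iff_eq_add', ← Finset.sum_sub_distrib, Finset.sum_eq_single (draw τ).1]
    · rw [step_α, Function.update_self, ← map_sub, ← map_smul]
      congr 1
      module
    · intro i _ hi
      rw [step_α, Function.update_of_ne hi, sub_self]
    · simp
  simp only [dualToPrimal, h, Finset.sum_add_distrib, smul_add, localUpdate, Finset.smul_sum,
    smul_smul]
  congr 1
  refine Finset.sum_congr rfl fun τ _ => ?_
  congr 1
  field_simp

/-- The new `-α` is a convex combination of the old one and a gradient, with weight `θ m ≤ 1/8`.
Strong convexity of the conjugate applies, and Fenchel–Young equality evaluates it at the gradient.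
-/
theorem step_feasible (hκ : 0 ≤ κ) (hδ : 0 < δ) (y : Vec d) (draw : Fin n → Fin m × S)
    {s : SDCAState d t n m} (hs : p.Feasible s.α) :
    p.Feasible (p.step Q κ δ y draw s).α ∧
    ∀ τ, (fenchelConj (p.φ τ (draw τ).1) (-((p.step Q κ δ y draw s).α τ (draw τ).1))).toReal
      ≤ (fenchelConj (p.φ τ (draw τ).1) (-(s.α τ (draw τ).1))).toReal
        + p.stepSize κ δ * m * (-(fenchelConj (p.φ τ (draw τ).1) (-(s.α τ (draw τ).1))).toReal
          + Inner.inner ℝ ((p.A τ (draw τ).1).adjoint (p.primalPoint κ y s.u))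
            (gradient (p.φ τ (draw τ).1)
              ((p.A τ (draw τ).1).adjoint (p.primalPoint κ y s.u)))
          - p.φ τ (draw τ).1 ((p.A τ (draw τ).1).adjoint (p.primalPoint κ y s.u))
          - p.gam / 2 * (1 - p.stepSize κ δ * m) * ‖p.resid κ y s τ (draw τ).1‖ ^ 2) := by
  have h0 : 0 ≤ p.stepSize κ δ * m := by
    have := p.stepSize_pos hκ hδ
    positivity
  have h1 : p.stepSize κ δ * m ≤ 1 := by linarith [p.stepSize_mul_le hκ hδ]
  have key : ∀ τ, -((p.step Q κ δ y draw s).α τ (draw τ).1)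
      = (1 - p.stepSize κ δ * m) • (-(s.α τ (draw τ).1)) + (p.stepSize κ δ * m) •
        gradient (p.φ τ (draw τ).1) ((p.A τ (draw τ).1).adjoint (p.primalPoint κ y s.u)) := by
    intro τ
    rw [step_α, Function.update_self, resid]
    module
  have h2 := fun τ => fenchelConj_combo p.gam_pos (p.φ_differentiable τ (draw τ).1)
    (p.φ_smooth τ (draw τ).1) (hs τ (draw τ).1)
    (by rw [fenchelConj_gradient (p.φ_convex τ (draw τ).1) (p.φ_differentiable τ (draw τ).1)
          ((p.A τ (draw τ).1).adjoint (p.primalPoint κ y s.u))]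
        exact EReal.coe_ne_top _) h0 h1
  refine ⟨fun τ i => ?_, fun τ => ?_⟩
  · by_cases hi : i = (draw τ).1
    · subst hi
      rw [key]
      exact (h2 τ).1
    · rw [step_α, Function.update_of_ne hi]
      exact hs τ i
  · rw [key]
    refine (h2 τ).2.trans (le_of_eq ?_)
    rw [fenchelConj_gradient (p.φ_convex τ (draw τ).1) (p.φ_differentiable τ (draw τ).1)
          ((p.A τ (draw τ).1).adjoint (p.primalPoint κ y s.u)), EReal.toReal_coe]
    have e : ‖-(s.α τ (draw τ).1) - gradient (p.φ τ (draw τ).1)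
        ((p.A τ (draw τ).1).adjoint (p.primalPoint κ y s.u))‖
        = ‖p.resid κ y s τ (draw τ).1‖ := by
      rw [← norm_neg, resid]
      congr 1
      abel
    rw [e]
    ring

/-- Error compensation: whatever the compressor withholds from `u` is stored in `e_τ`, so `u` plus
the mean error moves by exactly the uncompressed update. -/
theorem Consistent.step (hκ : 0 ≤ κ) (hδ : 0 < δ) (y : Vec d) (draw : Fin n → Fin m × S)
    {s : SDCAState d t n m} (hs : p.Consistent κ s) :
    p.Consistent κ (p.step Q κ δ y draw s) := by
  refine ⟨(p.step_feasible Q hκ hδ y draw hs.feasible).1, ?_⟩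
  rw [p.step_dualToPrimal Q hκ, p.step_u Q hκ, ← hs.sum_eq, ← Finset.smul_sum]
  simp only [p.step_e Q hκ, Finset.sum_sub_distrib, Finset.sum_add_distrib, smul_sub, smul_add]
  abel

/-- Gain of the sampled coordinate in the loss part of the dual objective. -/
def lossGain (κ δ : ℝ) (y : Vec d) (s : SDCAState d t n m) (τ : Fin n) (i : Fin m) : ℝ :=
  p.stepSize κ δ * m * (-(fenchelConj (p.φ τ i) (-(s.α τ i))).toReal
    + Inner.inner ℝ ((p.A τ i).adjoint (p.primalPoint κ y s.u))
      (gradient (p.φ τ i) ((p.A τ i).adjoint (p.primalPoint κ y s.u)))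
    - p.φ τ i ((p.A τ i).adjoint (p.primalPoint κ y s.u))
    - p.gam / 2 * (1 - p.stepSize κ δ * m) * ‖p.resid κ y s τ i‖ ^ 2)

/-- The losses change only in the sampled coordinates, and the conjugate of the regularizer is
1-smooth. The expansion is made at the exact `v(α)`, where the quadratic remainder involves only the
uncompressed updates. -/
theorem gapReal_step_le (hκ : 0 ≤ κ) (hδ : 0 < δ) (y : Vec d) (draw : Fin n → Fin m × S)
    {s : SDCAState d t n m} (hs : p.Feasible s.α) :
    p.gapReal κ y (p.step Q κ δ y draw s).α ≤ p.gapReal κ y s.α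
      + ∑ τ, (1 / ((m : ℝ) * n) * p.lossGain κ δ y s τ (draw τ).1
        + (p.lam + κ) * Inner.inner ℝ (p.primalPoint κ y (p.dualToPrimal κ s.α))
            ((1 / (n : ℝ)) • p.localUpdate κ δ y s τ (draw τ).1))
      + (p.lam + κ) / 2 * ‖∑ τ, (1 / (n : ℝ)) • p.localUpdate κ δ y s τ (draw τ).1‖ ^ 2 := by
  have hL := p.lam_add_pos hκ
  have hN := p.N_pos
  have h1 := (p.step_feasible Q hκ hδ y draw hs).2
  have h2 := mul_le_mul_of_nonneg_left (p.regConj_le hκ y (p.dualToPrimal κ s.α)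
    (p.dualToPrimal κ (p.step Q κ δ y draw s).α)) hL.le
  rw [p.step_dualToPrimal Q hκ, add_sub_cancel_left] at h2
  have h3 : p.conjAvg (p.step Q κ δ y draw s).α ≤ p.conjAvg s.α
      + 1 / ((m : ℝ) * n) * ∑ τ, p.lossGain κ δ y s τ (draw τ).1 := by
    rw [conjAvg, conjAvg, ← mul_add]
    gcongr
    rw [← Finset.sum_add_distrib]
    refine Finset.sum_le_sum fun τ _ => ?_
    rw [← sub_le_iff_le_add', ← Finset.sum_sub_distrib, Finset.sum_eq_single (draw τ).1]
    · rw [sub_le_iff_le_add']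
      exact h1 τ
    · intro i _ hi
      rw [step_α, Function.update_of_ne hi, sub_self]
    · simp
  have h4 : ∀ α, p.gapReal κ y α = p.subOpt κ y + p.conjAvg α
      + (p.lam + κ) * p.regConj κ y (p.dualToPrimal κ α) := fun α => by
    rw [gapReal, dualReal]; ring
  rw [h4, h4, p.step_dualToPrimal Q hκ, Finset.sum_add_distrib, ← Finset.mul_sum, ← Finset.mul_sum,
    ← inner_sum]
  linarith

end

end SumProblem

/-! ### Averages over the sampled indices and choice of parameters -/

namespace SumProblem

variable {d t n m : ℕ} (p : SumProblem d t n m) {κ δ : ℝ}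

section

theorem meanResid_nonneg (y : Vec d) (s : SDCAState d t n m) : 0 ≤ p.meanResid κ y s := by
  unfold meanResid
  positivity

/-- The mean of the change of `v(α)`. -/
def meanUpdate (κ δ : ℝ) (y : Vec d) (s : SDCAState d t n m) : Vec d :=
  ∑ τ, (1 / (m : ℝ)) • ∑ i, (1 / (n : ℝ)) • p.localUpdate κ δ y s τ i

theorem meanUpdate_eq (y : Vec d) (s : SDCAState d t n m) :
    p.meanUpdate κ δ y s = (-(p.stepSize κ δ / ((p.lam + κ) * ((m : ℝ) * n)))) •
      ∑ τ, ∑ i, p.A τ i (p.resid κ y s τ i) := by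
  simp only [meanUpdate, localUpdate, Finset.smul_sum, smul_smul]
  refine Finset.sum_congr rfl fun τ _ => Finset.sum_congr rfl fun i _ => ?_
  congr 1
  rw [div_mul_eq_div_div, div_mul_eq_div_div]
  ring

theorem norm_meanUpdate_sq_le (hκ : 0 ≤ κ) (y : Vec d) (s : SDCAState d t n m) :
    ‖p.meanUpdate κ δ y s‖ ^ 2
      ≤ (p.stepSize κ δ / (p.lam + κ)) ^ 2 * p.R ^ 2 * p.meanResid κ y s := by
  have hL := p.lam_add_pos hκ
  have hm := p.m_real_pos
  have hn := p.n_real_pos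
  rw [meanUpdate_eq, norm_smul, mul_pow, Real.norm_eq_abs, sq_abs, neg_sq]
  refine (mul_le_mul_of_nonneg_left (p.norm_sum_sq_le _) (sq_nonneg _)).trans (le_of_eq ?_)
  rw [meanResid]
  field_simp

/-- Each update is bounded separately through `R_m`. The scaling by `1/n`, squared and summed over
nodes, leaves a factor `1/n`, the source of `R_m²/(nγ)` in `a₃`. -/
theorem var_update_le (hκ : 0 ≤ κ) (y : Vec d) (s : SDCAState d t n m) :
    ∑ τ, (1 / (m : ℝ)) * ∑ i, ‖(1 / (n : ℝ)) • p.localUpdate κ δ y s τ i‖ ^ 2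
      ≤ (p.stepSize κ δ / (p.lam + κ)) ^ 2 * (p.Rm ^ 2 / n) * p.meanResid κ y s := by
  have hL := p.lam_add_pos hκ
  have hm := p.m_real_pos
  have hn := p.n_real_pos
  have hR := p.Rm_nonneg
  calc ∑ τ, (1 / (m : ℝ)) * ∑ i, ‖(1 / (n : ℝ)) • p.localUpdate κ δ y s τ i‖ ^ 2
      ≤ ∑ τ, (1 / (m : ℝ)) * ∑ i, (1 / (n : ℝ)) ^ 2 * ((p.stepSize κ δ / (p.lam + κ)) ^ 2 *
          (p.Rm * ‖p.resid κ y s τ i‖) ^ 2) := by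
        gcongr with τ _ i _
        rw [localUpdate, norm_smul, norm_smul, mul_pow, mul_pow, Real.norm_eq_abs, Real.norm_eq_abs,
          sq_abs, sq_abs, neg_sq]
        gcongr
        exact (ContinuousLinearMap.le_opNorm _ _).trans (by gcongr; exact p.norm_A_le τ i)
    _ = _ := by
        rw [meanResid]
        simp only [mul_pow, Finset.mul_sum]
        refine Finset.sum_congr rfl fun τ _ => Finset.sum_congr rfl fun i _ => ?_
        field_simp

/-- If the first-order term were taken at `x = ∇ξ*(u)`, the average would be `-θ` times the loss
part of the primal-dual gap minus the strong convexity gain. Two corrections appear: the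
regularizer's Fenchel–Young defect, at most `‖e‖²/2`, and the mismatch between `∇ξ*(v)` and `x`, at
most `‖e‖`. -/
theorem gap_mean_le (hκ : 0 ≤ κ) (hδ : 0 < δ) (y : Vec d)
    {s : SDCAState d t n m} (hs : p.Consistent κ s) :
    (∑ τ, (1 / (m : ℝ)) * ∑ i, (1 / ((m : ℝ) * n) * p.lossGain κ δ y s τ i
        + (p.lam + κ) * Inner.inner ℝ (p.primalPoint κ y (p.dualToPrimal κ s.α))
            ((1 / (n : ℝ)) • p.localUpdate κ δ y s τ i)))
      + (p.lam + κ) / 2 * (‖p.meanUpdate κ δ y s‖ ^ 2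
        + ∑ τ, (1 / (m : ℝ)) * ∑ i, ‖(1 / (n : ℝ)) • p.localUpdate κ δ y s τ i‖ ^ 2)
      ≤ -p.stepSize κ δ * (p.subObj κ y (p.primalPoint κ y s.u) - p.dualReal κ y s.α)
        + p.stepSize κ δ * (p.lam + κ) / 2 * ‖s.meanErr‖ ^ 2
        + p.stepSize κ δ * p.R * (Real.sqrt (p.meanResid κ y s) * ‖s.meanErr‖)
        + (p.stepSize κ δ ^ 2 * (p.R ^ 2 + p.Rm ^ 2 / n) / (2 * (p.lam + κ))
          - p.stepSize κ δ * p.gam / 2 * (1 - p.stepSize κ δ * m)) * p.meanResid κ y s := by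
  have hL := p.lam_add_pos hκ
  have hm := p.m_real_pos
  have hn := p.n_real_pos
  have hθ := p.stepSize_pos hκ hδ
  have hW := p.meanResid_nonneg (κ := κ) y s
  set x := p.primalPoint κ y s.u with hx
  set v := p.dualToPrimal κ s.α with hv
  set xv := p.primalPoint κ y v with hxv
  set θ := p.stepSize κ δ with hθdef
  set W := p.meanResid κ y s with hWdef
  have he : v - s.u = s.meanErr := by
    rw [hv, ← hs.sum_eq, SDCAState.meanErr, add_sub_cancel_left]
  have hX := p.norm_meanUpdate_sq_le (δ := δ) hκ y s
  have hV := p.var_update_le (δ := δ) hκ y s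
  have e1 : (∑ τ, (1 / (m : ℝ)) * ∑ i, (1 / ((m : ℝ) * n) * p.lossGain κ δ y s τ i
        + (p.lam + κ) * Inner.inner ℝ xv ((1 / (n : ℝ)) • p.localUpdate κ δ y s τ i)))
      = 1 / ((m : ℝ) * n) * (∑ τ, ∑ i, (1 / (m : ℝ)) * p.lossGain κ δ y s τ i)
        + (p.lam + κ) * Inner.inner ℝ xv (p.meanUpdate κ δ y s) := by
    rw [meanUpdate, inner_sum, Finset.mul_sum, Finset.mul_sum, ← Finset.sum_add_distrib]
    refine Finset.sum_congr rfl fun τ _ => ?_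
    rw [real_inner_smul_right, inner_sum, Finset.sum_add_distrib, ← Finset.mul_sum,
      ← Finset.mul_sum, ← Finset.mul_sum]
    ring
  -- At `x` the gradient products cancel: the conjugates contribute `⟨Aᵀx, ∇φ⟩` and the move of `v`
  -- contributes `-⟨Aᵀx, α + ∇φ⟩`, so only Fenchel–Young sums and the residual gain survive.
  have e2 : 1 / ((m : ℝ) * n) * (∑ τ, ∑ i, (1 / (m : ℝ)) * p.lossGain κ δ y s τ i)
        + (p.lam + κ) * Inner.inner ℝ x (p.meanUpdate κ δ y s)
      = -θ * (1 / ((m : ℝ) * n) * ∑ τ, ∑ i, (p.φ τ i ((p.A τ i).adjoint x)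
          + (fenchelConj (p.φ τ i) (-(s.α τ i))).toReal + Inner.inner ℝ ((p.A τ i).adjoint x) (s.α τ i)))
        - θ * p.gam / 2 * (1 - θ * m) * W := by
    rw [meanUpdate_eq, real_inner_smul_right, hWdef, meanResid, inner_sum]
    simp only [inner_sum, Finset.mul_sum, ← Finset.sum_add_distrib, ← Finset.sum_sub_distrib]
    refine Finset.sum_congr rfl fun τ _ => Finset.sum_congr rfl fun i _ => ?_
    have e3 : Inner.inner ℝ x (p.A τ i (p.resid κ y s τ i))
        = Inner.inner ℝ ((p.A τ i).adjoint x) (s.α τ i)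
          + Inner.inner ℝ ((p.A τ i).adjoint x) (gradient (p.φ τ i) ((p.A τ i).adjoint x)) := by
      rw [← ContinuousLinearMap.adjoint_inner_left, ← inner_add_right]
      rfl
    rw [e3, lossGain, ← hx, ← hθdef]
    field_simp
    ring
  have h3 : p.subReg κ y x + p.regConj κ y v - Inner.inner ℝ x v ≤ 1 / 2 * ‖s.meanErr‖ ^ 2 := by
    have h4 := p.regConj_le hκ y s.u v
    rw [he, ← hx] at h4
    have h5 : p.regConj κ y s.u = Inner.inner ℝ x s.u - p.subReg κ y x := rfl
    have h6 : Inner.inner ℝ x v = Inner.inner ℝ x s.u + Inner.inner ℝ x s.meanErr := by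
      rw [← he, inner_sub_right]; ring
    linarith
  have h7 := p.subObj_sub_dualReal hκ y x s.α
  rw [← hv] at h7
  have h8 : (p.lam + κ) * Inner.inner ℝ (xv - x) (p.meanUpdate κ δ y s)
      ≤ θ * p.R * (Real.sqrt W * ‖s.meanErr‖) := by
    have h9 : ‖xv - x‖ ≤ ‖s.meanErr‖ := by
      refine (p.norm_primalPoint_sub_le hκ y y v s.u).trans (le_of_eq ?_)
      rw [sub_self, smul_zero, add_zero, he]
    have h10 : ‖p.meanUpdate κ δ y s‖ ≤ θ / (p.lam + κ) * p.R * Real.sqrt W := by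
      have hR := p.R_nonneg
      refine abs_le_of_sq_le_sq' ?_ (by positivity) |>.2
      rw [mul_pow, mul_pow, Real.sq_sqrt hW]
      exact hX
    have h11 := (real_inner_le_norm (xv - x) (p.meanUpdate κ δ y s)).trans
      (mul_le_mul h9 h10 (norm_nonneg _) (norm_nonneg _))
    refine (mul_le_mul_of_nonneg_left h11 hL.le).trans (le_of_eq ?_)
    field_simp
  rw [inner_sub_left] at h8
  have h12 : (p.lam + κ) / 2 * (‖p.meanUpdate κ δ y s‖ ^ 2
        + ∑ τ, (1 / (m : ℝ)) * ∑ i, ‖(1 / (n : ℝ)) • p.localUpdate κ δ y s τ i‖ ^ 2)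
      ≤ θ ^ 2 * (p.R ^ 2 + p.Rm ^ 2 / n) / (2 * (p.lam + κ)) * W := by
    calc _ ≤ (p.lam + κ) / 2 * ((θ / (p.lam + κ)) ^ 2 * p.R ^ 2 * W
          + (θ / (p.lam + κ)) ^ 2 * (p.Rm ^ 2 / n) * W) := by gcongr
      _ = _ := by field_simp
  rw [e1]
  have h13 := mul_le_mul_of_nonneg_left h3 (mul_pos hθ hL).le
  rw [h7]
  linarith

/-- Averaging before applying Young's inequality lets the cross term with the old error involve only
the mean update. Hence `R̄` carries the factor `2/δ`, whereas the second moment, measured by `R_m`,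
carries no `1/δ`. -/
theorem err_mean_le (hκ : 0 ≤ κ) (hδ : 0 < δ) (hδ1 : δ < 1) (y : Vec d)
    (s : SDCAState d t n m) (τ : Fin n) :
    (1 / (m : ℝ)) * ∑ i, (1 - δ) * ‖p.localUpdate κ δ y s τ i + s.e τ‖ ^ 2
      ≤ (1 - δ / 2) * ‖s.e τ‖ ^ 2 + (1 - δ) * (2 * p.Rbar ^ 2 + δ * p.Rm ^ 2)
        * (p.stepSize κ δ / (p.lam + κ)) ^ 2 / δ * ((1 / (m : ℝ)) * ∑ i, ‖p.resid κ y s τ i‖ ^ 2) := by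
  have hL := p.lam_add_pos hκ
  have hm := p.m_real_pos
  have hR := p.Rm_nonneg
  set c := p.localUpdate κ δ y s τ
  set e := s.e τ
  set W := (1 / (m : ℝ)) * ∑ i, ‖p.resid κ y s τ i‖ ^ 2 with hW
  set r := (p.stepSize κ δ / (p.lam + κ)) ^ 2
  have hr : 0 ≤ r := sq_nonneg _
  have hW0 : 0 ≤ W := by positivity
  set cb := (1 / (m : ℝ)) • ∑ i, c i with hcb
  have h1 : (1 / (m : ℝ)) * ∑ i, ‖c i‖ ^ 2 ≤ r * p.Rm ^ 2 * W := by
    have : ∀ i, ‖c i‖ ^ 2 ≤ r * p.Rm ^ 2 * ‖p.resid κ y s τ i‖ ^ 2 := by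
      intro i
      have h2 : ‖p.A τ i (p.resid κ y s τ i)‖ ≤ p.Rm * ‖p.resid κ y s τ i‖ :=
        (ContinuousLinearMap.le_opNorm _ _).trans (by gcongr; exact p.norm_A_le τ i)
      have e : ‖c i‖ ^ 2 = r * ‖p.A τ i (p.resid κ y s τ i)‖ ^ 2 := by
        simp only [c, localUpdate, norm_smul, mul_pow, Real.norm_eq_abs, sq_abs, neg_sq, r]
      rw [e, mul_assoc r, ← mul_pow p.Rm]
      exact mul_le_mul_of_nonneg_left (pow_le_pow_left₀ (norm_nonneg _) h2 2) hr
    calc _ ≤ (1 / (m : ℝ)) * ∑ i, r * p.Rm ^ 2 * ‖p.resid κ y s τ i‖ ^ 2 := by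
          gcongr with i _; exact this i
      _ = _ := by rw [← Finset.mul_sum, hW]; ring
  have h3 : ‖cb‖ ^ 2 ≤ r * p.Rbar ^ 2 * W := by
    have h4 : cb = (-(p.stepSize κ δ / (p.lam + κ)) * (1 / (m : ℝ))) •
        ∑ i, p.A τ i (p.resid κ y s τ i) := by
      simp only [hcb, c, localUpdate, ← Finset.smul_sum, smul_smul]
      congr 1
      ring
    rw [h4, norm_smul, mul_pow, Real.norm_eq_abs, sq_abs]
    refine (mul_le_mul_of_nonneg_left (p.norm_avg_local_sq_le τ _) (sq_nonneg _)).trans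
      (le_of_eq ?_)
    rw [mul_pow, neg_sq, hW]
    simp only [r]
    field_simp
  have h5 : (1 / (m : ℝ)) * ∑ i, ‖c i + e‖ ^ 2
      = (1 / (m : ℝ)) * ∑ i, ‖c i‖ ^ 2 + 2 * Inner.inner ℝ cb e + ‖e‖ ^ 2 := by
    simp only [norm_add_sq_real, Finset.sum_add_distrib, Finset.sum_const, Finset.card_univ,
      Fintype.card_fin, nsmul_eq_mul, ← Finset.mul_sum, hcb, real_inner_smul_left, sum_inner]
    field_simp
  have h6 : (1 - δ) * (2 * Inner.inner ℝ cb e) ≤ δ / 2 * ‖e‖ ^ 2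
      + 2 * (1 - δ) / δ * ‖cb‖ ^ 2 := by
    have h7 := real_inner_le_norm cb e
    have h8 : 2 * (‖cb‖ * ‖e‖) ≤ δ / 2 * ‖e‖ ^ 2 + 2 / δ * ‖cb‖ ^ 2 := by
      have h9 := sq_nonneg (δ * ‖e‖ - 2 * ‖cb‖)
      have h10 : δ / 2 * ‖e‖ ^ 2 + 2 / δ * ‖cb‖ ^ 2 - 2 * (‖cb‖ * ‖e‖)
          = (δ * ‖e‖ - 2 * ‖cb‖) ^ 2 / (2 * δ) := by field_simp; ring
      have : 0 ≤ (δ * ‖e‖ - 2 * ‖cb‖) ^ 2 / (2 * δ) := by positivity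
      linarith
    have h11 : (1 - δ) * (2 * Inner.inner ℝ cb e) ≤
        (1 - δ) * (δ / 2 * ‖e‖ ^ 2 + 2 / δ * ‖cb‖ ^ 2) := by
      apply mul_le_mul_of_nonneg_left _ (by linarith)
      linarith
    have h12 : (1 - δ) * (δ / 2 * ‖e‖ ^ 2) ≤ δ / 2 * ‖e‖ ^ 2 := by
      have : 0 ≤ δ / 2 * ‖e‖ ^ 2 := by positivity
      nlinarith
    calc _ ≤ _ := h11
      _ = (1 - δ) * (δ / 2 * ‖e‖ ^ 2) + 2 * (1 - δ) / δ * ‖cb‖ ^ 2 := by ring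
      _ ≤ _ := by linarith
  rw [← Finset.mul_sum, mul_left_comm, h5]
  have hd : 0 ≤ 1 - δ := by linarith
  calc (1 - δ) * ((1 / (m : ℝ)) * ∑ i, ‖c i‖ ^ 2 + 2 * Inner.inner ℝ cb e + ‖e‖ ^ 2)
      = (1 - δ) * ((1 / (m : ℝ)) * ∑ i, ‖c i‖ ^ 2) + (1 - δ) * (2 * Inner.inner ℝ cb e)
        + (1 - δ) * ‖e‖ ^ 2 := by ring
    _ ≤ (1 - δ) * (r * p.Rm ^ 2 * W) + (δ / 2 * ‖e‖ ^ 2 + 2 * (1 - δ) / δ * (r * p.Rbar ^ 2 * W))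
        + (1 - δ) * ‖e‖ ^ 2 := by
        refine add_le_add (add_le_add (mul_le_mul_of_nonneg_left h1 hd) (h6.trans ?_)) le_rfl
        gcongr
    _ = _ := by field_simp; ring

/-- The parameter inequality behind the choice of `θ` and `ρ`. -/
theorem coeff_nonpos (hκ : 0 ≤ κ) (hδ : 0 < δ) (hδ1 : δ < 1) :
    p.stepSize κ δ ^ 2 * (p.R ^ 2 + p.Rm ^ 2 / n) / (2 * (p.lam + κ))
      - p.stepSize κ δ * p.gam / 2 * (1 - p.stepSize κ δ * m)
      + p.stepSize κ δ ^ 2 * p.R * Real.sqrt ((1 - δ) * (2 * p.Rbar ^ 2 + δ * p.Rm ^ 2))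
          / (δ * (p.lam + κ))
      + 2 * (p.rho κ δ + p.stepSize κ δ * (p.lam + κ)) / δ *
          ((1 - δ) * (2 * p.Rbar ^ 2 + δ * p.Rm ^ 2) * (p.stepSize κ δ / (p.lam + κ)) ^ 2 / δ) ≤ 0 := by
  have hL := p.lam_add_pos hκ
  have hm := p.m_real_pos
  have hn := p.n_real_pos
  have hγ := p.gam_pos
  have hR := p.R_nonneg
  have hRm := p.Rm_nonneg
  have hRb := p.Rbar_nonneg
  have hθ := p.stepSize_pos hκ hδ
  have hid := p.stepSize_identity hκ hδ
  have ha := p.a3_nonneg hδ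
  have hb := p.b3_nonneg hδ
  set θ := p.stepSize κ δ
  set Λ := p.lam + κ
  have h1δ : 0 < 1 - δ := by linarith
  set H := (1 - δ) * (2 * p.Rbar ^ 2 + δ * p.Rm ^ 2) with hH
  have hH0 : 0 ≤ H := by positivity
  set a := θ * (p.a3 δ / Λ) with haa
  set b := θ * (p.b3 δ / Real.sqrt Λ) with hbb
  have ha0 : 0 ≤ a := by positivity
  have hb0 : 0 ≤ b := by positivity
  -- Subadditivity of the root separates the `R̄` and `R_m` parts, which match the last two terms of
  -- `a₃` after multiplication by `R/δ`.
  have hsH : Real.sqrt H ≤ Real.sqrt 2 * (Real.sqrt (1 - δ) * p.Rbar)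
      + Real.sqrt δ * (Real.sqrt (1 - δ) * p.Rm) := by
    rw [Real.sqrt_le_left (by positivity)]
    have s2 := Real.sq_sqrt (zero_le_two (α := ℝ))
    have s1 := Real.sq_sqrt h1δ.le
    have sδ := Real.sq_sqrt hδ.le
    have e : (Real.sqrt 2 * (Real.sqrt (1 - δ) * p.Rbar)
      + Real.sqrt δ * (Real.sqrt (1 - δ) * p.Rm)) ^ 2 = H +
        2 * (Real.sqrt 2 * (Real.sqrt (1 - δ) * p.Rbar)) * (Real.sqrt δ * (Real.sqrt (1 - δ) * p.Rm)) := by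
      rw [add_sq, mul_pow, mul_pow, mul_pow, mul_pow, s2, s1, sδ, hH]
      ring
    rw [e]
    have : 0 ≤ 2 * (Real.sqrt 2 * (Real.sqrt (1 - δ) * p.Rbar)) *
      (Real.sqrt δ * (Real.sqrt (1 - δ) * p.Rm)) := by positivity
    linarith
  have hs2 : Real.sqrt 2 ≤ 3 / 2 := by
    rw [Real.sqrt_le_left (by norm_num)]; norm_num
  have hs2' : 1 ≤ Real.sqrt 2 := by
    rw [Real.one_le_sqrt]; norm_num
  have hsH2 : Real.sqrt H ≤ 3 / 2 * (Real.sqrt (1 - δ) * p.Rbar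
      + Real.sqrt δ * (Real.sqrt (1 - δ) * p.Rm)) := by
    refine hsH.trans ?_
    have k1 : 0 ≤ Real.sqrt (1 - δ) * p.Rbar := by positivity
    have k2 : 0 ≤ Real.sqrt δ * (Real.sqrt (1 - δ) * p.Rm) := by positivity
    nlinarith
  -- The choice of `ρ` balances the two uses of `R √H`: its share of the compression loss equals the
  -- loss from the Young estimate in `cross_term_le`.
  have hrho : 2 * p.rho κ δ / δ * (H * (θ / Λ) ^ 2 / δ) = θ ^ 2 * p.R * Real.sqrt H / (δ * Λ) := by
    rw [rho, ← hH]
    rcases hH0.eq_or_lt with h0 | h0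
    · rw [← h0]; simp
    · have hs : 0 < Real.sqrt H := Real.sqrt_pos.2 h0
      nth_rw 2 [← Real.sq_sqrt hH0]
      change 2 * (δ * Λ * p.R / (2 * Real.sqrt H)) / δ * (Real.sqrt H ^ 2 * (θ / Λ) ^ 2 / δ) = _
      field_simp
  have hA : 2 * (θ ^ 2 * p.R * Real.sqrt H / (δ * Λ))
      + θ ^ 2 * (p.R ^ 2 + p.Rm ^ 2 / n) / (2 * Λ) ≤ 3 * (θ * p.gam * a) := by
    have k : θ * p.gam * a = θ ^ 2 / Λ * (p.Rm ^ 2 / n + p.R ^ 2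
        + p.R / δ * (Real.sqrt (1 - δ) * p.Rbar)
        + p.R / δ * (Real.sqrt δ * (Real.sqrt (1 - δ) * p.Rm))) := by
      rw [haa, a3]
      have : Real.sqrt (1 - δ) * p.R * p.Rm / (Real.sqrt δ * p.gam)
          = p.R / δ * (Real.sqrt δ * (Real.sqrt (1 - δ) * p.Rm)) / p.gam := by
        have hsδ : 0 < Real.sqrt δ := Real.sqrt_pos.2 hδ
        field_simp
        rw [Real.sq_sqrt hδ.le]
        try ring
      rw [this]
      field_simp
    have k1 : θ ^ 2 * p.R * Real.sqrt H / (δ * Λ) ≤ θ ^ 2 / Λ * (p.R / δ * (3 / 2 * (Real.sqrt (1 - δ) * p.Rbar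
      + Real.sqrt δ * (Real.sqrt (1 - δ) * p.Rm)))) := by
      calc _ = θ ^ 2 / Λ * (p.R / δ * Real.sqrt H) := by field_simp
        _ ≤ _ := by gcongr
    have k2 : θ ^ 2 * (p.R ^ 2 + p.Rm ^ 2 / n) / (2 * Λ)
        ≤ θ ^ 2 / Λ * (3 * (p.Rm ^ 2 / n + p.R ^ 2)) := by
      have k3 : 0 ≤ θ ^ 2 / Λ * (p.Rm ^ 2 / n + p.R ^ 2) := by positivity
      calc _ = 1 / 2 * (θ ^ 2 / Λ * (p.Rm ^ 2 / n + p.R ^ 2)) := by field_simp; ring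
        _ ≤ 3 * (θ ^ 2 / Λ * (p.Rm ^ 2 / n + p.R ^ 2)) := by linarith
        _ = _ := by ring
    rw [k]
    refine (add_le_add (mul_le_mul_of_nonneg_left k1 zero_le_two) k2).trans (le_of_eq ?_)
    ring
  have hB : 2 * (θ * Λ) / δ * (H * (θ / Λ) ^ 2 / δ) ≤ 4 * (θ * p.gam) * b ^ 2 := by
    have k : b ^ 2 = θ ^ 2 / Λ * ((1 - δ) * (p.Rbar ^ 2 + δ * p.Rm ^ 2) / p.gam) / δ ^ 2 := by
      rw [hbb, b3, mul_pow, div_pow, mul_pow, Real.sq_sqrt (by positivity), Real.sq_sqrt hL.le]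
      field_simp
    rw [k]
    have k2 : H ≤ 2 * ((1 - δ) * (p.Rbar ^ 2 + δ * p.Rm ^ 2)) := by
      rw [hH]
      have : 0 ≤ (1 - δ) * (δ * p.Rm ^ 2) := by positivity
      linarith
    calc _ = 2 * θ ^ 3 / (Λ * δ ^ 2) * H := by field_simp
      _ ≤ 2 * θ ^ 3 / (Λ * δ ^ 2) * (2 * ((1 - δ) * (p.Rbar ^ 2 + δ * p.Rm ^ 2))) := by gcongr
      _ = _ := by field_simp; ring
  -- Here `θ m + a + b = 1/8`, so `b ≤ 1/8` and `4 b² ≤ b/2`; the sum is then well below the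
  -- available `1/2`.
  have hfin : 3 * a + 4 * b ^ 2 + θ * m / 2 ≤ 1 / 2 := by
    have : b ≤ 1 / 8 := by nlinarith [mul_pos hθ hm]
    nlinarith [mul_pos hθ hm]
  have hg := mul_le_mul_of_nonneg_left hfin (mul_pos hθ hγ).le
  have e : 2 * (p.rho κ δ + θ * Λ) / δ * (H * (θ / Λ) ^ 2 / δ)
      = 2 * p.rho κ δ / δ * (H * (θ / Λ) ^ 2 / δ) + 2 * (θ * Λ) / δ * (H * (θ / Λ) ^ 2 / δ) := by ring
  rw [e, hrho]
  linarith

/-- Young's inequality with `ρ` tuned so that the difference of the two sides is a perfect square.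
The case `R = 0` is separate; for `R > 0` also `R_m > 0`, and the root in the denominator of `ρ` is
positive. -/
theorem cross_term_le (hκ : 0 ≤ κ) (hδ : 0 < δ) (hδ1 : δ < 1) {w e : ℝ} (hw : 0 ≤ w) :
    p.stepSize κ δ * p.R * (Real.sqrt w * e) ≤ p.rho κ δ / 2 * e ^ 2
      + p.stepSize κ δ ^ 2 * p.R * Real.sqrt ((1 - δ) * (2 * p.Rbar ^ 2 + δ * p.Rm ^ 2))
          / (δ * (p.lam + κ)) * w := by
  have hL := p.lam_add_pos hκ
  have hR := p.R_nonneg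
  have hθ := p.stepSize_pos hκ hδ
  have h1δ : 0 < 1 - δ := by linarith
  set H := (1 - δ) * (2 * p.Rbar ^ 2 + δ * p.Rm ^ 2) with hH
  rcases hR.eq_or_lt with h0 | h0
  · simp [rho, ← h0]
  · have hRm : 0 < p.Rm := lt_of_le_of_ne p.Rm_nonneg fun h => h0.ne' (p.R_eq_zero h.symm)
    have hH0 : 0 < H := by positivity
    have hs : 0 < Real.sqrt H := Real.sqrt_pos.2 hH0
    rw [rho, ← hH]
    have e1 : δ * (p.lam + κ) * p.R / (2 * Real.sqrt H) / 2 * e ^ 2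
        + p.stepSize κ δ ^ 2 * p.R * Real.sqrt H / (δ * (p.lam + κ)) * w
        - p.stepSize κ δ * p.R * (Real.sqrt w * e)
        = p.R / (4 * Real.sqrt H * δ * (p.lam + κ)) *
          (δ * (p.lam + κ) * e - 2 * p.stepSize κ δ * Real.sqrt H * Real.sqrt w) ^ 2 := by
      rw [sub_sq, mul_pow (2 * p.stepSize κ δ * Real.sqrt H), Real.sq_sqrt hw]
      field_simp
      ring
    have : 0 ≤ p.R / (4 * Real.sqrt H * δ * (p.lam + κ)) *
          (δ * (p.lam + κ) * e - 2 * p.stepSize κ δ * Real.sqrt H * Real.sqrt w) ^ 2 := by positivity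
    linarith

theorem norm_meanErr_sq_le (p : SumProblem d t n m) (s : SDCAState d t n m) :
    ‖s.meanErr‖ ^ 2 ≤ (1 / (n : ℝ)) * ∑ τ, ‖s.e τ‖ ^ 2 := by
  have hn := p.n_real_pos
  rw [SDCAState.meanErr, norm_smul, mul_pow, Real.norm_eq_abs, sq_abs]
  have h1 : ‖∑ τ, s.e τ‖ ^ 2 ≤ (∑ τ, ‖s.e τ‖) ^ 2 := by gcongr; exact norm_sum_le _ _
  have h2 := sq_sum_le_card_mul_sum_sq (s := Finset.univ) (f := fun τ => ‖s.e τ‖)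
  rw [Finset.card_univ, Fintype.card_fin] at h2
  calc _ ≤ (1 / (n : ℝ)) ^ 2 * (n * ∑ τ, ‖s.e τ‖ ^ 2) := by gcongr; exact h1.trans h2
    _ = _ := by field_simp

/-- The contraction factor of EC-SDCA. -/
def contr (κ δ : ℝ) : ℝ := min (p.stepSize κ δ / 2) (δ / 4)

/-- The bound of the conditional mean of the Lyapunov function, before the expectation is
taken. -/
theorem lyap_mean_le (hκ : 0 ≤ κ) (hδ : 0 < δ) (hδ1 : δ < 1) (y : Vec d)
    {s : SDCAState d t n m} (hs : p.Consistent κ s) :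
    p.gapReal κ y s.α
      + ((∑ τ, (1 / (m : ℝ)) * ∑ i, (1 / ((m : ℝ) * n) * p.lossGain κ δ y s τ i
        + (p.lam + κ) * Inner.inner ℝ (p.primalPoint κ y (p.dualToPrimal κ s.α))
            ((1 / (n : ℝ)) • p.localUpdate κ δ y s τ i)))
      + (p.lam + κ) / 2 * (‖p.meanUpdate κ δ y s‖ ^ 2
        + ∑ τ, (1 / (m : ℝ)) * ∑ i, ‖(1 / (n : ℝ)) • p.localUpdate κ δ y s τ i‖ ^ 2))
      + p.errWeight κ δ * ∑ τ, (1 / (m : ℝ)) * ∑ i, (1 - δ) * ‖p.localUpdate κ δ y s τ i + s.e τ‖ ^ 2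
      ≤ (1 - p.contr κ δ) * p.lyapReal κ δ y s
        - p.stepSize κ δ / 2 * (p.subObj κ y (p.primalPoint κ y s.u) - p.subOpt κ y) := by
  have hL := p.lam_add_pos hκ
  have hm := p.m_real_pos
  have hn := p.n_real_pos
  have hθ := p.stepSize_pos hκ hδ
  have hρ := p.rho_nonneg hκ hδ
  have hw := p.errWeight_nonneg hκ hδ
  have hW := p.meanResid_nonneg (κ := κ) y s
  have h1 := p.gap_mean_le hκ hδ y hs
  have h2 := p.cross_term_le hκ hδ hδ1 (e := ‖s.meanErr‖) hW
  have h3 := p.coeff_nonpos hκ hδ hδ1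
  have h4 := p.norm_meanErr_sq_le s
  have hg := p.gapReal_nonneg hκ y hs.feasible
  have hsub := p.subOpt_le hκ y (p.primalPoint κ y s.u)
  set E := ∑ τ, ‖s.e τ‖ ^ 2 with hE
  have hE0 : 0 ≤ E := by positivity
  set W := p.meanResid κ y s with hWdef
  set θ := p.stepSize κ δ with hθd
  set Λ := p.lam + κ
  set H := (1 - δ) * (2 * p.Rbar ^ 2 + δ * p.Rm ^ 2) with hH
  set ρ := p.rho κ δ
  have h5 : ∑ τ, (1 / (m : ℝ)) * ∑ i, (1 - δ) * ‖p.localUpdate κ δ y s τ i + s.e τ‖ ^ 2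
      ≤ (1 - δ / 2) * E + n * (H * (θ / Λ) ^ 2 / δ) * W := by
    calc _ ≤ ∑ τ, ((1 - δ / 2) * ‖s.e τ‖ ^ 2
          + H * (θ / Λ) ^ 2 / δ * ((1 / (m : ℝ)) * ∑ i, ‖p.resid κ y s τ i‖ ^ 2)) :=
          Finset.sum_le_sum fun τ _ => p.err_mean_le hκ hδ hδ1 y s τ
      _ = _ := by
        rw [Finset.sum_add_distrib, ← Finset.mul_sum, ← Finset.mul_sum, ← Finset.mul_sum, hWdef,
          meanResid, hE]
        field_simp
  have h6 := mul_le_mul_of_nonneg_left h5 hw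
  have hew : p.errWeight κ δ = 2 * (ρ + θ * Λ) / δ * (1 / n) := by
    rw [errWeight]; field_simp; rfl
  have h7 : p.errWeight κ δ * ((1 - δ / 2) * E + n * (H * (θ / Λ) ^ 2 / δ) * W)
      = p.errWeight κ δ * E - (ρ + θ * Λ) * ((1 / n) * E)
        + (2 * (ρ + θ * Λ) / δ * (H * (θ / Λ) ^ 2 / δ)) * W := by
    rw [hew]; field_simp
  rw [h7] at h6
  have h8 := mul_le_mul_of_nonneg_left h4 (by positivity : 0 ≤ (ρ + θ * Λ) / 2)
  have h9 := mul_nonneg_of_nonpos_of_nonpos (neg_nonpos.2 hW) h3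
  have hc1 : p.contr κ δ ≤ θ / 2 := min_le_left _ _
  have hc2 : p.contr κ δ ≤ δ / 4 := min_le_right _ _
  have h10 := mul_le_mul_of_nonneg_right hc1 hg
  have h11 := mul_le_mul_of_nonneg_right hc2 (mul_nonneg hw hE0)
  -- The old errors shrink by `δ/2`. One half pays for `(ρ + θ(λ+κ))/2 ‖e‖²` in the dual estimate;
  -- the other half is the rate `δ/4`.
  have h12 : δ / 4 * (p.errWeight κ δ * E) = (ρ + θ * Λ) / 2 * ((1 / n) * E) := by
    rw [hew]; field_simp; norm_num
  -- The primal-dual gap is primal plus dual suboptimality. Of the decrease `-θ` of each, `θ/2` is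
  -- used: one contracts the dual gap, the other remains in the conclusion.
  have h13 : p.subObj κ y (p.primalPoint κ y s.u) - p.dualReal κ y s.α
      = (p.subObj κ y (p.primalPoint κ y s.u) - p.subOpt κ y) + p.gapReal κ y s.α := by
    rw [gapReal]; ring
  rw [h13] at h1
  have h14 : 0 ≤ θ * (p.subObj κ y (p.primalPoint κ y s.u) - p.subOpt κ y) :=
    mul_nonneg hθ.le (sub_nonneg.2 hsub)
  have hlyap : p.lyapReal κ δ y s = p.gapReal κ y s.α + p.errWeight κ δ * E := rfl
  rw [hlyap]
  have h15 : 0 ≤ θ * p.gapReal κ y s.α := mul_nonneg hθ.le hg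
  nlinarith

end

end SumProblem

/-! ### Moments of uniform indices and compressor seeds -/

section UniformDraws

theorem uniformOn_univ_real_singleton {m : ℕ} (j : Fin m) :
    (uniformOn (Set.univ : Set (Fin m))).real {j} = 1 / (m : ℝ) := by
  rw [Measure.real, uniformOn_univ]
  simp

theorem uniformOn_univ_singleton {m : ℕ} (j : Fin m) :
    (uniformOn (Set.univ : Set (Fin m))) {j} = ENNReal.ofReal (1 / (m : ℝ)) := by
  rw [← uniformOn_univ_real_singleton j, Measure.real, ENNReal.ofReal_toReal (measure_ne_top _ _)]

theorem integral_uniformOn_univ {m : ℕ} (f : Fin m → ℝ) :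
    ∫ j, f j ∂(uniformOn (Set.univ : Set (Fin m))) = (1 / (m : ℝ)) * ∑ j, f j := by
  rw [integral_fintype Integrable.of_finite, Finset.mul_sum]
  simp only [uniformOn_univ_real_singleton, smul_eq_mul]

variable {n m : ℕ} {S Ω : Type*} [MeasurableSpace S] [MeasurableSpace Ω]

/-- The draws of the nodes in one iteration. -/
structure IsNodeDraw (ν : Measure S) (μ : Measure Ω) (D : Fin n → Ω → Fin m × S) : Prop where
  measurable : ∀ τ, Measurable (D τ)
  indep : iIndepFun D μ
  law : ∀ τ, μ.map (D τ) = (uniformOn (Set.univ : Set (Fin m))).prod ν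

variable {ν : Measure S} {μ : Measure Ω} {D : Fin n → Ω → Fin m × S}

theorem IsNodeDraw.map_fst [IsProbabilityMeasure ν] (hD : IsNodeDraw ν μ D) (τ : Fin n) :
    μ.map (fun ω => (D τ ω).1) = uniformOn (Set.univ : Set (Fin m)) := by
  have : μ.map (fun ω => (D τ ω).1) = (μ.map (D τ)).map Prod.fst := by
    rw [Measure.map_map measurable_fst (hD.measurable τ)]; rfl
  rw [this, hD.law, Measure.map_fst_prod, measure_univ, one_smul]

theorem IsNodeDraw.integrable_index [IsProbabilityMeasure μ] (hD : IsNodeDraw ν μ D) (F : (Fin n → Fin m) → ℝ) :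
    Integrable (fun ω => F fun τ => (D τ ω).1) μ := by
  have hm : Measurable fun ω => fun τ => (D τ ω).1 :=
    measurable_pi_lambda _ fun τ => measurable_fst.comp (hD.measurable τ)
  have : IsFiniteMeasure (μ.map fun ω => fun τ => (D τ ω).1) :=
    Measure.isFiniteMeasure_map _ _
  exact (Integrable.of_finite (μ := μ.map fun ω => fun τ => (D τ ω).1) (f := F)).comp_measurable hm

theorem IsNodeDraw.integral_index [IsProbabilityMeasure ν] (hD : IsNodeDraw ν μ D) (τ : Fin n) (f : Fin m → ℝ) :
    ∫ ω, f (D τ ω).1 ∂μ = (1 / (m : ℝ)) * ∑ j, f j := by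
  have hm : Measurable fun ω => (D τ ω).1 := measurable_fst.comp (hD.measurable τ)
  rw [← integral_uniformOn_univ, ← hD.map_fst τ,
    integral_map hm.aemeasurable (measurable_of_finite f).aestronglyMeasurable]

theorem IsNodeDraw.integral_index_pair [IsProbabilityMeasure ν] [IsProbabilityMeasure μ]
    (hD : IsNodeDraw ν μ D) {τ σ : Fin n} (hτσ : τ ≠ σ)
    (f : Fin m → Fin m → ℝ) :
    ∫ ω, f (D τ ω).1 (D σ ω).1 ∂μ = (1 / (m : ℝ)) * ∑ j, (1 / (m : ℝ)) * ∑ k, f j k := by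
  have hind : IndepFun (fun ω => (D τ ω).1) (fun ω => (D σ ω).1) μ :=
    (hD.indep.indepFun hτσ).comp measurable_fst measurable_fst
  have hmτ : Measurable fun ω => (D τ ω).1 := measurable_fst.comp (hD.measurable τ)
  have hmσ : Measurable fun ω => (D σ ω).1 := measurable_fst.comp (hD.measurable σ)
  have hmap := (indepFun_iff_map_prod_eq_prod_map_map hmτ.aemeasurable hmσ.aemeasurable).1 hind
  have e : ∫ ω, f (D τ ω).1 (D σ ω).1 ∂μ
      = ∫ z, f z.1 z.2 ∂(μ.map fun ω => ((D τ ω).1, (D σ ω).1)) := by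
    rw [integral_map (hmτ.prodMk hmσ).aemeasurable]
    · exact (measurable_of_finite fun z : Fin m × Fin m => f z.1 z.2).aestronglyMeasurable
  have hmap' : μ.map (fun ω => ((D τ ω).1, (D σ ω).1))
      = (uniformOn (Set.univ : Set (Fin m))).prod (uniformOn (Set.univ : Set (Fin m))) := by
    rw [hmap, hD.map_fst, hD.map_fst]
  rw [e, hmap', integral_prod _ Integrable.of_finite]
  simp only [integral_uniformOn_univ]

/-- Second moment of a sum over the nodes: the variances add up. -/
theorem IsNodeDraw.integral_norm_sum_sq_le [IsProbabilityMeasure ν] [IsProbabilityMeasure μ]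
    (hD : IsNodeDraw ν μ D) {d : ℕ}
    (X : Fin n → Fin m → Vec d) :
    ∫ ω, ‖∑ τ, X τ (D τ ω).1‖ ^ 2 ∂μ ≤ ‖∑ τ, (1 / (m : ℝ)) • ∑ i, X τ i‖ ^ 2
      + ∑ τ, (1 / (m : ℝ)) * ∑ i, ‖X τ i‖ ^ 2 := by
  have hexp : ∀ (Y : Fin n → Vec d), ‖∑ τ, Y τ‖ ^ 2 = ∑ τ, ∑ σ, inner ℝ (Y τ) (Y σ) := by
    intro Y
    rw [← real_inner_self_eq_norm_sq, sum_inner]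
    simp only [inner_sum]
  simp only [hexp]
  rw [integral_finsetSum _ fun τ _ => hD.integrable_index fun i =>
    ∑ σ, inner ℝ (X τ (i τ)) (X σ (i σ)), ← Finset.sum_add_distrib]
  refine Finset.sum_le_sum fun τ _ => ?_
  rw [integral_finsetSum _ fun σ _ => hD.integrable_index fun i => inner ℝ (X τ (i τ)) (X σ (i σ))]
  rw [← Finset.add_sum_erase _ _ (Finset.mem_univ τ), ← Finset.add_sum_erase _ _ (Finset.mem_univ τ)]
  have h1 : ∫ ω, inner ℝ (X τ (D τ ω).1) (X τ (D τ ω).1) ∂μ = (1 / (m : ℝ)) * ∑ i, ‖X τ i‖ ^ 2 := by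
    rw [hD.integral_index τ fun i => inner ℝ (X τ i) (X τ i)]
    simp only [real_inner_self_eq_norm_sq]
  have h2 : ∀ σ ∈ Finset.univ.erase τ, ∫ ω, inner ℝ (X τ (D τ ω).1) (X σ (D σ ω).1) ∂μ
      = inner ℝ ((1 / (m : ℝ)) • ∑ i, X τ i) ((1 / (m : ℝ)) • ∑ i, X σ i) := by
    intro σ hσ
    rw [hD.integral_index_pair (Finset.ne_of_mem_erase hσ).symm fun i j => inner ℝ (X τ i) (X σ j),
      real_inner_smul_left, sum_inner]
    simp only [real_inner_smul_right, inner_sum]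
  rw [h1, Finset.sum_congr rfl h2]
  -- The squared norm of the mean contains a diagonal term that the second moment does not; being
  -- nonnegative, it may be added.
  have h3 : (0 : ℝ) ≤ inner ℝ ((1 / (m : ℝ)) • ∑ i, X τ i) ((1 / (m : ℝ)) • ∑ i, X τ i) :=
    real_inner_self_nonneg
  linarith

/-- The law of a draw is a product, so the seed is integrated first, at a frozen index, where the
contraction property applies to a fixed vector. -/
theorem IsNodeDraw.lintegral_compress_le [IsProbabilityMeasure ν] (hD : IsNodeDraw ν μ D) {d : ℕ} {Q : Vec d → S → Vec d}
    {δ : ℝ} (hδ1 : δ < 1) (hQ : IsContractionCompressor ν Q δ) (τ : Fin n) (c : Fin m → Vec d) :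
    ∫⁻ ω, ENNReal.ofReal (‖c (D τ ω).1 - Q (c (D τ ω).1) (D τ ω).2‖ ^ 2) ∂μ
      ≤ ENNReal.ofReal ((1 / (m : ℝ)) * ∑ i, (1 - δ) * ‖c i‖ ^ 2) := by
  have hmeas : Measurable fun z : Fin m × S => ENNReal.ofReal (‖c z.1 - Q (c z.1) z.2‖ ^ 2) := by
    have hc : Measurable fun z : Fin m × S => c z.1 := (measurable_of_finite c).comp measurable_fst
    have hq : Measurable fun z : Fin m × S => Q (c z.1) z.2 :=
      hQ.measurable.comp (hc.prodMk measurable_snd)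
    exact ((hc.sub hq).norm.pow_const 2).ennreal_ofReal
  rw [← lintegral_map (μ := μ) (g := D τ) hmeas (hD.measurable τ), hD.law,
    lintegral_prod _ hmeas.aemeasurable, lintegral_fintype]
  have hb : ∀ i, ∫⁻ s, ENNReal.ofReal (‖c i - Q (c i) s‖ ^ 2) ∂ν
      ≤ ENNReal.ofReal ((1 - δ) * ‖c i‖ ^ 2) := by
    intro i
    rw [← ofReal_integral_eq_lintegral_ofReal (hQ.integrable (c i))
      (Filter.Eventually.of_forall fun s => sq_nonneg _)]
    exact ENNReal.ofReal_le_ofReal (hQ.contraction (c i))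
  have h1 : (0 : ℝ) ≤ 1 - δ := by linarith
  calc _ ≤ ∑ i : Fin m, ENNReal.ofReal ((1 - δ) * ‖c i‖ ^ 2) * ENNReal.ofReal (1 / (m : ℝ)) := by
        refine Finset.sum_le_sum fun i _ => ?_
        rw [uniformOn_univ_singleton]
        gcongr
        exact hb i
    _ = _ := by
        rw [Finset.mul_sum, ENNReal.ofReal_sum_of_nonneg fun i _ => by positivity]
        refine Finset.sum_congr rfl fun i _ => ?_
        rw [← ENNReal.ofReal_mul (by positivity), mul_comm]

end UniformDraws

/-! ### One-step contraction of the Lyapunov function in expectation -/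

namespace SumProblem

variable {d t n m : ℕ} (p : SumProblem d t n m) {κ δ : ℝ}
variable {S Ω : Type*} [MeasurableSpace S] [MeasurableSpace Ω]
  {ν : Measure S} [IsProbabilityMeasure ν] {μ : Measure Ω} [IsProbabilityMeasure μ]
  {D : Fin n → Ω → Fin m × S} {Q : Vec d → S → Vec d}

/-- One iteration of EC-SDCA contracts the Lyapunov function in expectation and controls the
primal suboptimality. -/
theorem lintegral_lyapReal_step_le (hκ : 0 ≤ κ) (hδ : 0 < δ) (hδ1 : δ < 1)
    (hQ : IsContractionCompressor ν Q δ) (hD : IsNodeDraw ν μ D) (y : Vec d)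
    {s : SDCAState d t n m} (hs : p.Consistent κ s) :
    0 ≤ (1 - p.contr κ δ) * p.lyapReal κ δ y s
        - p.stepSize κ δ / 2 * (p.subObj κ y (p.primalPoint κ y s.u) - p.subOpt κ y) ∧
    ∫⁻ ω, ENNReal.ofReal (p.lyapReal κ δ y (p.step Q κ δ y (fun τ => D τ ω) s)) ∂μ
      ≤ ENNReal.ofReal ((1 - p.contr κ δ) * p.lyapReal κ δ y s
        - p.stepSize κ δ / 2 * (p.subObj κ y (p.primalPoint κ y s.u) - p.subOpt κ y)) := by
  have hL := p.lam_add_pos hκ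
  have hw := p.errWeight_nonneg hκ hδ
  set h : Fin n → Fin m → ℝ := fun τ i => 1 / ((m : ℝ) * n) * p.lossGain κ δ y s τ i
        + (p.lam + κ) * Inner.inner ℝ (p.primalPoint κ y (p.dualToPrimal κ s.α))
            ((1 / (n : ℝ)) • p.localUpdate κ δ y s τ i) with hh
  set X : Fin n → Fin m → Vec d := fun τ i => (1 / (n : ℝ)) • p.localUpdate κ δ y s τ i with hX
  set c : Fin n → Fin m → Vec d := fun τ i => p.localUpdate κ δ y s τ i + s.e τ with hc
  -- A majorant of the new dual gap that depends on the indices alone. It takes finitely many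
  -- values, so integrability is automatic, and the seeds enter only through the errors.
  set G : (Fin n → Fin m) → ℝ := fun i => p.gapReal κ y s.α + ∑ τ, h τ (i τ)
    + (p.lam + κ) / 2 * ‖∑ τ, X τ (i τ)‖ ^ 2 with hG
  have hgap : ∀ ω, p.gapReal κ y (p.step Q κ δ y (fun τ => D τ ω) s).α ≤ G fun τ => (D τ ω).1 :=
    fun ω => p.gapReal_step_le Q hκ hδ y (fun τ => D τ ω) hs.feasible
  have hG0 : ∀ ω, 0 ≤ G fun τ => (D τ ω).1 := fun ω =>
    (p.gapReal_nonneg hκ y (hs.step p Q hκ hδ y fun τ => D τ ω).feasible).trans (hgap ω)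
  have hlyap : ∀ ω, ENNReal.ofReal (p.lyapReal κ δ y (p.step Q κ δ y (fun τ => D τ ω) s))
      ≤ ENNReal.ofReal (G fun τ => (D τ ω).1) + ∑ τ, ENNReal.ofReal (p.errWeight κ δ) *
          ENNReal.ofReal (‖c τ (D τ ω).1 - Q (c τ (D τ ω).1) (D τ ω).2‖ ^ 2) := by
    intro ω
    rw [lyapReal]
    refine ENNReal.ofReal_add_le.trans (add_le_add (ENNReal.ofReal_le_ofReal (hgap ω)) ?_)
    rw [ENNReal.ofReal_mul hw, ENNReal.ofReal_sum_of_nonneg fun i _ => sq_nonneg _, Finset.mul_sum]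
    simp only [p.step_e Q hκ, hc, le_refl]
  have hGint : Integrable (fun ω => G fun τ => (D τ ω).1) μ := hD.integrable_index G
  have hGle : ∫ ω, G (fun τ => (D τ ω).1) ∂μ ≤ p.gapReal κ y s.α
      + ((∑ τ, (1 / (m : ℝ)) * ∑ i, h τ i)
      + (p.lam + κ) / 2 * (‖p.meanUpdate κ δ y s‖ ^ 2
        + ∑ τ, (1 / (m : ℝ)) * ∑ i, ‖X τ i‖ ^ 2)) := by
    have i1 : Integrable (fun _ => p.gapReal κ y s.α) μ := integrable_const _
    have i2 : Integrable (fun ω => ∑ τ, h τ (D τ ω).1) μ :=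
      hD.integrable_index fun i => ∑ τ, h τ (i τ)
    have i12 : Integrable (fun ω => p.gapReal κ y s.α + ∑ τ, h τ (D τ ω).1) μ := i1.add i2
    have i3 : Integrable (fun ω => (p.lam + κ) / 2 * ‖∑ τ, X τ (D τ ω).1‖ ^ 2) μ :=
      hD.integrable_index fun i => (p.lam + κ) / 2 * ‖∑ τ, X τ (i τ)‖ ^ 2
    simp only [hG]
    rw [integral_add i12 i3, integral_add i1 i2, integral_const_mul,
      integral_finsetSum _ fun τ _ => hD.integrable_index fun i => h τ (i τ)]
    simp only [hD.integral_index _ (h _), integral_const, probReal_univ, smul_eq_mul,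
      one_mul]
    rw [add_assoc]
    gcongr
    exact hD.integral_norm_sum_sq_le X
  have hmc : ∀ τ, Measurable fun ω => ENNReal.ofReal (p.errWeight κ δ) *
      ENNReal.ofReal (‖c τ (D τ ω).1 - Q (c τ (D τ ω).1) (D τ ω).2‖ ^ 2) := by
    intro τ
    have hcm : Measurable fun ω => c τ (D τ ω).1 :=
      (measurable_of_finite (c τ)).comp (measurable_fst.comp (hD.measurable τ))
    have hq : Measurable fun ω => Q (c τ (D τ ω).1) (D τ ω).2 :=
      hQ.measurable.comp (hcm.prodMk (measurable_snd.comp (hD.measurable τ)))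
    exact (((hcm.sub hq).norm.pow_const 2).ennreal_ofReal).const_mul _
  have h1 : (0 : ℝ) ≤ 1 - δ := by linarith
  have hfin : ∫ ω, G (fun τ => (D τ ω).1) ∂μ
      + p.errWeight κ δ * ∑ τ, (1 / (m : ℝ)) * ∑ i, (1 - δ) * ‖c τ i‖ ^ 2
      ≤ (1 - p.contr κ δ) * p.lyapReal κ δ y s
        - p.stepSize κ δ / 2 * (p.subObj κ y (p.primalPoint κ y s.u) - p.subOpt κ y) := by
    refine le_trans ?_ (p.lyap_mean_le hκ hδ hδ1 y hs)
    gcongr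
  -- The right side dominates an average of nonnegative quantities. This gives a bound on the primal
  -- suboptimality at the current state, with no randomness left.
  refine ⟨le_trans (add_nonneg (integral_nonneg hG0) (by positivity)) hfin, ?_⟩
  calc _ ≤ ∫⁻ ω, (ENNReal.ofReal (G fun τ => (D τ ω).1) + ∑ τ, ENNReal.ofReal (p.errWeight κ δ) *
          ENNReal.ofReal (‖c τ (D τ ω).1 - Q (c τ (D τ ω).1) (D τ ω).2‖ ^ 2)) ∂μ :=
        lintegral_mono hlyap
    _ = ENNReal.ofReal (∫ ω, G (fun τ => (D τ ω).1) ∂μ) + ∑ τ, ENNReal.ofReal (p.errWeight κ δ) *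
          ∫⁻ ω, ENNReal.ofReal (‖c τ (D τ ω).1 - Q (c τ (D τ ω).1) (D τ ω).2‖ ^ 2) ∂μ := by
        rw [lintegral_add_right _ (Finset.measurable_sum _ fun τ _ => hmc τ),
          lintegral_finsetSum _ fun τ _ => hmc τ,
          ofReal_integral_eq_lintegral_ofReal hGint (Filter.Eventually.of_forall hG0)]
        congr 1
        refine Finset.sum_congr rfl fun τ _ => ?_
        rw [lintegral_const_mul' _ _ ENNReal.ofReal_ne_top]
    _ ≤ ENNReal.ofReal (∫ ω, G (fun τ => (D τ ω).1) ∂μ) + ∑ τ, ENNReal.ofReal (p.errWeight κ δ) *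
          ENNReal.ofReal ((1 / (m : ℝ)) * ∑ i, (1 - δ) * ‖c τ i‖ ^ 2) := by
        gcongr with τ _
        exact hD.lintegral_compress_le hδ1 hQ τ (c τ)
    _ = ENNReal.ofReal (∫ ω, G (fun τ => (D τ ω).1) ∂μ
          + p.errWeight κ δ * ∑ τ, (1 / (m : ℝ)) * ∑ i, (1 - δ) * ‖c τ i‖ ^ 2) := by
        rw [ENNReal.ofReal_add (integral_nonneg hG0) (by positivity), ENNReal.ofReal_mul hw,
          ENNReal.ofReal_sum_of_nonneg fun i _ => by positivity, Finset.mul_sum]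
    _ ≤ _ := ENNReal.ofReal_le_ofReal hfin

end SumProblem

/-! ### Measurability of states, stopping times and outer iterates -/

theorem measurable_apply_of_countable {X ι V : Type*} [MeasurableSpace X] [MeasurableSpace ι]
    [MeasurableSpace V] [Countable ι] [MeasurableSingletonClass ι] {F : ι → X → V} {j : X → ι}
    (hF : ∀ i, Measurable (F i)) (hj : Measurable j) : Measurable fun x => F (j x) x :=
  (measurable_from_prod_countable_right (f := fun z : ι × X => F z.1 z.2) hF).comp
    (hj.prodMk measurable_id)

instance SDCAState.instMeasurableSpace {d t n m : ℕ} : MeasurableSpace (SDCAState d t n m) :=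
  MeasurableSpace.comap (fun s => (s.α, s.u, s.e, s.compressedSent, s.uncompressedSent)) inferInstance

namespace SDCAState

variable {d t n m : ℕ} {X : Type*} [MeasurableSpace X]

theorem measurable_toProd : Measurable fun s : SDCAState d t n m =>
    (s.α, s.u, s.e, s.compressedSent, s.uncompressedSent) := comap_measurable _

theorem measurable_α : Measurable fun s : SDCAState d t n m => s.α :=
  measurable_fst.comp measurable_toProd

theorem measurable_u : Measurable fun s : SDCAState d t n m => s.u :=
  measurable_fst.comp (measurable_snd.comp measurable_toProd)

theorem measurable_e : Measurable fun s : SDCAState d t n m => s.e :=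
  measurable_fst.comp (measurable_snd.comp (measurable_snd.comp measurable_toProd))

theorem measurable_compressedSent : Measurable fun s : SDCAState d t n m => s.compressedSent :=
  measurable_fst.comp (measurable_snd.comp (measurable_snd.comp
    (measurable_snd.comp measurable_toProd)))

theorem measurable_uncompressedSent :
    Measurable fun s : SDCAState d t n m => s.uncompressedSent :=
  measurable_snd.comp (measurable_snd.comp (measurable_snd.comp
    (measurable_snd.comp measurable_toProd)))

theorem measurable_of {f : X → SDCAState d t n m}
    (hα : Measurable fun x => (f x).α) (hu : Measurable fun x => (f x).u)
    (he : Measurable fun x => (f x).e) (hc : Measurable fun x => (f x).compressedSent)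
    (hc' : Measurable fun x => (f x).uncompressedSent) : Measurable f := by
  rw [measurable_comap_iff]
  exact hα.prodMk (hu.prodMk (he.prodMk (hc.prodMk hc')))

end SDCAState

namespace SumProblem

variable {d t n m : ℕ} (p : SumProblem d t n m) {κ δ : ℝ}

section

variable {S X : Type*} [MeasurableSpace S] [MeasurableSpace X] {Q : Vec d → S → Vec d}

theorem continuous_gradient (τ : Fin n) (i : Fin m) : Continuous (gradient (p.φ τ i)) := by
  have h : LipschitzWith (Real.toNNReal (1 / p.gam)) (gradient (p.φ τ i)) := by
    refine LipschitzWith.of_dist_le_mul fun z w => ?_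
    rw [dist_eq_norm, dist_eq_norm, Real.coe_toNNReal _ (by have := p.gam_pos; positivity)]
    exact p.φ_smooth τ i z w
  exact h.continuous

theorem measurable_primalPoint (hκ : 0 ≤ κ) {y u : X → Vec d} (hy : Measurable y)
    (hu : Measurable u) : Measurable fun x => p.primalPoint κ (y x) (u x) :=
  (p.continuous_primalPoint hκ).measurable2 hy hu

/-- For a frozen tuple of indices the step is assembled from continuous maps and `Q`; there are only
finitely many tuples to glue. -/
theorem measurable_step (hκ : 0 ≤ κ) (hQ : Measurable (Function.uncurry Q)) {y : X → Vec d}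
    {D : X → Fin n → Fin m × S} {s : X → SDCAState d t n m} (hy : Measurable y)
    (hD : ∀ τ, Measurable fun x => D x τ) (hs : Measurable s) :
    Measurable fun x => p.step Q κ δ (y x) (D x) (s x) := by
  have hu : Measurable fun x => (s x).u := SDCAState.measurable_u.comp hs
  have hα : ∀ τ i, Measurable fun x => (s x).α τ i := fun τ i =>
    (measurable_pi_apply i).comp ((measurable_pi_apply τ).comp (SDCAState.measurable_α.comp hs))
  have he : ∀ τ, Measurable fun x => (s x).e τ := fun τ =>
    (measurable_pi_apply τ).comp (SDCAState.measurable_e.comp hs)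
  have hr : ∀ τ i, Measurable fun x => p.resid κ (y x) (s x) τ i := by
    intro τ i
    refine (hα τ i).add ((p.continuous_gradient τ i).measurable.comp
      ((p.A τ i).adjoint.continuous.measurable.comp ?_))
    exact p.measurable_primalPoint hκ hy hu
  have hl : ∀ τ i, Measurable fun x => p.localUpdate κ δ (y x) (s x) τ i := fun τ i =>
    (measurable_const_smul (-(p.stepSize κ δ / (p.lam + κ)))).comp
      ((p.A τ i).continuous.measurable.comp (hr τ i))
  have key : ∀ i : Fin n → Fin m, Measurable fun x =>
      p.step Q κ δ (y x) (fun τ => (i τ, (D x τ).2)) (s x) := by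
    intro i
    have hq : ∀ τ, Measurable fun x =>
        Q (p.localUpdate κ δ (y x) (s x) τ (i τ) + (s x).e τ) (D x τ).2 := fun τ =>
      hQ.comp (((hl τ (i τ)).add (he τ)).prodMk (measurable_snd.comp (hD τ)))
    apply SDCAState.measurable_of
    · refine measurable_pi_lambda _ fun τ => measurable_pi_lambda _ fun j => ?_
      simp only [step_α]
      by_cases hj : j = i τ
      · subst hj
        simp only [Function.update_self]
        exact (hα τ (i τ)).sub ((measurable_const_smul (p.stepSize κ δ * m)).comp (hr τ (i τ)))
      · simp only [Function.update_of_ne hj]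
        exact hα τ j
    · simp only [p.step_u Q hκ]
      exact hu.add ((measurable_const_smul (1 / (n : ℝ))).comp
        (Finset.measurable_sum _ fun τ _ => hq τ))
    · refine measurable_pi_lambda _ fun τ => ?_
      simp only [p.step_e Q hκ]
      exact ((hl τ (i τ)).add (he τ)).sub (hq τ)
    · change Measurable fun x => (s x).compressedSent + 1
      exact (SDCAState.measurable_compressedSent.comp hs).add_const 1
    · change Measurable fun x => (s x).uncompressedSent
      exact SDCAState.measurable_uncompressedSent.comp hs
  exact measurable_apply_of_countable (j := fun x τ => (D x τ).1) key
    (measurable_pi_lambda _ fun τ => measurable_fst.comp (hD τ))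

theorem measurable_inner (hκ : 0 ≤ κ) (hQ : Measurable (Function.uncurry Q)) {y : X → Vec d}
    {D : X → ℕ → Fin n → Fin m × S} {s : X → SDCAState d t n m} (hy : Measurable y)
    (hs : Measurable s) (K : ℕ) (hD : ∀ L < K, ∀ τ, Measurable fun x => D x L τ) :
    Measurable fun x => p.inner Q κ δ (y x) (D x) (s x) K := by
  induction K with
  | zero => exact hs
  | succ K ih =>
    exact p.measurable_step hκ hQ hy (hD K (Nat.lt_succ_self K))
      (ih fun L hL => hD L (hL.trans (Nat.lt_succ_self K)))

theorem Consistent.inner {S : Type*} {Q : Vec d → S → Vec d} (hκ : 0 ≤ κ) (hδ : 0 < δ) (y : Vec d) (D : ℕ → Fin n → Fin m × S)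
    {s : SDCAState d t n m} (hs : p.Consistent κ s) (K : ℕ) :
    p.Consistent κ (p.inner Q κ δ y D s K) := by
  induction K with
  | zero => exact hs
  | succ K ih => exact ih.step p Q hκ hδ y (D K)

theorem continuous_g : Continuous p.g := p.g_strongConvex.continuous p.lam_pos.le

theorem continuous_obj : Continuous p.obj := p.strongConvexOn_obj.continuous p.lam_pos.le

/-- Expanding the square exhibits the optimal value as a conjugate evaluated at `κ y`. Conjugates
are lower semicontinuous, hence measurable. -/
theorem subOpt_eq (hκ : 0 ≤ κ) (y : Vec d) :
    p.subOpt κ y = κ / 2 * ‖y‖ ^ 2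
      - (fenchelConj (fun x => p.obj x + κ / 2 * ‖x‖ ^ 2) (κ • y)).toReal := by
  have hexp : ∀ x : Vec d, ‖x - y‖ ^ 2 = ‖x‖ ^ 2 - 2 * Inner.inner ℝ x y + ‖y‖ ^ 2 :=
    fun x => norm_sub_sq_real x y
  rw [fenchelConj_eq_of_isMax (z := p.subMin κ hκ y) fun x => ?_, EReal.toReal_coe,
    ← p.subObj_subMin hκ, subObj, hexp, real_inner_smul_right]
  · ring
  · have := p.subOpt_le hκ y x
    rw [← p.subObj_subMin hκ, subObj, subObj, hexp, hexp] at this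
    rw [real_inner_smul_right, real_inner_smul_right]
    linarith

theorem measurable_subOpt (hκ : 0 ≤ κ) : Measurable fun y => p.subOpt κ y := by
  simp only [p.subOpt_eq hκ]
  refine Measurable.sub (by fun_prop) ?_
  exact ((measurable_fenchelConj _).comp (measurable_const_smul κ)).ereal_toReal

theorem measurable_lyapReal (hκ : 0 ≤ κ) {y : X → Vec d} {s : X → SDCAState d t n m}
    (hy : Measurable y) (hs : Measurable s) :
    Measurable fun x => p.lyapReal κ δ (y x) (s x) := by
  have hα : ∀ τ i, Measurable fun x => (s x).α τ i := fun τ i =>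
    (measurable_pi_apply i).comp ((measurable_pi_apply τ).comp (SDCAState.measurable_α.comp hs))
  have he : ∀ τ, Measurable fun x => (s x).e τ := fun τ =>
    (measurable_pi_apply τ).comp (SDCAState.measurable_e.comp hs)
  have hv : Measurable fun x => p.dualToPrimal κ (s x).α :=
    (measurable_const_smul (1 / ((p.lam + κ) * ((m : ℝ) * n)))).comp
      (Finset.measurable_sum _ fun τ _ => Finset.measurable_sum _ fun i _ =>
        (p.A τ i).continuous.measurable.comp (hα τ i))
  have hp := p.measurable_primalPoint hκ hy hv
  have hreg : Measurable fun x => p.regConj κ (y x) (p.dualToPrimal κ (s x).α) := by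
    unfold regConj subReg
    refine (hp.inner hv).sub (Measurable.div_const ?_ _)
    exact (p.continuous_g.measurable.comp hp).add (((hp.sub hy).norm.pow_const 2).const_mul _)
  have hconj : Measurable fun x => p.conjAvg (s x).α :=
    (Finset.measurable_sum _ fun τ _ => Finset.measurable_sum _ fun i _ =>
      ((measurable_fenchelConj (p.φ τ i)).comp (hα τ i).neg).ereal_toReal).const_mul _
  unfold lyapReal gapReal dualReal
  exact (((p.measurable_subOpt hκ).comp hy).sub (hconj.neg.sub (hreg.const_mul _))).add
    ((Finset.measurable_sum _ fun τ _ => (he τ).norm.pow_const 2).const_mul _)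

theorem measurableSet_stopCrit (hκ : 0 ≤ κ) {y : X → Vec d} {s : X → SDCAState d t n m} (ε : ℝ)
    (hy : Measurable y) (hs : Measurable s) (hf : ∀ x, p.Consistent κ (s x)) :
    MeasurableSet {x | p.stopCrit κ δ (y x) ε (s x)} := by
  have hu : Measurable fun x => (s x).u := SDCAState.measurable_u.comp hs
  have hp := p.measurable_primalPoint hκ hy hu
  have h : {x | p.stopCrit κ δ (y x) ε (s x)} = {x | Real.sqrt (4 * n + δ * m * n) *
      p.lyapReal κ δ (y x) (s x) + 2 * (p.subObj κ (y x) (p.primalPoint κ (y x) (s x).u)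
        - p.subOpt κ (y x)) ≤ ε} := by
    ext x
    exact p.stopCrit_iff hκ (y x) ε (hf x).feasible
  rw [h]
  refine measurableSet_le (Measurable.add ((p.measurable_lyapReal hκ hy hs).const_mul _)
    (Measurable.const_mul (Measurable.sub ?_ ((p.measurable_subOpt hκ).comp hy)) _)) measurable_const
  exact (p.continuous_obj.measurable.comp hp).add (((hp.sub hy).norm.pow_const 2).const_mul _)

theorem stopTime_le_iff {S : Type*} (Q : Vec d → S → Vec d) (y : Vec d) (ε : ℝ)
    (D : ℕ → Fin n → Fin m × S) (s : SDCAState d t n m) (N : ℕ) :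
    p.stopTime Q κ δ y ε D s ≤ N ↔
      ∃ K ≤ N, 1 ≤ K ∧ p.stopCrit κ δ y ε (p.inner Q κ δ y D s K) := by
  constructor
  · intro h
    by_contra! hcon
    have : ((N + 1 : ℕ) : ℕ∞) ≤ p.stopTime Q κ δ y ε D s := by
      refine le_iInf fun K => le_iInf fun hK => ?_
      by_contra hlt
      have hlt' : K < N + 1 := by exact_mod_cast not_le.1 hlt
      exact hcon K (Nat.lt_succ_iff.1 hlt') hK.1 hK.2
    have h2 := this.trans h
    have h3 : N + 1 ≤ N := by exact_mod_cast h2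
    omega
  · rintro ⟨K, hKN, hK⟩
    exact (iInf₂_le K hK).trans (by exact_mod_cast hKN)

theorem measurable_stopTime (hκ : 0 ≤ κ) (hδ : 0 < δ) (hQ : Measurable (Function.uncurry Q))
    {y : X → Vec d} (ε : ℝ) {D : X → ℕ → Fin n → Fin m × S} {s : X → SDCAState d t n m}
    (hy : Measurable y) (hs : Measurable s) (hD : ∀ L τ, Measurable fun x => D x L τ)
    (hf : ∀ x, p.Consistent κ (s x)) :
    Measurable fun x => p.stopTime Q κ δ (y x) ε (D x) (s x) := by
  have hle : ∀ N : ℕ, MeasurableSet {x | p.stopTime Q κ δ (y x) ε (D x) (s x) ≤ N} := by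
    intro N
    have e : {x | p.stopTime Q κ δ (y x) ε (D x) (s x) ≤ N} = ⋃ K ∈ Finset.Icc 1 N,
        {x | p.stopCrit κ δ (y x) ε (p.inner Q κ δ (y x) (D x) (s x) K)} := by
      ext x
      simp only [Set.mem_ofPred_eq, p.stopTime_le_iff, Set.mem_iUnion, Finset.mem_Icc, exists_prop]
      constructor
      · rintro ⟨K, h1, h2, h3⟩; exact ⟨K, ⟨h2, h1⟩, h3⟩
      · rintro ⟨K, ⟨h2, h1⟩, h3⟩; exact ⟨K, h1, h2, h3⟩
    rw [e]
    refine Finset.measurableSet_biUnion _ fun K _ => ?_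
    exact p.measurableSet_stopCrit hκ ε hy (p.measurable_inner hκ hQ hy hs K fun L _ => hD L)
      fun x => (hf x).inner p hκ hδ (y x) (D x) K
  rw [ENat.measurable_iff]
  intro N
  have e : (fun x => p.stopTime Q κ δ (y x) ε (D x) (s x)) ⁻¹' {(N : ℕ∞)}
      = {x | p.stopTime Q κ δ (y x) ε (D x) (s x) ≤ N} \
        ⋃ k ∈ Finset.range N, {x | p.stopTime Q κ δ (y x) ε (D x) (s x) ≤ k} := by
    ext x
    simp only [Set.mem_preimage, Set.mem_singleton_iff, Set.mem_sdiff, Set.mem_ofPred_eq,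
      Set.mem_iUnion, Finset.mem_range, exists_prop, not_exists, not_and]
    constructor
    · intro h
      rw [h]
      exact ⟨le_rfl, fun k hk => not_le.2 (by exact_mod_cast hk)⟩
    · rintro ⟨h1, h2⟩
      obtain ⟨k, hk⟩ := ENat.ne_top_iff_exists.1 (ne_top_of_le_ne_top (ENat.natCast_ne_top N) h1)
      rw [← hk] at h1 h2 ⊢
      have h1' : k ≤ N := by exact_mod_cast h1
      by_contra hne
      have hkN : k < N := lt_of_le_of_ne h1' fun h => hne (by rw [h])
      exact h2 k hkN le_rfl
  rw [e]
  exact (hle N).diff (Finset.measurableSet_biUnion _ fun k _ => hle k)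

theorem consistent_zero : p.Consistent κ (SDCAState.zero d t n m) :=
  ⟨p.feasible_zero, by simp [SDCAState.zero, dualToPrimal]⟩

theorem consistent_outer {S : Type*} {Q : Vec d → S → Vec d} (hκ : 0 ≤ κ) (hδ : 0 < δ) (ρ₀ : ℝ) (x₀ : Vec d)
    (D : ℕ → ℕ → Fin n → Fin m × S) (k : ℕ) :
    p.Consistent κ (p.outer Q κ δ ρ₀ x₀ D k).s := by
  induction k with
  | zero => exact p.consistent_zero
  | succ k ih => exact ih.inner p hκ hδ _ _ _

/-- The σ-algebra is arbitrary and only the draws of loops up to `k` enter, so the lemma also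
applies to the σ-algebra generated by those draws, as independence of the next loop requires. -/
theorem measurable_outer (hκ : 0 ≤ κ) (hδ : 0 < δ) (hQ : Measurable (Function.uncurry Q))
    (ρ₀ : ℝ) (x₀ : Vec d) {D : X → ℕ → ℕ → Fin n → Fin m × S} (k : ℕ)
    (hD : ∀ j ≤ k, ∀ L τ, Measurable fun x => D x j L τ) :
    Measurable (fun x => (p.outer Q κ δ ρ₀ x₀ (D x) k).x) ∧
    Measurable (fun x => (p.outer Q κ δ ρ₀ x₀ (D x) k).y) ∧
    Measurable (fun x => (p.outer Q κ δ ρ₀ x₀ (D x) k).s) := by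
  induction k with
  | zero => exact ⟨measurable_const, measurable_const, measurable_const⟩
  | succ k ih =>
    obtain ⟨hx, hy, hs⟩ := ih fun j hj => hD j (hj.trans k.le_succ)
    have hT := p.measurable_stopTime hκ hδ hQ (p.tol ρ₀ x₀ (k + 1)) hy hs (hD (k + 1) le_rfl)
      fun x => p.consistent_outer hκ hδ ρ₀ x₀ (D x) k
    have hs' : Measurable fun x => (p.outer Q κ δ ρ₀ x₀ (D x) (k + 1)).s :=
      measurable_apply_of_countable
        (F := fun K x => p.inner Q κ δ (p.outer Q κ δ ρ₀ x₀ (D x) k).y (D x (k + 1))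
          (p.outer Q κ δ ρ₀ x₀ (D x) k).s K)
        (fun K => p.measurable_inner hκ hQ hy hs K fun L _ => hD (k + 1) le_rfl L)
        (measurable_from_top.comp hT)
    have hx' : Measurable fun x => (p.outer Q κ δ ρ₀ x₀ (D x) (k + 1)).x :=
      p.measurable_primalPoint hκ hy (SDCAState.measurable_u.comp hs')
    exact ⟨hx', hx'.add ((measurable_const_smul (catalystBeta (p.q κ) (k + 1))).comp (hx'.sub hx)), hs'⟩

end

end SumProblem

/-! ### Conditioning on the past by independence -/

section Independence

variable {Ω : Type*} [MeasurableSpace Ω] {μ : Measure Ω}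

/-- Tonelli for the product law; this replaces conditional expectations, since the past `X` can be
frozen while the fresh randomness `Y` is integrated. -/
theorem lintegral_indepFun {α β : Type*} [MeasurableSpace α] [MeasurableSpace β]
    [IsProbabilityMeasure μ] {X : Ω → α} {Y : Ω → β} (h : IndepFun X Y μ) (hX : Measurable X)
    (hY : Measurable Y) {f : α × β → ℝ≥0∞} (hf : Measurable f) :
    ∫⁻ ω, f (X ω, Y ω) ∂μ = ∫⁻ ω, ∫⁻ ω', f (X ω, Y ω') ∂μ ∂μ := by
  have hmap := (indepFun_iff_map_prod_eq_prod_map_map hX.aemeasurable hY.aemeasurable).1 h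
  have : IsProbabilityMeasure (μ.map Y) := Measure.isProbabilityMeasure_map hY.aemeasurable
  rw [← lintegral_map (μ := μ) (g := fun ω => (X ω, Y ω)) hf (hX.prodMk hY), hmap,
    lintegral_prod _ hf.aemeasurable, lintegral_map hf.lintegral_prod_right' hX]
  refine lintegral_congr fun ω => ?_
  exact lintegral_map (f := fun b => f (X ω, b)) (hf.comp measurable_prodMk_left) hY

theorem indepFun_of_disjoint {ι α β γ : Type*} [MeasurableSpace α] [MeasurableSpace β]
    [MeasurableSpace γ] {Z : ι → Ω → γ} (hZ : ∀ i, Measurable (Z i)) (h : iIndepFun Z μ)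
    {A B : Set ι} (hAB : Disjoint A B) {X : Ω → α} {Y : Ω → β}
    (hX : Measurable[⨆ i ∈ A, MeasurableSpace.comap (Z i) inferInstance] X)
    (hY : Measurable[⨆ i ∈ B, MeasurableSpace.comap (Z i) inferInstance] Y) :
    IndepFun X Y μ := by
  rw [IndepFun_iff_Indep]
  have h1 := indep_iSup_of_disjoint (fun i => (hZ i).comap_le) h.iIndep hAB
  exact indep_of_indep_of_le_left (indep_of_indep_of_le_right h1 hY.comap_le) hX.comap_le

theorem measurable_iSup_comap {Ω ι γ : Type*} [MeasurableSpace γ] {Z : ι → Ω → γ} {A : Set ι} {i : ι}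
    (hi : i ∈ A) : Measurable[⨆ i ∈ A, MeasurableSpace.comap (Z i) inferInstance] (Z i) :=
  (comap_measurable (Z i)).mono (le_iSup₂ (f := fun i (_ : i ∈ A) =>
    MeasurableSpace.comap (Z i) inferInstance) i hi) le_rfl

/-- The draws of all nodes in all iterations of one inner loop. -/
structure IsLoopDraw {n m : ℕ} {S : Type*} [MeasurableSpace S]
    (ν : Measure S) (μ : Measure Ω) (D : ℕ → Fin n → Ω → Fin m × S) :
    Prop where
  measurable : ∀ K τ, Measurable (D K τ)
  indep : iIndepFun (fun j : ℕ × Fin n => D j.1 j.2) μ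
  law : ∀ K τ, μ.map (D K τ) = (uniformOn (Set.univ : Set (Fin m))).prod ν

theorem IsLoopDraw.isNodeDraw {n m : ℕ} {S : Type*} [MeasurableSpace S] {ν : Measure S}
    {D : ℕ → Fin n → Ω → Fin m × S} (hD : IsLoopDraw ν μ D)
    (K : ℕ) : IsNodeDraw ν μ (D K) where
  measurable := hD.measurable K
  indep := hD.indep.precomp (g := fun τ => (K, τ)) fun _ _ h => (Prod.ext_iff.1 h).2
  law := hD.law K

end Independence

/-! ### Expected stopping time of the inner loop -/

namespace SumProblem

variable {d t n m : ℕ} (p : SumProblem d t n m) {κ δ : ℝ}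

section

theorem one_div_le_rate (hκ : 0 ≤ κ) (hδ : 0 < δ) : 1 / δ + m ≤ p.rate κ δ := by
  have := p.lam_add_pos hκ
  have := p.a3_nonneg hδ
  have := p.b3_nonneg hδ
  have h1 : 0 ≤ p.a3 δ / (p.lam + κ) := by positivity
  have h2 : 0 ≤ p.b3 δ / Real.sqrt (p.lam + κ) := by positivity
  unfold rate
  linarith

theorem two_le_rate (hκ : 0 ≤ κ) (hδ : 0 < δ) (hδ1 : δ < 1) : 2 ≤ p.rate κ δ := by
  have h := p.one_div_le_rate hκ hδ
  have h1 : 1 ≤ 1 / δ := by rw [one_le_div hδ]; exact hδ1.le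
  linarith [p.one_le_m]

theorem inv_stepSize_le (hκ : 0 ≤ κ) (hδ : 0 < δ) : 1 / p.stepSize κ δ ≤ 8 * p.rate κ δ := by
  have := p.stepDen_pos hκ hδ
  rw [stepSize, one_div_one_div, rate]
  have : 0 ≤ 1 / δ := by positivity
  linarith

theorem inv_contr_le (hκ : 0 ≤ κ) (hδ : 0 < δ) (hδ1 : δ < 1) :
    0 < p.contr κ δ ∧ p.contr κ δ < 1 ∧ 1 / p.contr κ δ ≤ 16 * p.rate κ δ := by
  have hθ := p.stepSize_pos hκ hδ
  have hB := p.two_le_rate hκ hδ hδ1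
  have hc : 0 < p.contr κ δ := lt_min (by positivity) (by positivity)
  refine ⟨hc, (min_le_right _ _).trans_lt (by linarith), ?_⟩
  have h1 := p.inv_stepSize_le hκ hδ
  have h2 := p.one_div_le_rate hκ hδ
  rw [div_le_iff₀ hθ] at h1
  have h3 : 1 ≤ p.rate κ δ * δ := by
    rw [← div_le_iff₀ hδ]
    linarith [p.one_le_m]
  rw [div_le_iff₀ hc, contr]
  rcases min_cases (p.stepSize κ δ / 2) (δ / 4) with h | h <;> rw [h.1] <;> nlinarith

/-- The factor between the Lyapunov function and the stopping criterion. -/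
theorem sqrt_add_le (hκ : 0 ≤ κ) (hδ : 0 < δ) (hδ1 : δ < 1) :
    Real.sqrt (4 * n + δ * m * n) + 4 / p.stepSize κ δ ≤ 35 * ((m : ℝ) * n * p.rate κ δ) := by
  have hB := p.two_le_rate hκ hδ hδ1
  have hn := p.one_le_n
  have hm := p.one_le_m
  have hN : 1 ≤ (m : ℝ) * n := by nlinarith
  have hnN : (n : ℝ) ≤ (m : ℝ) * n := by nlinarith
  -- The constant is `35 = 3 + 32`: the root is at most `3mn` because `4n + δmn ≤ 5mn`, and `4/θ ≤
  -- 32 B`.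
  have h1 : Real.sqrt (4 * n + δ * m * n) ≤ 3 * ((m : ℝ) * n) := by
    rw [Real.sqrt_le_left (by positivity)]
    have : δ * m * n ≤ (m : ℝ) * n := by
      rw [mul_assoc]; exact mul_le_of_le_one_left (by positivity) hδ1.le
    nlinarith
  have h2 := p.inv_stepSize_le hκ hδ
  have h3 : 4 / p.stepSize κ δ ≤ 32 * p.rate κ δ := by
    rw [show 4 / p.stepSize κ δ = 4 * (1 / p.stepSize κ δ) by ring]; linarith
  have h4 : p.rate κ δ ≤ (m : ℝ) * n * p.rate κ δ := le_mul_of_one_le_left (by linarith) hN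
  have h5 : (m : ℝ) * n ≤ (m : ℝ) * n * p.rate κ δ := le_mul_of_one_le_right (by linarith) (by linarith)
  linarith

theorem lyapReal_nonneg (hκ : 0 ≤ κ) (hδ : 0 < δ) (y : Vec d) {s : SDCAState d t n m}
    (hs : p.Feasible s.α) : 0 ≤ p.lyapReal κ δ y s :=
  add_nonneg (p.gapReal_nonneg hκ y hs)
    (mul_nonneg (p.errWeight_nonneg hκ hδ) (Finset.sum_nonneg fun _ _ => sq_nonneg _))

variable {S Ω : Type*} [MeasurableSpace S] [MeasurableSpace Ω]
  {ν : Measure S} [IsProbabilityMeasure ν] {μ : Measure Ω} [IsProbabilityMeasure μ]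
  {Q : Vec d → S → Vec d}

/-- Nonnegativity in the one-step estimate gives `θ/2 (G(x) - G*) ≤ Ψ` at the current state, so both
parts of the criterion are multiples of `Ψ`. The conclusion is pathwise although it comes from an
expectation. -/
theorem lt_lyapReal_of_not_stopCrit (hκ : 0 ≤ κ) (hδ : 0 < δ) (hδ1 : δ < 1)
    (hQ : IsContractionCompressor ν Q δ) {D : Fin n → Ω → Fin m × S} (hD : IsNodeDraw ν μ D)
    (y : Vec d) {s : SDCAState d t n m} (hs : p.Consistent κ s) {ε : ℝ}
    (h : ¬ p.stopCrit κ δ y ε s) :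
    ε < 35 * ((m : ℝ) * n * p.rate κ δ) * p.lyapReal κ δ y s := by
  have hθ := p.stepSize_pos hκ hδ
  have h0 := (p.lintegral_lyapReal_step_le hκ hδ hδ1 hQ hD y hs).1
  have hΨ := p.lyapReal_nonneg hκ hδ y hs.feasible
  have hc := p.inv_contr_le hκ hδ hδ1
  rw [p.stopCrit_iff hκ y ε hs.feasible, not_le] at h
  have h2 := mul_le_mul_of_nonneg_right (p.sqrt_add_le hκ hδ hδ1) hΨ
  have h3 : 2 * (p.subObj κ y (p.primalPoint κ y s.u) - p.subOpt κ y)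
      ≤ 4 / p.stepSize κ δ * p.lyapReal κ δ y s := by
    have h4 : p.stepSize κ δ / 2 * (p.subObj κ y (p.primalPoint κ y s.u) - p.subOpt κ y)
        ≤ p.lyapReal κ δ y s := by nlinarith
    calc _ = 4 / p.stepSize κ δ *
          (p.stepSize κ δ / 2 * (p.subObj κ y (p.primalPoint κ y s.u) - p.subOpt κ y)) := by
          field_simp; ring
      _ ≤ _ := by gcongr
  linarith

theorem lintegral_lyapReal_inner_le (hκ : 0 ≤ κ) (hδ : 0 < δ) (hδ1 : δ < 1)
    (hQ : IsContractionCompressor ν Q δ) {D : ℕ → Fin n → Ω → Fin m × S} (hD : IsLoopDraw ν μ D)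
    (y : Vec d) {s : SDCAState d t n m} (hs : p.Consistent κ s) (K : ℕ) :
    ∫⁻ ω, ENNReal.ofReal (p.lyapReal κ δ y (p.inner Q κ δ y (fun L τ => D L τ ω) s K)) ∂μ
      ≤ ENNReal.ofReal ((1 - p.contr κ δ) ^ K * p.lyapReal κ δ y s) := by
  obtain ⟨hc0, hc1, -⟩ := p.inv_contr_le hκ hδ hδ1
  have hΨ := p.lyapReal_nonneg hκ hδ y hs.feasible
  induction K with
  | zero => simp [inner]
  | succ K ih =>
    set X : Ω → SDCAState d t n m := fun ω => p.inner Q κ δ y (fun L τ => D L τ ω) s K with hX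
    set Y : Ω → Fin n → Fin m × S := fun ω τ => D K τ ω with hY
    have hXm : Measurable X := p.measurable_inner hκ hQ.measurable measurable_const
      measurable_const K fun L _ τ => hD.measurable L τ
    have hYm : Measurable Y := measurable_pi_lambda _ fun τ => hD.measurable K τ
    have hind : IndepFun X Y μ := by
      refine indepFun_of_disjoint (A := {j | j.1 < K}) (B := {j | j.1 = K})
        (fun j : ℕ × Fin n => hD.measurable j.1 j.2) hD.indep ?_ ?_ ?_
      · rw [Set.disjoint_left]
        rintro j (h1 : j.1 < K) (h2 : j.1 = K)
        omega
      · refine @measurable_inner d t n m p κ δ S Ω _ (_) Q hκ hQ.measurable _ _ _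
          measurable_const measurable_const K fun L hL τ => ?_
        exact measurable_iSup_comap (Z := fun j : ℕ × Fin n => D j.1 j.2) (i := (L, τ)) hL
      · refine @measurable_pi_lambda _ _ _ (_) _ _ fun τ => ?_
        exact measurable_iSup_comap (Z := fun j : ℕ × Fin n => D j.1 j.2) (i := (K, τ))
          (A := {j | j.1 = K}) rfl
    have hf : Measurable fun z : SDCAState d t n m × (Fin n → Fin m × S) =>
        ENNReal.ofReal (p.lyapReal κ δ y (p.step Q κ δ y z.2 z.1)) :=
      (p.measurable_lyapReal hκ measurable_const (p.measurable_step hκ hQ.measurable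
        measurable_const (fun τ => (measurable_pi_apply τ).comp measurable_snd)
        measurable_fst)).ennreal_ofReal
    have hXc : ∀ ω, p.Consistent κ (X ω) := fun ω => hs.inner p hκ hδ y _ K
    calc _ = ∫⁻ ω, ENNReal.ofReal (p.lyapReal κ δ y (p.step Q κ δ y (Y ω) (X ω))) ∂μ := rfl
      _ = ∫⁻ ω, ∫⁻ ω', ENNReal.ofReal (p.lyapReal κ δ y (p.step Q κ δ y (Y ω') (X ω))) ∂μ ∂μ :=
        lintegral_indepFun hind hXm hYm hf
      _ ≤ ∫⁻ ω, ENNReal.ofReal (1 - p.contr κ δ) * ENNReal.ofReal (p.lyapReal κ δ y (X ω)) ∂μ := by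
        refine lintegral_mono fun ω => ?_
        refine (p.lintegral_lyapReal_step_le hκ hδ hδ1 hQ (hD.isNodeDraw K) y (hXc ω)).2.trans ?_
        rw [← ENNReal.ofReal_mul (by linarith)]
        refine ENNReal.ofReal_le_ofReal (sub_le_self _ ?_)
        exact mul_nonneg (by linarith [p.stepSize_pos hκ hδ]) (sub_nonneg.2 (p.subOpt_le hκ y _))
      _ ≤ ENNReal.ofReal (1 - p.contr κ δ) *
          ENNReal.ofReal ((1 - p.contr κ δ) ^ K * p.lyapReal κ δ y s) := by
        rw [lintegral_const_mul' _ _ ENNReal.ofReal_ne_top]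
        gcongr
      _ = _ := by
        rw [← ENNReal.ofReal_mul (by linarith), pow_succ]
        congr 1
        ring

/-- Waiting `K₀` iterations and then counting failures bounds the stopping time. If the criterion
never holds after `K₀`, the series diverges and the bound is trivial. -/
theorem stopTime_le_tsum {S : Type*} (Q : Vec d → S → Vec d) (y : Vec d) (ε : ℝ)
    (D : ℕ → Fin n → Fin m × S) (s : SDCAState d t n m) {K₀ : ℕ} (hK₀ : 1 ≤ K₀) {a : ℕ → ℝ≥0∞}
    (ha : ∀ L, ¬ p.stopCrit κ δ y ε (p.inner Q κ δ y D s (K₀ + L)) → 1 ≤ a L) :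
    ((p.stopTime Q κ δ y ε D s : ℕ∞) : ℝ≥0∞) ≤ K₀ + ∑' L, a L := by
  classical
  by_cases h : ∃ L, p.stopCrit κ δ y ε (p.inner Q κ δ y D s (K₀ + L))
  · have h1 : p.stopTime Q κ δ y ε D s ≤ ((K₀ + Nat.find h : ℕ) : ℕ∞) :=
      (p.stopTime_le_iff Q y ε D s _).2 ⟨_, le_rfl, by omega, Nat.find_spec h⟩
    calc ((p.stopTime Q κ δ y ε D s : ℕ∞) : ℝ≥0∞) ≤ (((K₀ + Nat.find h : ℕ) : ℕ∞) : ℝ≥0∞) :=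
          ENat.toENNReal_le.2 h1
      _ = K₀ + ∑ L ∈ Finset.range (Nat.find h), (1 : ℝ≥0∞) := by simp
      _ ≤ K₀ + ∑ L ∈ Finset.range (Nat.find h), a L := by
          gcongr with L hL
          exact ha L (Nat.find_min h (Finset.mem_range.1 hL))
      _ ≤ _ := by gcongr; exact ENNReal.sum_le_tsum _
  · have h2 : ∑' L, a L = ⊤ := by
      rw [eq_top_iff, ← ENNReal.tsum_const_eq_top_of_ne_zero (α := ℕ) one_ne_zero]
      exact ENNReal.tsum_le_tsum fun L => ha L fun hL => h ⟨L, hL⟩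
    rw [h2]
    simp

/-- The expected number of iterations of EC-SDCA from a fixed initial state. -/
theorem lintegral_stopTime_le (hκ : 0 ≤ κ) (hδ : 0 < δ) (hδ1 : δ < 1)
    (hQ : IsContractionCompressor ν Q δ) {D : ℕ → Fin n → Ω → Fin m × S} (hD : IsLoopDraw ν μ D)
    (y : Vec d) {s : SDCAState d t n m} (hs : p.Consistent κ s) {ε : ℝ} (hε : 0 < ε) :
    ∫⁻ ω, ((p.stopTime Q κ δ y ε (fun L τ => D L τ ω) s : ℕ∞) : ℝ≥0∞) ∂μ
      ≤ ENNReal.ofReal (16 * p.rate κ δ * (2 + Real.log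
          (1 + 35 * ((m : ℝ) * n * p.rate κ δ) * (p.lyapReal κ δ y s / ε)))) := by
  obtain ⟨hc0, hc1, hcB⟩ := p.inv_contr_le hκ hδ hδ1
  have hB := p.two_le_rate hκ hδ hδ1
  have hN := p.N_pos
  have hΨ := p.lyapReal_nonneg hκ hδ y hs.feasible
  set c := p.contr κ δ
  set M := 35 * ((m : ℝ) * n * p.rate κ δ) with hM
  have hM0 : 0 ≤ M := by positivity
  set r := M * (p.lyapReal κ δ y s / ε) with hr
  have hr0 : 0 ≤ r := by positivity
  have hlog : 0 ≤ Real.log (1 + r) := Real.log_nonneg (by linarith)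
  -- Chosen so that `(1 - c)^K₀ (1 + r) ≤ 1`; the extra `1` respects the requirement that at least
  -- one iteration is made.
  set K₀ := ⌈Real.log (1 + r) / c⌉₊ + 1 with hK₀
  have hK₀le : (K₀ : ℝ) ≤ Real.log (1 + r) / c + 2 := by
    have := (Nat.ceil_lt_add_one (by positivity : 0 ≤ Real.log (1 + r) / c)).le
    rw [hK₀]; push_cast; linarith
  have hK₀ge : Real.log (1 + r) ≤ c * K₀ := by
    have h := Nat.le_ceil (Real.log (1 + r) / c)
    have h' : Real.log (1 + r) / c ≤ K₀ := by rw [hK₀]; push_cast; linarith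
    rw [div_le_iff₀ hc0] at h'
    linarith
  have hpow : (1 - c) ^ K₀ * (1 + r) ≤ 1 := by
    have h1 : (1 - c) ^ K₀ ≤ Real.exp (-(c * K₀)) := by
      calc (1 - c) ^ K₀ ≤ Real.exp (-c) ^ K₀ := by
            exact pow_le_pow_left₀ (by linarith) (by linarith [Real.add_one_le_exp (-c)]) _
        _ = _ := by rw [← Real.exp_nat_mul]; congr 1; ring
    have h2 : 1 + r ≤ Real.exp (c * K₀) := by
      rw [← Real.exp_log (by linarith : 0 < 1 + r)]
      exact Real.exp_le_exp.2 hK₀ge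
    calc _ ≤ Real.exp (-(c * K₀)) * Real.exp (c * K₀) := by gcongr
      _ = 1 := by rw [← Real.exp_add]; simp
  set a : ℕ → Ω → ℝ≥0∞ := fun L ω => ENNReal.ofReal (M / ε) *
    ENNReal.ofReal (p.lyapReal κ δ y (p.inner Q κ δ y (fun L τ => D L τ ω) s (K₀ + L))) with ha
  have hpt : ∀ ω, ((p.stopTime Q κ δ y ε (fun L τ => D L τ ω) s : ℕ∞) : ℝ≥0∞)
      ≤ K₀ + ∑' L, a L ω := by
    intro ω
    refine p.stopTime_le_tsum Q y ε _ s (by omega) fun L hL => ?_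
    have h1 := p.lt_lyapReal_of_not_stopCrit hκ hδ hδ1 hQ (hD.isNodeDraw 0) y
      (hs.inner p hκ hδ y (fun L τ => D L τ ω) (K₀ + L)) hL
    simp only [ha]
    rw [← ENNReal.ofReal_mul (by positivity), ← ENNReal.ofReal_one]
    refine ENNReal.ofReal_le_ofReal ?_
    rw [div_mul_eq_mul_div, one_le_div hε]
    exact h1.le
  have ham : ∀ L, Measurable (a L) := fun L =>
    ((p.measurable_lyapReal hκ measurable_const (p.measurable_inner hκ hQ.measurable
      measurable_const measurable_const _ fun L _ τ => hD.measurable L τ)).ennreal_ofReal).const_mul _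
  -- Markov's inequality in disguise: the chance of failing at `K₀ + L` is at most `(1 - c)^L`, and
  -- the sum over `L` is `1/c`.
  have haL : ∀ L, ∫⁻ ω, a L ω ∂μ ≤ ENNReal.ofReal ((1 - c) ^ L) := by
    intro L
    simp only [ha]
    rw [lintegral_const_mul' _ _ ENNReal.ofReal_ne_top]
    refine (mul_le_mul_right (p.lintegral_lyapReal_inner_le hκ hδ hδ1 hQ hD y hs (K₀ + L)) _).trans ?_
    rw [← ENNReal.ofReal_mul (by positivity)]
    refine ENNReal.ofReal_le_ofReal ?_
    have h1 : 0 ≤ (1 - c) ^ L := pow_nonneg (by linarith) _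
    have h0 : 0 ≤ (1 - c) ^ K₀ := pow_nonneg (by linarith) _
    calc M / ε * ((1 - c) ^ (K₀ + L) * p.lyapReal κ δ y s)
        = ((1 - c) ^ K₀ * r) * (1 - c) ^ L := by rw [pow_add, hr]; ring
      _ ≤ 1 * (1 - c) ^ L := by
          gcongr
          linarith
      _ = _ := one_mul _
  calc _ ≤ ∫⁻ ω, ((K₀ : ℝ≥0∞) + ∑' L, a L ω) ∂μ := lintegral_mono hpt
    _ = K₀ + ∑' L, ∫⁻ ω, a L ω ∂μ := by
        rw [lintegral_add_left measurable_const, lintegral_const, measure_univ, mul_one,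
          lintegral_tsum fun L => (ham L).aemeasurable]
    _ ≤ K₀ + ∑' L : ℕ, ENNReal.ofReal ((1 - c) ^ L) := by
        gcongr with L
        exact haL L
    _ = ENNReal.ofReal K₀ + ENNReal.ofReal (1 / c) := by
        rw [← ENNReal.ofReal_tsum_of_nonneg (fun L => pow_nonneg (by linarith) _)
          (summable_geometric_of_lt_one (by linarith) (by linarith)),
          tsum_geometric_of_lt_one (by linarith) (by linarith), sub_sub_cancel, one_div,
          ENNReal.ofReal_natCast]
    _ ≤ _ := by
        rw [← ENNReal.ofReal_add (by positivity) (by positivity)]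
        refine ENNReal.ofReal_le_ofReal ?_
        have h1 : Real.log (1 + r) / c ≤ 16 * p.rate κ δ * Real.log (1 + r) := by
          rw [div_eq_mul_one_div, mul_comm]
          gcongr
        linarith

end

end SumProblem

/-! ### Accelerated inexact proximal point method -/

theorem catalystWeight_eq_sqrt {q : ℝ} (hq : 0 ≤ q) (k : ℕ) : catalystWeight q k = Real.sqrt q := by
  induction k with
  | zero => rfl
  | succ k ih =>
    rw [catalystWeight, ih, Real.sq_sqrt hq, sub_self, zero_pow two_ne_zero, zero_add, zero_add,
      Real.sqrt_mul (by norm_num), show (4 : ℝ) = 2 ^ 2 by norm_num, Real.sqrt_sq (by norm_num)]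
    ring

theorem catalystBeta_eq {q : ℝ} (hq : 0 < q) (k : ℕ) :
    catalystBeta q k = (1 - Real.sqrt q) / (1 + Real.sqrt q) := by
  have ha : 0 < Real.sqrt q := Real.sqrt_pos.2 hq
  rw [catalystBeta, catalystWeight_eq_sqrt hq.le, catalystWeight_eq_sqrt hq.le]
  field_simp
  ring

/-- Linear convergence of a sequence that contracts up to geometrically decreasing errors. -/
theorem geometric_of_perturbed_contraction {a ρ g : ℝ} (hρ : 0 < ρ) (hρa : ρ < a) (ha : a ≤ 1)
    (hg : 0 ≤ g) {s : ℕ → ℝ} (h0 : s 0 ≤ 2 * g) {k : ℕ}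
    (h : ∀ j < k, ∀ η > 0, (1 - η) * s (j + 1) ≤
      (1 - a) * s j + 2 / 9 * g * (1 - ρ) ^ (j + 1) * (1 + 1 / η)) :
    s k ≤ 8 / (a - ρ) ^ 2 * g * (1 - ρ) ^ k := by
  have hd : 0 < a - ρ := by linarith
  induction k with
  | zero =>
    have h1 : 2 ≤ 8 / (a - ρ) ^ 2 := by
      rw [le_div_iff₀ (by positivity)]; nlinarith
    rw [pow_zero, mul_one]
    nlinarith
  | succ k ih =>
    have ih' := ih fun j hj => h j (hj.trans k.lt_succ_self)
    -- Half of the spectral margin goes to the inexactness. With the prefactor `2/η²`, the remaining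
    -- margin `η` leaves slack `2/η`, more than the perturbation `(2/9)(1 + 1/η)`.
    set η := (a - ρ) / 2 with hη
    have hη0 : 0 < η := by positivity
    have hη1 : η ≤ 1 / 2 := by rw [hη]; linarith
    have h1 := h k k.lt_succ_self η hη0
    have h2 := mul_le_mul_of_nonneg_left ih' (by linarith : 0 ≤ 1 - a)
    have hp : 0 ≤ (1 - ρ) ^ k := pow_nonneg (by linarith) k
    have e : 8 / (a - ρ) ^ 2 = 2 / η ^ 2 := by rw [hη]; field_simp; norm_num
    rw [e] at h2 ⊢
    have h3 : (1 - a) * (2 / η ^ 2) + 2 / 9 * (1 - ρ) * (1 + 1 / η)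
        ≤ (1 - η) * (2 / η ^ 2 * (1 - ρ)) := by
      have k1 : η ≤ (1 - η) * (1 - ρ) - (1 - a) := by
        have : η * ρ ≥ 0 := by positivity
        have : a = ρ + 2 * η := by rw [hη]; ring
        nlinarith
      have k2 : η * (2 / η ^ 2) ≤ ((1 - η) * (1 - ρ) - (1 - a)) * (2 / η ^ 2) := by gcongr
      have k3 : η * (2 / η ^ 2) = 2 / η := by field_simp
      have k4 : 1 ≤ 1 / η := by rw [one_le_div hη0]; linarith
      have k5 : (1 - ρ) * (1 + 1 / η) ≤ 1 + 1 / η := mul_le_of_le_one_left (by positivity) (by linarith)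
      have k6 : 2 / η = 2 * (1 / η) := by ring
      nlinarith
    have h4 := mul_le_mul_of_nonneg_right h3 (mul_nonneg hg hp)
    have h5 : (1 - η) * s (k + 1) ≤ (1 - η) * (2 / η ^ 2 * g * (1 - ρ) ^ (k + 1)) := by
      rw [pow_succ (1 - ρ) k] at h1 ⊢
      linarith
    exact le_of_mul_le_mul_left h5 (by linarith)

namespace SumProblem

variable {d t n m : ℕ} (p : SumProblem d t n m) {κ δ : ℝ}

section

theorem q_pos (hκ : 0 ≤ κ) : 0 < p.q κ := div_pos p.lam_pos (p.lam_add_pos hκ)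

theorem sqrt_q_le_one (hκ : 0 ≤ κ) : Real.sqrt (p.q κ) ≤ 1 := by
  rw [Real.sqrt_le_one, q, div_le_one (p.lam_add_pos hκ)]
  linarith

/-- One step of the accelerated inexact proximal point method. -/
theorem catalyst_step (hκ : 0 ≤ κ) {a ε : ℝ} (ha0 : 0 < a) (ha1 : a ≤ 1)
    (haq : (p.lam + κ) * a ^ 2 = p.lam) {x y z x' xs : Vec d} (hxs : p.obj xs = p.optVal)
    (hy : (1 + a) • y = x + a • z) (hx' : p.subObj κ y x' - p.subOpt κ y ≤ ε) {η : ℝ} (hη : 0 < η) :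
    (1 - η) * (p.obj x' - p.optVal + p.lam / 2 * ‖xs - (x + (1 / a) • (x' - x))‖ ^ 2)
      ≤ (1 - a) * (p.obj x - p.optVal + p.lam / 2 * ‖xs - z‖ ^ 2) + ε * (1 + 1 / η) := by
  have hL := p.lam_add_pos hκ
  set Λ := p.lam + κ with hΛ
  set z' := x + (1 / a) • (x' - x) with hz'
  set xh := p.subMin κ hκ y
  -- The usual comparison point of acceleration: `w - x'` is `a` times `xs - z'`, and `(λ+κ) a² = λ`
  -- converts the subproblem's curvature into that of `P`.
  set w := a • xs + (1 - a) • x with hw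
  have h1 : p.subOpt κ y + Λ / 2 * ‖w - xh‖ ^ 2 ≤ p.subObj κ y w := p.subOpt_add_le hκ y w
  have h2 : p.subOpt κ y + Λ / 2 * ‖x' - xh‖ ^ 2 ≤ p.subObj κ y x' := p.subOpt_add_le hκ y x'
  have h3 : ‖w - x'‖ ^ 2 - 2 * (‖w - x'‖ * ‖x' - xh‖) ≤ ‖w - xh‖ ^ 2 := by
    have e : w - xh = (w - x') + (x' - xh) := by abel
    rw [e, norm_add_sq_real]
    have := abs_real_inner_le_norm (w - x') (x' - xh)
    have := neg_abs_le (Inner.inner ℝ (w - x') (x' - xh))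
    nlinarith [sq_nonneg ‖x' - xh‖]
  have h4 : p.obj w ≤ a * p.optVal + (1 - a) * p.obj x
      - a * (1 - a) * (p.lam / 2 * ‖xs - x‖ ^ 2) := by
    have := p.strongConvexOn_obj.2 (Set.mem_univ xs) (Set.mem_univ x) ha0.le
      (sub_nonneg.2 ha1) (by ring)
    simpa only [smul_eq_mul, hxs] using this
  have h5 : ‖w - x'‖ = a * ‖xs - z'‖ := by
    have e : w - x' = a • (xs - z') := by
      rw [hz', smul_sub, smul_add, smul_smul, mul_one_div_cancel ha0.ne', hw]
      module
    rw [e, norm_smul, Real.norm_of_nonneg ha0.le]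
  -- The vector `w - y` is `a` times a convex combination of `xs - x` and `xs - z`, and `κ = (λ+κ)(1
  -- - a²)`. The `xs - x` part cancels exactly against the strong convexity gain in `h4`.
  have h6 : κ / 2 * ‖w - y‖ ^ 2
      ≤ (1 - a) * (p.lam / 2 * ‖xs - z‖ ^ 2) + a * (1 - a) * (p.lam / 2 * ‖xs - x‖ ^ 2) := by
    have e : w - y = a • ((a / (1 + a)) • (xs - x) + (1 / (1 + a)) • (xs - z)) := by
      have h1a : (1 + a) ≠ 0 := by positivity
      have ey : y = (1 / (1 + a)) • (x + a • z) := by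
        rw [← hy, smul_smul, one_div_mul_cancel h1a, one_smul]
      have c1 : a = (1 + a) * (a * (1 / (1 + a))) := by field_simp
      have ew : w = (1 / (1 + a)) • ((1 + a) • w) := by
        rw [smul_smul, one_div_mul_cancel h1a, one_smul]
      rw [ew, ey, ← smul_sub, show a / (1 + a) = 1 / (1 + a) * a by ring, mul_smul, ← smul_add,
        smul_comm a]
      congr 1
      rw [hw]
      module
    have h7 := norm_combo_sq (xs - x) (xs - z) (a := a / (1 + a)) (b := 1 / (1 + a)) (by field_simp; ring)
    have h8 : 0 ≤ a / (1 + a) * (1 / (1 + a)) * ‖xs - x - (xs - z)‖ ^ 2 := by positivity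
    have h9 : ‖w - y‖ ^ 2 ≤ a ^ 2 * (a / (1 + a) * ‖xs - x‖ ^ 2 + 1 / (1 + a) * ‖xs - z‖ ^ 2) := by
      rw [e, norm_smul, mul_pow, Real.norm_eq_abs, sq_abs, h7]
      gcongr
      linarith
    have hκe : κ = Λ * ((1 - a) * (1 + a)) := by
      have : Λ = p.lam + κ := hΛ
      nlinarith
    calc κ / 2 * ‖w - y‖ ^ 2
        ≤ κ / 2 * (a ^ 2 * (a / (1 + a) * ‖xs - x‖ ^ 2 + 1 / (1 + a) * ‖xs - z‖ ^ 2)) := by gcongr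
      _ = Λ * a ^ 2 * ((1 - a) / 2) * (a * ‖xs - x‖ ^ 2 + ‖xs - z‖ ^ 2) := by
          rw [hκe]; field_simp
      _ = _ := by rw [haq]; ring
  -- Young's inequality with weight `η`: inexactness costs an `η` share of the new potential and
  -- `ε/η`.
  have h10 : Λ * (a * ‖xs - z'‖ * ‖x' - xh‖)
      ≤ η * (p.lam / 2 * ‖xs - z'‖ ^ 2) + 1 / η * (Λ / 2 * ‖x' - xh‖ ^ 2) := by
    have e : η * (p.lam / 2 * ‖xs - z'‖ ^ 2) + 1 / η * (Λ / 2 * ‖x' - xh‖ ^ 2)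
        - Λ * (a * ‖xs - z'‖ * ‖x' - xh‖)
        = Λ / (2 * η) * (η * a * ‖xs - z'‖ - ‖x' - xh‖) ^ 2 := by
      rw [← haq]; field_simp; ring
    have : 0 ≤ Λ / (2 * η) * (η * a * ‖xs - z'‖ - ‖x' - xh‖) ^ 2 := by positivity
    linarith
  have h11 : 1 / η * (Λ / 2 * ‖x' - xh‖ ^ 2) ≤ 1 / η * ε := by
    gcongr
    linarith
  have h12 : 0 ≤ η * (p.obj x' - p.optVal) := mul_nonneg hη.le (sub_nonneg.2 (p.optVal_le x'))
  have h13 : 0 ≤ κ / 2 * ‖x' - y‖ ^ 2 := by positivity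
  rw [h5] at h3
  have h14 := mul_le_mul_of_nonneg_left h3 (by positivity : 0 ≤ Λ / 2)
  have e14 : Λ / 2 * ((a * ‖xs - z'‖) ^ 2 - 2 * (a * ‖xs - z'‖ * ‖x' - xh‖))
      = p.lam / 2 * ‖xs - z'‖ ^ 2 - Λ * (a * ‖xs - z'‖ * ‖x' - xh‖) := by
    rw [← haq]; ring
  rw [e14] at h14
  simp only [subObj] at h1 hx'
  rw [mul_add ε, mul_one, mul_comm ε (1 / η)]
  linarith

theorem stopCrit_toNat {S : Type*} (Q : Vec d → S → Vec d) (y : Vec d) (ε : ℝ)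
    (D : ℕ → Fin n → Fin m × S) (s : SDCAState d t n m)
    (h : p.stopTime Q κ δ y ε D s ≠ ⊤) :
    p.stopCrit κ δ y ε (p.inner Q κ δ y D s (p.stopTime Q κ δ y ε D s).toNat) := by
  obtain ⟨N, hN⟩ := ENat.ne_top_iff_exists.1 h
  obtain ⟨K, hKN, hK1, hK⟩ := (p.stopTime_le_iff Q y ε D s N).1 hN.ge
  have h2 := (p.stopTime_le_iff Q y ε D s K).2 ⟨K, le_rfl, hK1, hK⟩
  rw [← hN] at h2 ⊢
  have h3 : N ≤ K := by exact_mod_cast h2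
  obtain rfl : K = N := le_antisymm hKN h3
  exact hK

theorem tol_pos {ρ₀ : ℝ} (hρ : ρ₀ < 1) {x₀ : Vec d} (hx₀ : p.optVal < p.obj x₀) (k : ℕ) :
    0 < p.tol ρ₀ x₀ k :=
  mul_pos (mul_pos (by norm_num) (sub_pos.2 hx₀)) (pow_pos (sub_pos.2 hρ) k)

/-- The auxiliary sequence of the accelerated method. -/
def outerAux {S : Type*} (Q : Vec d → S → Vec d) (κ δ ρ₀ : ℝ) (x₀ : Vec d)
    (D : ℕ → ℕ → Fin n → Fin m × S) : ℕ → Vec d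
  | 0 => x₀
  | k + 1 => (p.outer Q κ δ ρ₀ x₀ D k).x + (1 / Real.sqrt (p.q κ)) •
      ((p.outer Q κ δ ρ₀ x₀ D (k + 1)).x - (p.outer Q κ δ ρ₀ x₀ D k).x)

variable {S : Type*} {Q : Vec d → S → Vec d} {ρ₀ : ℝ} {x₀ : Vec d}
  {D : ℕ → ℕ → Fin n → Fin m × S}

/-- With the constant `β = (1 - √q)/(1 + √q)`, the extrapolated point is a convex combination of `x`
and the auxiliary point, the form that `catalyst_step` needs. -/
theorem outer_y_eq (hκ : 0 ≤ κ) (k : ℕ) :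
    (1 + Real.sqrt (p.q κ)) • (p.outer Q κ δ ρ₀ x₀ D k).y
      = (p.outer Q κ δ ρ₀ x₀ D k).x + Real.sqrt (p.q κ) • p.outerAux Q κ δ ρ₀ x₀ D k := by
  have ha : 0 < Real.sqrt (p.q κ) := Real.sqrt_pos.2 (p.q_pos hκ)
  cases k with
  | zero => simp only [outer, outerAux, add_smul, one_smul]
  | succ k =>
    have e : (p.outer Q κ δ ρ₀ x₀ D (k + 1)).y = (p.outer Q κ δ ρ₀ x₀ D (k + 1)).x
      + catalystBeta (p.q κ) (k + 1) •
        ((p.outer Q κ δ ρ₀ x₀ D (k + 1)).x - (p.outer Q κ δ ρ₀ x₀ D k).x) := rfl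
    rw [e, catalystBeta_eq (p.q_pos hκ), outerAux]
    set a := Real.sqrt (p.q κ)
    generalize (p.outer Q κ δ ρ₀ x₀ D (k + 1)).x = u
    generalize (p.outer Q κ δ ρ₀ x₀ D k).x = v
    rw [smul_add, smul_smul, smul_add, smul_smul, mul_one_div_cancel ha.ne',
      mul_div_cancel₀ _ (by positivity : 1 + a ≠ 0)]
    module

/-- The stopping criterion holds where the `k`-th inner loop stopped. -/
theorem stopCrit_outer (k : ℕ) (h : p.innerCount Q κ δ ρ₀ x₀ D (k + 1) ≠ ⊤) :
    p.stopCrit κ δ (p.outer Q κ δ ρ₀ x₀ D k).y (p.tol ρ₀ x₀ (k + 1))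
      (p.outer Q κ δ ρ₀ x₀ D (k + 1)).s :=
  p.stopCrit_toNat Q _ _ _ _ h

/-- Both summands of the stopping criterion are nonnegative and have coefficients at least `1`, so
each is below the tolerance: `Ψ` serves the next warm start, the primal part serves the outer
method. -/
theorem outer_stop_bounds (hκ : 0 ≤ κ) (hδ : 0 < δ) (k : ℕ)
    (h : p.innerCount Q κ δ ρ₀ x₀ D (k + 1) ≠ ⊤) :
    p.lyapReal κ δ (p.outer Q κ δ ρ₀ x₀ D k).y (p.outer Q κ δ ρ₀ x₀ D (k + 1)).s
        ≤ p.tol ρ₀ x₀ (k + 1) ∧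
    p.subObj κ (p.outer Q κ δ ρ₀ x₀ D k).y (p.outer Q κ δ ρ₀ x₀ D (k + 1)).x
        - p.subOpt κ (p.outer Q κ δ ρ₀ x₀ D k).y ≤ p.tol ρ₀ x₀ (k + 1) := by
  have hc := (p.consistent_outer hκ hδ ρ₀ x₀ D (k + 1) (Q := Q)).feasible
  have h1 := p.stopCrit_outer k h
  rw [p.stopCrit_iff hκ _ _ hc] at h1
  have ex : p.primalPoint κ (p.outer Q κ δ ρ₀ x₀ D k).y (p.outer Q κ δ ρ₀ x₀ D (k + 1)).s.u
      = (p.outer Q κ δ ρ₀ x₀ D (k + 1)).x := rfl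
  rw [ex] at h1
  have hΨ := p.lyapReal_nonneg (δ := δ) hκ hδ (p.outer Q κ δ ρ₀ x₀ D k).y hc
  have hs := p.subOpt_le hκ (p.outer Q κ δ ρ₀ x₀ D k).y (p.outer Q κ δ ρ₀ x₀ D (k + 1)).x
  have hsq : 1 ≤ Real.sqrt (4 * n + δ * m * n) := by
    rw [Real.one_le_sqrt]
    have := p.one_le_n
    have : 0 ≤ δ * m * n := by positivity
    linarith
  constructor <;> nlinarith

/-- Linear convergence of the outer loop, as long as the inner loops terminate. -/
theorem outer_converges (hκ : 0 ≤ κ) (hδ : 0 < δ) (hρ : 0 < ρ₀) (hρq : ρ₀ < Real.sqrt (p.q κ))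
    (k : ℕ) (h : ∀ j < k, p.innerCount Q κ δ ρ₀ x₀ D (j + 1) ≠ ⊤)
    {xs : Vec d} (hxs : p.obj xs = p.optVal)
    (hgrow : ∀ x, p.optVal + p.lam / 2 * ‖x - xs‖ ^ 2 ≤ p.obj x) :
    p.obj (p.outer Q κ δ ρ₀ x₀ D k).x - p.optVal
        + p.lam / 2 * ‖xs - p.outerAux Q κ δ ρ₀ x₀ D k‖ ^ 2
      ≤ 8 / (Real.sqrt (p.q κ) - ρ₀) ^ 2 * (p.obj x₀ - p.optVal) * (1 - ρ₀) ^ k := by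
  have ha : 0 < Real.sqrt (p.q κ) := Real.sqrt_pos.2 (p.q_pos hκ)
  have haq : (p.lam + κ) * Real.sqrt (p.q κ) ^ 2 = p.lam := by
    rw [Real.sq_sqrt (p.q_pos hκ).le, q, mul_div_cancel₀ _ (p.lam_add_pos hκ).ne']
  refine geometric_of_perturbed_contraction (s := fun k =>
    p.obj (p.outer Q κ δ ρ₀ x₀ D k).x - p.optVal
        + p.lam / 2 * ‖xs - p.outerAux Q κ δ ρ₀ x₀ D k‖ ^ 2) hρ hρq (p.sqrt_q_le_one hκ)
    (sub_nonneg.2 (p.optVal_le x₀)) ?_ ?_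
  · have := hgrow x₀
    simp only [outer, outerAux]
    rw [norm_sub_rev]
    linarith
  · intro j hj η hη
    exact p.catalyst_step hκ ha (p.sqrt_q_le_one hκ) haq hxs (p.outer_y_eq hκ j)
      (p.outer_stop_bounds hκ hδ j (h j hj)).2 hη

end

end SumProblem

/-! ### Warm starts and logarithmic factors -/

namespace SumProblem

variable {d t n m : ℕ} (p : SumProblem d t n m) {κ δ : ℝ}

section

/-- The argument of the logarithm in `logFactor`. -/
def logArg (κ δ ρ₀ : ℝ) : ℝ :=
  (m : ℝ) * n * p.rate κ δ * ((p.lam + κ) / p.lam) / (Real.sqrt (p.q κ) - ρ₀)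

variable {ρ₀ : ℝ} {x₀ : Vec d}

theorem logArg_bounds (hκ : 0 ≤ κ) (hδ : 0 < δ) (hδ1 : δ < 1) (hρ : 0 < ρ₀)
    (hρq : ρ₀ < Real.sqrt (p.q κ)) :
    1 ≤ p.logArg κ δ ρ₀ ∧ (m : ℝ) * n * p.rate κ δ ≤ p.logArg κ δ ρ₀ ∧
      1 / (Real.sqrt (p.q κ) - ρ₀) ≤ p.logArg κ δ ρ₀ ∧
      (p.lam + κ) / p.lam / (Real.sqrt (p.q κ) - ρ₀) ≤ p.logArg κ δ ρ₀ := by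
  have hB := p.two_le_rate hκ hδ hδ1
  have hn := p.one_le_n
  have hm := p.one_le_m
  have hNB : 1 ≤ (m : ℝ) * n * p.rate κ δ :=
    one_le_mul_of_one_le_of_one_le (one_le_mul_of_one_le_of_one_le hm hn) (by linarith)
  have hr : 1 ≤ (p.lam + κ) / p.lam := by
    rw [one_le_div p.lam_pos]; linarith
  have ha1 := p.sqrt_q_le_one hκ
  have hD0 : 0 < Real.sqrt (p.q κ) - ρ₀ := by linarith
  have hD : 1 ≤ 1 / (Real.sqrt (p.q κ) - ρ₀) := by
    rw [one_le_div hD0]; linarith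
  have e : p.logArg κ δ ρ₀ = (m : ℝ) * n * p.rate κ δ * ((p.lam + κ) / p.lam)
      * (1 / (Real.sqrt (p.q κ) - ρ₀)) := by rw [logArg]; ring
  have h1 : 1 ≤ (m : ℝ) * n * p.rate κ δ * ((p.lam + κ) / p.lam) :=
    one_le_mul_of_one_le_of_one_le hNB hr
  rw [e]
  refine ⟨one_le_mul_of_one_le_of_one_le h1 hD, ?_, ?_, ?_⟩
  · rw [mul_assoc _ ((p.lam + κ) / p.lam)]
    exact le_mul_of_one_le_right (zero_le_one.trans hNB) (one_le_mul_of_one_le_of_one_le hr hD)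
  · exact le_mul_of_one_le_left (zero_le_one.trans hD) h1
  · rw [div_eq_mul_one_div]
    refine mul_le_mul_of_nonneg_right ?_ (by linarith)
    exact le_mul_of_one_le_left (zero_le_one.trans hr) hNB

variable {S : Type*} {Q : Vec d → S → Vec d} {D : ℕ → ℕ → Fin n → Fin m × S}

/-- The prox-center averages `x` and the auxiliary point, and the Catalyst potential bounds the
distance of both to the minimizer, the first by quadratic growth. -/
theorem norm_outer_y_sub_sq_le (hκ : 0 ≤ κ) (hδ : 0 < δ) (hρ : 0 < ρ₀)
    (hρq : ρ₀ < Real.sqrt (p.q κ)) (k : ℕ) (h : ∀ j < k, p.innerCount Q κ δ ρ₀ x₀ D (j + 1) ≠ ⊤)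
    {xs : Vec d} (hxs : p.obj xs = p.optVal)
    (hgrow : ∀ x, p.optVal + p.lam / 2 * ‖x - xs‖ ^ 2 ≤ p.obj x) :
    p.lam * ‖(p.outer Q κ δ ρ₀ x₀ D k).y - xs‖ ^ 2
      ≤ 16 / (Real.sqrt (p.q κ) - ρ₀) ^ 2 * (p.obj x₀ - p.optVal) * (1 - ρ₀) ^ k := by
  have ha : 0 < Real.sqrt (p.q κ) := Real.sqrt_pos.2 (p.q_pos hκ)
  have hy := p.outer_y_eq (δ := δ) (Q := Q) (ρ₀ := ρ₀) (x₀ := x₀) (D := D) hκ k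
  have hconv := p.outer_converges hκ hδ hρ hρq k h hxs hgrow
  set a := Real.sqrt (p.q κ)
  set y := (p.outer Q κ δ ρ₀ x₀ D k).y
  set x := (p.outer Q κ δ ρ₀ x₀ D k).x
  set z := p.outerAux Q κ δ ρ₀ x₀ D k
  have h1a : 1 + a ≠ 0 := by positivity
  have ey : y - xs = (1 / (1 + a)) • x + (a / (1 + a)) • z - xs := by
    rw [show a / (1 + a) = 1 / (1 + a) * a by ring, mul_smul, ← smul_add, ← hy, smul_smul,
      one_div_mul_cancel h1a, one_smul]
  have h1 : ‖y - xs‖ ^ 2 ≤ ‖x - xs‖ ^ 2 + ‖xs - z‖ ^ 2 := by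
    rw [ey, norm_sub_sq_combo _ _ _ (by field_simp), norm_sub_rev xs z]
    have k1 : 1 / (1 + a) ≤ 1 := by rw [div_le_one (by positivity)]; linarith
    have k2 : a / (1 + a) ≤ 1 := by rw [div_le_one (by positivity)]; linarith
    have k3 : 0 ≤ 1 / (1 + a) * (a / (1 + a)) * ‖x - z‖ ^ 2 := by positivity
    have k4 := mul_le_of_le_one_left (sq_nonneg ‖x - xs‖) k1
    have k5 := mul_le_of_le_one_left (sq_nonneg ‖z - xs‖) k2
    linarith
  have h2 := hgrow x
  have h3 := mul_le_mul_of_nonneg_left h1 p.lam_pos.le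
  have e : 16 / (a - ρ₀) ^ 2 * (p.obj x₀ - p.optVal) * (1 - ρ₀) ^ k
      = 2 * (8 / (a - ρ₀) ^ 2 * (p.obj x₀ - p.optVal) * (1 - ρ₀) ^ k) := by ring
  rw [e]
  linarith

/-- The Lyapunov function at the start of a warm-started inner loop. -/
theorem lyapReal_warm_start (hκ : 0 ≤ κ) (hδ : 0 < δ) (hρ : 0 < ρ₀)
    (hρq : ρ₀ < Real.sqrt (p.q κ)) (hx₀ : p.optVal < p.obj x₀) (k : ℕ)
    (h : ∀ j < k + 1, p.innerCount Q κ δ ρ₀ x₀ D (j + 1) ≠ ⊤) :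
    p.lyapReal κ δ (p.outer Q κ δ ρ₀ x₀ D (k + 1)).y (p.outer Q κ δ ρ₀ x₀ D (k + 1)).s
        / p.tol ρ₀ x₀ (k + 2)
      ≤ 434 * ((p.lam + κ) / p.lam / (Real.sqrt (p.q κ) - ρ₀) ^ 4) := by
  obtain ⟨xs, hxs, hgrow⟩ := p.exists_isMin_obj
  have ha1 := p.sqrt_q_le_one hκ
  have hl := p.lam_pos
  have hg : 0 < p.obj x₀ - p.optVal := sub_pos.2 hx₀
  have hc := (p.consistent_outer hκ hδ ρ₀ x₀ D (k + 1) (Q := Q)).feasible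
  have h1 := p.norm_outer_y_sub_sq_le hκ hδ hρ hρq (k + 1) h hxs hgrow
  have h2 := p.norm_outer_y_sub_sq_le hκ hδ hρ hρq k (fun j hj => h j (hj.trans k.lt_succ_self))
    hxs hgrow
  have h3 := (p.outer_stop_bounds hκ hδ k (h k k.lt_succ_self)).1
  have h4 := p.gapReal_warm_start hκ (p.outer Q κ δ ρ₀ x₀ D k).y
    (p.outer Q κ δ ρ₀ x₀ D (k + 1)).y hc
  have hE : 0 ≤ p.errWeight κ δ * ∑ τ, ‖(p.outer Q κ δ ρ₀ x₀ D (k + 1)).s.e τ‖ ^ 2 :=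
    mul_nonneg (p.errWeight_nonneg hκ hδ) (Finset.sum_nonneg fun _ _ => sq_nonneg _)
  unfold lyapReal at h3 ⊢
  set y' := (p.outer Q κ δ ρ₀ x₀ D (k + 1)).y
  set y := (p.outer Q κ δ ρ₀ x₀ D k).y
  set s := (p.outer Q κ δ ρ₀ x₀ D (k + 1)).s
  set a := Real.sqrt (p.q κ)
  set g := p.obj x₀ - p.optVal
  have hD0 : 0 < a - ρ₀ := by linarith
  have hD1 : a - ρ₀ ≤ 1 - ρ₀ := by linarith
  have hD2 : a - ρ₀ ≤ 1 := by linarith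
  set e := a - ρ₀ with he
  have hr0 : 0 < 1 - ρ₀ := by linarith
  have hpk : 0 < (1 - ρ₀) ^ k := pow_pos hr0 k
  have h5 : p.lam * ‖y' - y‖ ^ 2 ≤ 64 / e ^ 2 * g * (1 - ρ₀) ^ k := by
    have k1 : ‖y' - y‖ ^ 2 ≤ 2 * (‖y' - xs‖ ^ 2 + ‖y - xs‖ ^ 2) := by
      have k2 : ‖y' - y‖ ≤ ‖y' - xs‖ + ‖y - xs‖ := by
        rw [norm_sub_rev y xs]; exact norm_sub_le_norm_sub_add_norm_sub _ _ _
      nlinarith [sq_nonneg (‖y' - xs‖ - ‖y - xs‖), norm_nonneg (y' - y)]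
    have k3 : 16 / e ^ 2 * g * (1 - ρ₀) ^ (k + 1) ≤ 16 / e ^ 2 * g * (1 - ρ₀) ^ k := by
      gcongr ?_ * ?_
      exact pow_le_pow_of_le_one hr0.le (by linarith) k.le_succ
    have k4 := mul_le_mul_of_nonneg_left k1 hl.le
    have k5 : 64 / e ^ 2 * g * (1 - ρ₀) ^ k = 4 * (16 / e ^ 2 * g * (1 - ρ₀) ^ k) := by ring
    rw [k5]
    linarith
  have h6 : κ * ‖y' - y‖ ^ 2 ≤ (p.lam + κ) / p.lam * (64 / e ^ 2 * g * (1 - ρ₀) ^ k) := by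
    calc κ * ‖y' - y‖ ^ 2 ≤ (p.lam + κ) * ‖y' - y‖ ^ 2 := by gcongr; linarith
      _ = (p.lam + κ) / p.lam * (p.lam * ‖y' - y‖ ^ 2) := by field_simp
      _ ≤ _ := by gcongr
  set r := (p.lam + κ) / p.lam with hr
  have hr1 : 1 ≤ r := by rw [hr, one_le_div hl]; linarith
  rw [div_le_iff₀ (p.tol_pos (by linarith) hx₀ _)]
  have e1 : p.tol ρ₀ x₀ (k + 1) = 2 / 9 * g * (1 - ρ₀) ^ k * (1 - ρ₀) := by
    rw [tol, pow_succ]; ring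
  have e2 : p.tol ρ₀ x₀ (k + 2) = 2 / 9 * g * (1 - ρ₀) ^ k * (1 - ρ₀) ^ 2 := by
    rw [tol, pow_add]; ring
  rw [e1] at h3
  rw [e2]
  set G := g * (1 - ρ₀) ^ k with hG
  have hG0 : 0 < G := by positivity
  have h7 : p.gapReal κ y' s.α + p.errWeight κ δ * ∑ τ, ‖s.e τ‖ ^ 2
      ≤ G * (4 / 9 * (1 - ρ₀) + 96 * (r / e ^ 2)) := by
    have k1 : r * (64 / e ^ 2 * g * (1 - ρ₀) ^ k) = 64 * (G * (r / e ^ 2)) := by rw [hG]; ring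
    have k2 : 2 / 9 * g * (1 - ρ₀) ^ k * (1 - ρ₀) = 2 / 9 * (G * (1 - ρ₀)) := by rw [hG]; ring
    rw [k1] at h6
    rw [k2] at h3
    linarith
  refine h7.trans ?_
  have h8 : e ^ 2 ≤ (1 - ρ₀) ^ 2 := by gcongr
  -- The constant is `96 = (3/2) · 64` and `432 = 96 · 9/2`; together with the `2` of `h10` this
  -- gives `434`. Division by the tolerance costs `(1 - ρ₀)⁻²`, which `√q - ρ₀ ≤ 1 - ρ₀` absorbs.
  have h9 : 96 * (r / e ^ 2) ≤ 432 * (2 / 9) * (r / e ^ 4 * (1 - ρ₀) ^ 2) := by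
    have : r / e ^ 2 = r / e ^ 4 * e ^ 2 := by field_simp
    rw [this]
    have : r / e ^ 4 * e ^ 2 ≤ r / e ^ 4 * (1 - ρ₀) ^ 2 := by gcongr
    linarith
  have h10 : 4 / 9 * (1 - ρ₀) ≤ 2 * (2 / 9) * (r / e ^ 4 * (1 - ρ₀) ^ 2) := by
    have k1 : 1 ≤ r / e ^ 4 * (1 - ρ₀) := by
      calc (1 : ℝ) ≤ r / e ^ 4 * e := by
            rw [show r / e ^ 4 * e = r / e ^ 3 by field_simp, one_le_div (by positivity)]
            exact (pow_le_one₀ hD0.le hD2).trans hr1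
        _ ≤ _ := by gcongr
    have k2 := mul_le_mul_of_nonneg_right k1 hr0.le
    have k3 : r / e ^ 4 * (1 - ρ₀) * (1 - ρ₀) = r / e ^ 4 * (1 - ρ₀) ^ 2 := by ring
    linarith
  have h11 := mul_le_mul_of_nonneg_left (add_le_add h10 h9) hG0.le
  refine h11.trans (le_of_eq ?_)
  rw [hG]; ring

theorem log_two_pow_le (k : ℕ) : Real.log (2 ^ k) ≤ k := by
  rw [Real.log_pow]
  have := Real.log_two_lt_d9
  have hk : (0 : ℝ) ≤ k := Nat.cast_nonneg k
  nlinarith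

theorem logFactor_eq : p.logFactor κ δ ρ₀ = 1 + Real.log (p.logArg κ δ ρ₀) := rfl

theorem initLog_nonneg (hκ : 0 ≤ κ) (hρ : ρ₀ < 1) (hx₀ : p.optVal < p.obj x₀) :
    0 ≤ p.initLog κ ρ₀ x₀ := by
  have h1 := p.gapReal_nonneg hκ x₀ p.feasible_zero
  have h2 := p.tol_pos hρ hx₀ 1
  rw [initLog, p.dualGap_eq hκ x₀ p.feasible_zero, EReal.toReal_coe]
  exact Real.log_nonneg (by have := div_nonneg h1 h2.le; linarith)

theorem log_initial_le (hκ : 0 ≤ κ) (hδ : 0 < δ) (hδ1 : δ < 1) (hρ : 0 < ρ₀)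
    (hρq : ρ₀ < Real.sqrt (p.q κ)) (hx₀ : p.optVal < p.obj x₀) :
    Real.log (1 + 35 * ((m : ℝ) * n * p.rate κ δ) *
      (p.lyapReal κ δ x₀ (SDCAState.zero d t n m) / p.tol ρ₀ x₀ 1))
      ≤ 6 + Real.log (p.logArg κ δ ρ₀) + p.initLog κ ρ₀ x₀ := by
  obtain ⟨hX1, hX2, -, -⟩ := p.logArg_bounds hκ hδ hδ1 hρ hρq
  have h1 := p.gapReal_nonneg hκ x₀ p.feasible_zero
  have hB := p.two_le_rate hκ hδ hδ1
  have hN := p.N_pos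
  have h2 := p.tol_pos (by linarith [p.sqrt_q_le_one hκ] : ρ₀ < 1) hx₀ 1
  have e : p.lyapReal κ δ x₀ (SDCAState.zero d t n m) = p.gapReal κ x₀ 0 := by
    simp [lyapReal, SDCAState.zero]
  rw [initLog, p.dualGap_eq hκ x₀ p.feasible_zero, EReal.toReal_coe, e]
  set r := p.gapReal κ x₀ 0 / p.tol ρ₀ x₀ 1
  have hr : 0 ≤ r := div_nonneg h1 h2.le
  set X := p.logArg κ δ ρ₀
  calc _ ≤ Real.log (2 ^ 6 * X * (1 + r)) := by
        refine Real.log_le_log (by positivity) ?_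
        have : 35 * ((m : ℝ) * n * p.rate κ δ) * r ≤ 35 * X * r := by gcongr
        nlinarith
    _ = Real.log (2 ^ 6) + Real.log X + Real.log (1 + r) := by
        rw [Real.log_mul (by positivity) (by positivity), Real.log_mul (by positivity) (by positivity)]
    _ ≤ _ := by
        have := log_two_pow_le 6
        push_cast at this
        linarith

theorem log_warm_le (hκ : 0 ≤ κ) (hδ : 0 < δ) (hδ1 : δ < 1) (hρ : 0 < ρ₀)
    (hρq : ρ₀ < Real.sqrt (p.q κ)) (hx₀ : p.optVal < p.obj x₀) (k : ℕ)
    (h : ∀ j < k + 1, p.innerCount Q κ δ ρ₀ x₀ D (j + 1) ≠ ⊤) :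
    Real.log (1 + 35 * ((m : ℝ) * n * p.rate κ δ) *
      (p.lyapReal κ δ (p.outer Q κ δ ρ₀ x₀ D (k + 1)).y (p.outer Q κ δ ρ₀ x₀ D (k + 1)).s
        / p.tol ρ₀ x₀ (k + 2)))
      ≤ 14 + 5 * Real.log (p.logArg κ δ ρ₀) := by
  obtain ⟨hX1, hX2, hX3, hX4⟩ := p.logArg_bounds hκ hδ hδ1 hρ hρq
  have hB := p.two_le_rate hκ hδ hδ1
  have hN := p.N_pos
  have hw := p.lyapReal_warm_start hκ hδ hρ hρq hx₀ k h
  have h2 := p.tol_pos (by linarith [p.sqrt_q_le_one hκ] : ρ₀ < 1) hx₀ (k + 2)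
  have h3 := p.lyapReal_nonneg hκ hδ (p.outer Q κ δ ρ₀ x₀ D (k + 1)).y
    (p.consistent_outer hκ hδ ρ₀ x₀ D (k + 1) (Q := Q)).feasible
  have hD0 : 0 < Real.sqrt (p.q κ) - ρ₀ := by linarith
  set r := p.lyapReal κ δ (p.outer Q κ δ ρ₀ x₀ D (k + 1)).y (p.outer Q κ δ ρ₀ x₀ D (k + 1)).s
        / p.tol ρ₀ x₀ (k + 2)
  have hr : 0 ≤ r := div_nonneg h3 h2.le
  set X := p.logArg κ δ ρ₀
  have h4 : r ≤ 434 * X ^ 4 := by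
    refine hw.trans ?_
    have e : (p.lam + κ) / p.lam / (Real.sqrt (p.q κ) - ρ₀) ^ 4
        = (p.lam + κ) / p.lam / (Real.sqrt (p.q κ) - ρ₀) * (1 / (Real.sqrt (p.q κ) - ρ₀)) ^ 3 := by
      field_simp
    have : (p.lam + κ) / p.lam / (Real.sqrt (p.q κ) - ρ₀) ^ 4 ≤ X * X ^ 3 := by
      rw [e]
      gcongr
    calc _ ≤ 434 * (X * X ^ 3) := by gcongr
      _ = _ := by ring
  -- One power of `X` comes from `N B` and four from the warm start; `35 · 434 + 1 ≤ 2 ^ 14`.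
  calc _ ≤ Real.log (2 ^ 14 * X ^ 5) := by
        refine Real.log_le_log (by positivity) ?_
        have k1 : 35 * ((m : ℝ) * n * p.rate κ δ) * r ≤ 35 * X * (434 * X ^ 4) := by gcongr
        have k2 : 1 ≤ X ^ 5 := one_le_pow₀ hX1
        have k3 : 35 * X * (434 * X ^ 4) = 15190 * X ^ 5 := by ring
        linarith
    _ = Real.log (2 ^ 14) + 5 * Real.log X := by
        rw [Real.log_mul (by positivity) (by positivity), Real.log_pow X 5]
        norm_num
    _ ≤ _ := by
        have := log_two_pow_le 14
        push_cast at this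
        linarith

end

/-! ### Expected number of inner iterations in each outer loop -/

section

variable {S Ω : Type*} [MeasurableSpace S] [MeasurableSpace Ω]
  {ν : Measure S} {μ : Measure Ω}
  {Q : Vec d → S → Vec d} {Z : ℕ → ℕ → Fin n → Ω → Fin m × S} {ρ₀ : ℝ} {x₀ : Vec d}

theorem measurable_innerCount (hκ : 0 ≤ κ) (hδ : 0 < δ) (hQ : IsContractionCompressor ν Q δ)
    (hZ : AreDraws ν μ Z) (k : ℕ) :
    Measurable fun ω => ((p.innerCount Q κ δ ρ₀ x₀ (fun k K τ => Z k K τ ω) (k + 1) : ℕ∞) : ℝ≥0∞) := by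
  obtain ⟨-, hy, hs⟩ := p.measurable_outer hκ hδ hQ.measurable ρ₀ x₀
    (D := fun ω k K τ => Z k K τ ω) k fun j _ K τ => hZ.measurable j K τ
  exact measurable_from_top.comp (p.measurable_stopTime hκ hδ hQ.measurable (p.tol ρ₀ x₀ (k + 1)) hy
    hs (fun L τ => hZ.measurable (k + 1) L τ)
    fun ω => p.consistent_outer hκ hδ ρ₀ x₀ (fun k K τ => Z k K τ ω) k)

theorem _root_.AreDraws.isLoopDraw {n m : ℕ} {S Ω : Type*} [MeasurableSpace S] [MeasurableSpace Ω]
    {ν : Measure S} {μ : Measure Ω} {Z : ℕ → ℕ → Fin n → Ω → Fin m × S} (hZ : AreDraws ν μ Z)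
    (k : ℕ) : IsLoopDraw ν μ (Z k) where
  measurable := hZ.measurable k
  indep := hZ.indep.precomp (g := fun j : ℕ × Fin n => (k, j.1, j.2)) fun i j h => by
    simp only [Prod.mk.injEq, true_and] at h
    exact Prod.ext h.1 h.2
  law := hZ.law k

variable [IsProbabilityMeasure ν] [IsProbabilityMeasure μ]

/-- A bound for the expected number of iterations of an inner loop, given a bound for the initial
value of the Lyapunov function. -/
theorem lintegral_innerCount_le (hκ : 0 ≤ κ) (hδ : 0 < δ) (hδ1 : δ < 1) (hρ : ρ₀ < 1)
    (hx₀ : p.optVal < p.obj x₀) (hQ : IsContractionCompressor ν Q δ) (hZ : AreDraws ν μ Z) (k : ℕ)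
    {b : ℝ} (hb : ∀ᵐ ω ∂μ, Real.log (1 + 35 * ((m : ℝ) * n * p.rate κ δ) *
      (p.lyapReal κ δ (p.outer Q κ δ ρ₀ x₀ (fun k K τ => Z k K τ ω) k).y
        (p.outer Q κ δ ρ₀ x₀ (fun k K τ => Z k K τ ω) k).s / p.tol ρ₀ x₀ (k + 1))) ≤ b) :
    ∫⁻ ω, ((p.innerCount Q κ δ ρ₀ x₀ (fun k K τ => Z k K τ ω) (k + 1) : ℕ∞) : ℝ≥0∞) ∂μ
      ≤ ENNReal.ofReal (16 * p.rate κ δ * (2 + b)) := by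
  have hB := p.two_le_rate hκ hδ hδ1
  have htol := p.tol_pos hρ hx₀ (k + 1)
  set o : Ω → OuterState d t n m := fun ω => p.outer Q κ δ ρ₀ x₀ (fun k K τ => Z k K τ ω) k with ho
  have hcons : ∀ ω, p.Consistent κ (o ω).s := fun ω =>
    p.consistent_outer hκ hδ ρ₀ x₀ (fun k K τ => Z k K τ ω) k
  -- The past is summarized by the prox-center and the starting state. The subtype keeps consistency
  -- at every point of the space, as measurability of the stopping time requires.
  set X : Ω → Vec d × {s : SDCAState d t n m // p.Consistent κ s} :=
    fun ω => ((o ω).y, ⟨(o ω).s, hcons ω⟩) with hX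
  set Y : Ω → ℕ → Fin n → Fin m × S := fun ω K τ => Z (k + 1) K τ ω with hY
  have hXm' : ∀ mΩ : MeasurableSpace Ω, (∀ j ≤ k, ∀ K τ, Measurable[mΩ] (Z j K τ)) →
      Measurable[mΩ] X := by
    intro mΩ hm
    obtain ⟨-, hy, hs⟩ := @measurable_outer d t n m p κ δ S Ω _ mΩ Q hκ hδ hQ.measurable ρ₀ x₀
      (fun ω k K τ => Z k K τ ω) k hm
    exact hy.prodMk hs.subtype_mk
  have hXm : Measurable X := hXm' _ fun j _ K τ => hZ.measurable j K τ
  have hYm : Measurable Y := measurable_pi_lambda _ fun K => measurable_pi_lambda _ fun τ =>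
    hZ.measurable (k + 1) K τ
  have hind : IndepFun X Y μ := by
    refine indepFun_of_disjoint (A := {j | j.1 ≤ k}) (B := {j | j.1 = k + 1})
      (fun j : ℕ × ℕ × Fin n => hZ.measurable j.1 j.2.1 j.2.2) hZ.indep ?_ ?_ ?_
    · rw [Set.disjoint_left]
      rintro j (h1 : j.1 ≤ k) (h2 : j.1 = k + 1)
      omega
    · refine hXm' _ fun j hj K τ => ?_
      exact measurable_iSup_comap (Z := fun j : ℕ × ℕ × Fin n => Z j.1 j.2.1 j.2.2)
        (i := (j, K, τ)) hj
    · refine @measurable_pi_lambda _ _ _ (_) _ _ fun K => @measurable_pi_lambda _ _ _ (_) _ _ fun τ => ?_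
      exact measurable_iSup_comap (Z := fun j : ℕ × ℕ × Fin n => Z j.1 j.2.1 j.2.2)
        (i := (k + 1, K, τ)) (A := {j | j.1 = k + 1}) rfl
  have hf : Measurable fun z : (Vec d × {s : SDCAState d t n m // p.Consistent κ s}) ×
      (ℕ → Fin n → Fin m × S) =>
      ((p.stopTime Q κ δ z.1.1 (p.tol ρ₀ x₀ (k + 1)) z.2 z.1.2.1 : ℕ∞) : ℝ≥0∞) := by
    refine measurable_from_top.comp (p.measurable_stopTime hκ hδ hQ.measurable
      (p.tol ρ₀ x₀ (k + 1)) (measurable_fst.comp measurable_fst)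
      (measurable_subtype_coe.comp (measurable_snd.comp measurable_fst)) ?_ fun z => z.1.2.2)
    intro L τ
    exact (measurable_pi_apply τ).comp ((measurable_pi_apply L).comp measurable_snd)
  calc _ = ∫⁻ ω, ((p.stopTime Q κ δ (X ω).1 (p.tol ρ₀ x₀ (k + 1)) (Y ω) (X ω).2.1 : ℕ∞) : ℝ≥0∞) ∂μ :=
        rfl
    _ = ∫⁻ ω, ∫⁻ ω', ((p.stopTime Q κ δ (X ω).1 (p.tol ρ₀ x₀ (k + 1)) (Y ω') (X ω).2.1 : ℕ∞)
          : ℝ≥0∞) ∂μ ∂μ := lintegral_indepFun hind hXm hYm hf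
    _ ≤ ∫⁻ _, ENNReal.ofReal (16 * p.rate κ δ * (2 + b)) ∂μ := by
        refine lintegral_mono_ae ?_
        filter_upwards [hb] with ω hω
        refine (p.lintegral_stopTime_le hκ hδ hδ1 hQ (hZ.isLoopDraw (k + 1)) _ (hcons ω) htol).trans ?_
        refine ENNReal.ofReal_le_ofReal ?_
        gcongr
    _ = _ := by rw [lintegral_const, measure_univ, mul_one]

/-- The expected number of inner iterations in every outer loop. -/
theorem lintegral_innerCount_le_rate (hκ : 0 ≤ κ) (hδ : 0 < δ) (hδ1 : δ < 1) (hρ : 0 < ρ₀)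
    (hρq : ρ₀ < Real.sqrt (p.q κ)) (hx₀ : p.optVal < p.obj x₀)
    (hQ : IsContractionCompressor ν Q δ) (hZ : AreDraws ν μ Z) (k : ℕ) :
    ∫⁻ ω, ((p.innerCount Q κ δ ρ₀ x₀ (fun k K τ => Z k K τ ω) (k + 1) : ℕ∞) : ℝ≥0∞) ∂μ
      ≤ ENNReal.ofReal (256 * p.rate κ δ *
          (p.logFactor κ δ ρ₀ + if k + 1 = 1 then p.initLog κ ρ₀ x₀ else 0)) := by
  have hρ1 : ρ₀ < 1 := by linarith [p.sqrt_q_le_one hκ]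
  have hB := p.two_le_rate hκ hδ hδ1
  have hlog : 0 ≤ Real.log (p.logArg κ δ ρ₀) :=
    Real.log_nonneg (p.logArg_bounds hκ hδ hδ1 hρ hρq).1
  have hinit := p.initLog_nonneg hκ hρ1 hx₀
  -- The warm-start bound for a loop presupposes that all earlier loops stopped; the induction
  -- hypothesis provides this almost surely, because their expected counts are finite.
  induction k using Nat.strong_induction_on with
  | _ k ih =>
    cases k with
    | zero =>
      refine (p.lintegral_innerCount_le hκ hδ hδ1 hρ1 hx₀ hQ hZ 0 (Filter.Eventually.of_forall fun ω =>
        p.log_initial_le hκ hδ hδ1 hρ hρq hx₀)).trans ?_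
      refine ENNReal.ofReal_le_ofReal ?_
      rw [if_pos (zero_add 1), logFactor_eq]
      have : 16 * p.rate κ δ * (2 + (6 + Real.log (p.logArg κ δ ρ₀) + p.initLog κ ρ₀ x₀))
          ≤ 16 * p.rate κ δ * (16 * (1 + Real.log (p.logArg κ δ ρ₀) + p.initLog κ ρ₀ x₀)) := by
        gcongr
        linarith
      linarith
    | succ k =>
      have hfin : ∀ᵐ ω ∂μ, ∀ j < k + 1,
          p.innerCount Q κ δ ρ₀ x₀ (fun k K τ => Z k K τ ω) (j + 1) ≠ ⊤ := by
        refine ae_all_iff.2 fun j => Filter.eventually_imp_distrib_left.2 fun hj => ?_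
        have h1 := ae_lt_top (p.measurable_innerCount hκ hδ hQ hZ j (ρ₀ := ρ₀) (x₀ := x₀))
          ((ih j hj).trans_lt ENNReal.ofReal_lt_top).ne
        filter_upwards [h1] with ω hω h2
        rw [h2] at hω
        simp at hω
      refine (p.lintegral_innerCount_le hκ hδ hδ1 hρ1 hx₀ hQ hZ (k + 1) (b := 14 + 5 *
        Real.log (p.logArg κ δ ρ₀)) ?_).trans ?_
      · filter_upwards [hfin] with ω hω
        exact p.log_warm_le hκ hδ hδ1 hρ hρq hx₀ k hω
      · refine ENNReal.ofReal_le_ofReal ?_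
        rw [if_neg (by omega), logFactor_eq]
        have : 16 * p.rate κ δ * (2 + (14 + 5 * Real.log (p.logArg κ δ ρ₀)))
          ≤ 16 * p.rate κ δ * (16 * (1 + Real.log (p.logArg κ δ ρ₀) + 0)) := by
          gcongr
          linarith
        linarith

theorem ae_innerCount_ne_top (hκ : 0 ≤ κ) (hδ : 0 < δ) (hδ1 : δ < 1) (hρ : 0 < ρ₀)
    (hρq : ρ₀ < Real.sqrt (p.q κ)) (hx₀ : p.optVal < p.obj x₀)
    (hQ : IsContractionCompressor ν Q δ) (hZ : AreDraws ν μ Z) :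
    ∀ᵐ ω ∂μ, ∀ k, p.innerCount Q κ δ ρ₀ x₀ (fun k K τ => Z k K τ ω) (k + 1) ≠ ⊤ := by
  rw [ae_all_iff]
  intro k
  have h1 := ae_lt_top (p.measurable_innerCount hκ hδ hQ hZ k (ρ₀ := ρ₀) (x₀ := x₀))
    ((p.lintegral_innerCount_le_rate hκ hδ hδ1 hρ hρq hx₀ hQ hZ k).trans_lt ENNReal.ofReal_lt_top).ne
  filter_upwards [h1] with ω hω h2
  rw [h2] at hω
  simp at hω

end

/-! ### Communication cost and number of outer loops -/

section

variable {S : Type*} {Q : Vec d → S → Vec d} {ρ₀ : ℝ} {x₀ : Vec d} {D : ℕ → ℕ → Fin n → Fin m × S}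

theorem inner_sent (y : Vec d) (D : ℕ → Fin n → Fin m × S) (s : SDCAState d t n m) (K : ℕ) :
    (p.inner Q κ δ y D s K).compressedSent = s.compressedSent + K ∧
      (p.inner Q κ δ y D s K).uncompressedSent = s.uncompressedSent := by
  induction K with
  | zero => exact ⟨rfl, rfl⟩
  | succ K ih =>
    refine ⟨?_, ih.2⟩
    change (p.inner Q κ δ y D s K).compressedSent + 1 = _
    rw [ih.1, add_assoc]

theorem outer_uncompressedSent (k : ℕ) : (p.outer Q κ δ ρ₀ x₀ D k).s.uncompressedSent = 0 := by
  induction k with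
  | zero => rfl
  | succ k ih => exact (p.inner_sent _ _ _ _).2.trans ih

/-- Only an inequality, because a loop that never stops has infinite count while `toNat` records
`0`; it therefore holds on every path. -/
theorem outer_compressedSent_le (k : ℕ) :
    ((p.outer Q κ δ ρ₀ x₀ D k).s.compressedSent : ℝ≥0∞)
      ≤ ∑ j ∈ Finset.range k, ((p.innerCount Q κ δ ρ₀ x₀ D (j + 1) : ℕ∞) : ℝ≥0∞) := by
  induction k with
  | zero => simp [outer, SDCAState.zero]
  | succ k ih =>
    have h : (p.outer Q κ δ ρ₀ x₀ D (k + 1)).s.compressedSent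
        = (p.outer Q κ δ ρ₀ x₀ D k).s.compressedSent
          + (p.innerCount Q κ δ ρ₀ x₀ D (k + 1)).toNat := (p.inner_sent _ _ _ _).1
    rw [h, Finset.sum_range_succ, Nat.cast_add]
    gcongr
    have h2 : (((p.innerCount Q κ δ ρ₀ x₀ D (k + 1)).toNat : ℕ) : ℕ∞)
        ≤ p.innerCount Q κ δ ρ₀ x₀ D (k + 1) := ENat.natCast_toNat_le_self _
    simpa using ENat.toENNReal_le.2 h2

theorem commCost_le (rQ Ud : ℝ≥0) (k : ℕ) :
    p.commCost Q κ δ ρ₀ x₀ D rQ Ud k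
      ≤ rQ * ∑ j ∈ Finset.range k, ((p.innerCount Q κ δ ρ₀ x₀ D (j + 1) : ℕ∞) : ℝ≥0∞) := by
  simp only [commCost, p.outer_uncompressedSent, Nat.cast_zero, zero_mul, add_zero]
  rw [mul_comm]
  gcongr
  exact p.outer_compressedSent_le k

theorem rate_div_sqrt_q (hκ : 0 ≤ κ) :
    p.rate κ δ / Real.sqrt (p.q κ) = 1 / Real.sqrt p.lam *
      ((1 / δ + m) * Real.sqrt (p.lam + κ) + p.a3 δ / Real.sqrt (p.lam + κ) + p.b3 δ) := by
  have hL := p.lam_add_pos hκ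
  have h1 : 0 < Real.sqrt p.lam := Real.sqrt_pos.2 p.lam_pos
  have h2 : 0 < Real.sqrt (p.lam + κ) := Real.sqrt_pos.2 hL
  have h3 : p.lam + κ = Real.sqrt (p.lam + κ) ^ 2 := (Real.sq_sqrt hL.le).symm
  rw [rate, q, Real.sqrt_div p.lam_pos.le]
  nth_rw 1 [h3]
  generalize Real.sqrt (p.lam + κ) = r at h2 ⊢
  generalize 1 / δ + (m : ℝ) = c
  field_simp

/-- The number of outer loops that is needed for accuracy `ε`. -/
theorem exists_outer_count {a ρ g ε : ℝ} (hρ : 0 < ρ) (hρa : ρ < a) (ha : a ≤ 1) (hρ2 : a / 2 ≤ ρ)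
    (hε : 0 < ε) (hεg : ε ≤ g) :
    ∃ k : ℕ, 8 / (a - ρ) ^ 2 * g * (1 - ρ) ^ k ≤ ε ∧
      (k : ℝ) ≤ (7 + 4 * Real.log (1 / (a - ρ)) + 2 * Real.log (g / ε)) / a := by
  have hd : 0 < a - ρ := by linarith
  have hg : 0 < g := by linarith
  have ha0 : 0 < a := by linarith
  have h1 : 1 ≤ 1 / (a - ρ) := by rw [one_le_div hd]; linarith
  have h2 : 1 ≤ g / ε := by rwa [one_le_div hε]
  have hl1 := Real.log_nonneg h1
  have hl2 := Real.log_nonneg h2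
  set A := 8 / (a - ρ) ^ 2 * (g / ε) with hA
  have hA0 : 0 < A := by positivity
  have hlogA : Real.log A ≤ 3 + 2 * Real.log (1 / (a - ρ)) + Real.log (g / ε) := by
    have e : A = 2 ^ 3 * (1 / (a - ρ)) ^ 2 * (g / ε) := by rw [hA]; field_simp; norm_num
    rw [e, Real.log_mul (by positivity) (by positivity), Real.log_mul (by positivity) (by positivity),
      Real.log_pow (1 / (a - ρ)) 2]
    have h23 : Real.log ((2 : ℝ) ^ 3) ≤ 3 := by exact_mod_cast log_two_pow_le 3
    rw [Nat.cast_ofNat]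
    gcongr
  have hlogA0 : 0 ≤ Real.log A := by
    refine Real.log_nonneg ?_
    have : 1 ≤ 8 / (a - ρ) ^ 2 := by
      rw [one_le_div (by positivity)]; nlinarith
    exact one_le_mul_of_one_le_of_one_le this h2
  -- From `(1 - ρ)^k ≤ exp(-ρ k)` this `k` brings the error to `ε`. Since `ρ ≥ a/2`, it is at most
  -- `(2 log A + 1)/a`, hence the constants `7 = 2 · 3 + 1`, `4` and `2`.
  refine ⟨⌈Real.log A / ρ⌉₊, ?_, ?_⟩
  · have h3 : Real.log A ≤ ρ * (⌈Real.log A / ρ⌉₊ : ℝ) := by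
      have := Nat.le_ceil (Real.log A / ρ)
      rw [div_le_iff₀ hρ] at this
      linarith
    have h4 : (1 - ρ) ^ ⌈Real.log A / ρ⌉₊ ≤ A⁻¹ := by
      calc (1 - ρ) ^ ⌈Real.log A / ρ⌉₊ ≤ Real.exp (-ρ) ^ ⌈Real.log A / ρ⌉₊ :=
            pow_le_pow_left₀ (by linarith) (by linarith [Real.add_one_le_exp (-ρ)]) _
        _ = Real.exp (-(ρ * (⌈Real.log A / ρ⌉₊ : ℝ))) := by
            rw [← Real.exp_nat_mul]; congr 1; ring
        _ ≤ Real.exp (-Real.log A) := Real.exp_le_exp.2 (by linarith)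
        _ = A⁻¹ := by rw [Real.exp_neg, Real.exp_log hA0]
    calc _ = ε * A * (1 - ρ) ^ ⌈Real.log A / ρ⌉₊ := by rw [hA]; field_simp
      _ ≤ ε * A * A⁻¹ := by gcongr
      _ = ε := by field_simp
  · have h3 := (Nat.ceil_lt_add_one (by positivity : 0 ≤ Real.log A / ρ)).le
    have h4 : Real.log A / ρ ≤ 2 * Real.log A / a := by
      rw [div_le_div_iff₀ hρ ha0]; nlinarith
    have h5 : 1 ≤ 1 / a := by rw [one_le_div ha0]; exact ha
    calc _ ≤ 2 * Real.log A / a + 1 / a := by linarith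
      _ = (2 * Real.log A + 1) / a := by ring
      _ ≤ _ := div_le_div_of_nonneg_right (by linarith) ha0.le

end

end SumProblem

/-! ### Assembly of the three claims -/

theorem mainTheorem9 :
    ∃ C : ℝ, 0 < C ∧
      ∀ (d t n m : ℕ) (p : SumProblem d t n m) (κ δ ρ₀ : ℝ) (x₀ : Vec d)
        (S : Type*) [MeasurableSpace S] (ν : Measure S) [IsProbabilityMeasure ν]
        (Q : Vec d → S → Vec d)
        (Ω : Type*) [MeasurableSpace Ω] (μ : Measure Ω) [IsProbabilityMeasure μ]
        (Z : ℕ → ℕ → Fin n → Ω → Fin m × S),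
        0 ≤ κ → 0 < δ → δ < 1 → 0 < ρ₀ → ρ₀ < Real.sqrt (p.q κ) →
        p.optVal < p.obj x₀ →
        IsContractionCompressor ν Q δ →
        AreDraws ν μ Z →
        -- the invariant, and no uncompressed vector is ever sent
        (∀ ω, ∀ k ≥ 1, ∀ K,
          let s := p.innerState Q κ δ ρ₀ x₀ (fun k K τ => Z k K τ ω) k K
          s.u + (1 / (n : ℝ)) • ∑ τ, s.e τ = p.dualToPrimal κ s.α ∧ s.uncompressedSent = 0) ∧
        -- the expected number of inner iterations
        (∀ k ≥ 1,
          ∫⁻ ω, ((p.innerCount Q κ δ ρ₀ x₀ (fun k K τ => Z k K τ ω) k : ℕ∞) : ℝ≥0∞) ∂μ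
            ≤ ENNReal.ofReal (C * p.rate κ δ *
                (p.logFactor κ δ ρ₀ + if k = 1 then p.initLog κ ρ₀ x₀ else 0))) ∧
        -- the expected communication cost of an `ε`-accurate solution
        (Real.sqrt (p.q κ) / 2 ≤ ρ₀ →
          ∀ (rQ Ud : ℝ≥0) (ε : ℝ), 0 < ε → ε ≤ p.obj x₀ - p.optVal →
            ∃ k : ℕ,
              (∀ᵐ ω ∂μ,
                p.obj (p.outer Q κ δ ρ₀ x₀ (fun k K τ => Z k K τ ω) k).x - p.optVal ≤ ε) ∧
              ∫⁻ ω, p.commCost Q κ δ ρ₀ x₀ (fun k K τ => Z k K τ ω) rQ Ud k ∂μ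
                ≤ ENNReal.ofReal (C * (rQ / Real.sqrt p.lam) *
                    ((1 / δ + m) * Real.sqrt (p.lam + κ) + p.a3 δ / Real.sqrt (p.lam + κ) + p.b3 δ)
                    * p.logFactor κ δ ρ₀ ^ 2
                    * (1 + Real.log ((p.obj x₀ - p.optVal) / ε) + p.initLog κ ρ₀ x₀))) := by
  -- The constant is `256 · 7`: `256` for one inner loop and `7` for the number of outer loops.
  refine ⟨1792, by norm_num, ?_⟩
  intro d t n m p κ δ ρ₀ x₀ S _ ν _ Q Ω _ μ _ Z hκ hδ hδ1 hρ hρq hx₀ hQ hZ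
  have hρ1 : ρ₀ < 1 := by linarith [p.sqrt_q_le_one hκ]
  have hB := p.two_le_rate hκ hδ hδ1
  obtain ⟨hX1, -, hX3, -⟩ := p.logArg_bounds hκ hδ hδ1 hρ hρq
  have hlog : 0 ≤ Real.log (p.logArg κ δ ρ₀) := Real.log_nonneg hX1
  have hinit := p.initLog_nonneg hκ hρ1 hx₀
  have hLdef := p.logFactor_eq (κ := κ) (δ := δ) (ρ₀ := ρ₀)
  have hL : 1 ≤ p.logFactor κ δ ρ₀ := by rw [hLdef]; linarith
  refine ⟨fun ω k _ K => ⟨?_, ?_⟩, fun k hk => ?_, fun hρ2 rQ Ud ε hε hεg => ?_⟩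
  · exact ((p.consistent_outer hκ hδ ρ₀ x₀ (fun k K τ => Z k K τ ω) (k - 1)).inner p hκ hδ _ _ K).sum_eq
  · exact (p.inner_sent _ _ _ _).2.trans (p.outer_uncompressedSent _)
  · obtain ⟨k, rfl⟩ := Nat.exists_eq_add_of_le' hk
    refine (p.lintegral_innerCount_le_rate hκ hδ hδ1 hρ hρq hx₀ hQ hZ k).trans
      (ENNReal.ofReal_le_ofReal ?_)
    have : 0 ≤ p.logFactor κ δ ρ₀ + if k + 1 = 1 then p.initLog κ ρ₀ x₀ else 0 := by
      split_ifs <;> linarith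
    gcongr
    norm_num
  · obtain ⟨k, hk, hkle⟩ := SumProblem.exists_outer_count hρ hρq (p.sqrt_q_le_one hκ) hρ2 hε hεg
    refine ⟨k, ?_, ?_⟩
    · obtain ⟨xs, hxs, hgrow⟩ := p.exists_isMin_obj
      filter_upwards [p.ae_innerCount_ne_top hκ hδ hδ1 hρ hρq hx₀ hQ hZ] with ω hω
      have h1 := p.outer_converges hκ hδ hρ hρq k (fun j _ => hω j) hxs hgrow
      have h2 : 0 ≤ p.lam / 2 *
          ‖xs - p.outerAux Q κ δ ρ₀ x₀ (fun k K τ => Z k K τ ω) k‖ ^ 2 := by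
        have := p.lam_pos
        positivity
      linarith
    · set L := p.logFactor κ δ ρ₀
      set I := p.initLog κ ρ₀ x₀
      set a := Real.sqrt (p.q κ)
      set lg := Real.log ((p.obj x₀ - p.optVal) / ε)
      have hlg : 0 ≤ lg := Real.log_nonneg (by rwa [one_le_div hε])
      have ha0 : 0 < a := by linarith
      have hterm : ∀ j ∈ Finset.range k, (0 : ℝ) ≤ 256 * p.rate κ δ *
          (L + if j + 1 = 1 then I else 0) := by
        intro j _
        have : 0 ≤ L + if j + 1 = 1 then I else 0 := by split_ifs <;> linarith
        positivity
      calc _ ≤ ∫⁻ ω, rQ * ∑ j ∈ Finset.range k,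
            ((p.innerCount Q κ δ ρ₀ x₀ (fun k K τ => Z k K τ ω) (j + 1) : ℕ∞) : ℝ≥0∞) ∂μ :=
            lintegral_mono fun ω => p.commCost_le rQ Ud k
        _ = rQ * ∑ j ∈ Finset.range k, ∫⁻ ω,
            ((p.innerCount Q κ δ ρ₀ x₀ (fun k K τ => Z k K τ ω) (j + 1) : ℕ∞) : ℝ≥0∞) ∂μ := by
            rw [lintegral_const_mul' _ _ ENNReal.coe_ne_top,
              lintegral_finsetSum _ fun j _ => p.measurable_innerCount hκ hδ hQ hZ j]
        _ ≤ rQ * ∑ j ∈ Finset.range k, ENNReal.ofReal (256 * p.rate κ δ *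
            (L + if j + 1 = 1 then I else 0)) := by
            gcongr with j _
            exact p.lintegral_innerCount_le_rate hκ hδ hδ1 hρ hρq hx₀ hQ hZ j
        _ = ENNReal.ofReal (rQ * ∑ j ∈ Finset.range k, 256 * p.rate κ δ *
            (L + if j + 1 = 1 then I else 0)) := by
            rw [ENNReal.ofReal_mul (NNReal.coe_nonneg rQ), ENNReal.ofReal_sum_of_nonneg hterm, ENNReal.ofReal_coe_nnreal]
        _ ≤ _ := by
            refine ENNReal.ofReal_le_ofReal ?_
            have hsum : ∑ j ∈ Finset.range k, (L + if j + 1 = 1 then I else 0) ≤ k * L + I := by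
              rw [Finset.sum_add_distrib, Finset.sum_const, Finset.card_range, nsmul_eq_mul]
              gcongr
              simp only [Nat.add_eq_right, Finset.sum_ite_eq', Finset.mem_range]
              split_ifs <;> linarith
            -- One factor `L` is the price of an inner loop and the other bounds `log (1/(√q - ρ₀))`
            -- in the outer count; `I` is paid once, by the first loop.
            have hkL : k * L + I ≤ 7 / a * (L ^ 2 * (1 + lg + I)) := by
              have k1 : Real.log (1 / (a - ρ₀)) ≤ Real.log (p.logArg κ δ ρ₀) :=
                Real.log_le_log (by have : 0 < a - ρ₀ := by linarith
                                    positivity) hX3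
              have k2 : 7 + 4 * Real.log (1 / (a - ρ₀)) + 2 * lg ≤ 7 * (L * (1 + lg)) := by
                nlinarith [mul_nonneg hlog hlg]
              have k3 : (k : ℝ) ≤ 7 * (L * (1 + lg)) / a := hkle.trans (by gcongr)
              have k4 : k * L ≤ 7 * (L * (1 + lg)) / a * L := by gcongr
              have k5 : I ≤ 7 / a * (L ^ 2 * I) := by
                have : 1 ≤ 7 / a := by
                  rw [one_le_div ha0]; linarith [p.sqrt_q_le_one hκ]
                have h2 : 1 ≤ L ^ 2 := one_le_pow₀ hL
                rw [← mul_assoc]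
                exact le_mul_of_one_le_left hinit (one_le_mul_of_one_le_of_one_le this h2)
              calc _ ≤ 7 * (L * (1 + lg)) / a * L + 7 / a * (L ^ 2 * I) := add_le_add k4 k5
                _ = _ := by ring
            have hr := p.rate_div_sqrt_q (δ := δ) hκ
            rw [← Finset.mul_sum]
            calc (rQ : ℝ) * (256 * p.rate κ δ * ∑ j ∈ Finset.range k, (L + if j + 1 = 1 then I else 0))
                ≤ rQ * (256 * p.rate κ δ * (7 / a * (L ^ 2 * (1 + lg + I)))) := by
                  gcongr
                  exact hsum.trans hkL
              _ = 1792 * rQ * (p.rate κ δ / a) * L ^ 2 * (1 + lg + I) := by ring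
              _ = _ := by rw [hr]; ring
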